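/- **Theorem (non-Hermitian soft/hard edge scaling limit).** Write $dA(\zeta)=\frac1\pi d^2\zeta$ for the normalised area measure on $\mathbb C$. Let $Q(\zeta)=|\zeta|^2$ if $|\zeta|\le\sqrt2$ and $Q(\zeta)=+\infty$ otherwise, and for $N\ge1$ consider the planar symplectic ensemble $\boldsymbol\zeta=(\zeta_1,\dots,\zeta_N)\in\mathbb C^N$ with joint probability distribution $$ d\mathbf P_N(\boldsymbol\zeta)=\frac1{Z_N}\prod_{1\le k<j\le N}|\zeta_j-\zeta_k|^2\,|\zeta_j-\overline{\zeta}_k|^2\ \prod_{j=1}^N|\zeta_j-\overline{\zeta}_j|^2e^{-NQ(\zeta_j)}\,dA(\zeta_j), $$ where $Z_N$ is the normalising constant. Denote by $\mathbf P_N(\zeta_1,\dots,\zeta_N)$ also its density with respect to $\prod_j dA(\zeta_j)$, and let $$ \mathbf R_{N,k}(\zeta_1,\dots,\zeta_k)=\frac{N!}{(N-k)!}\int_{\mathbb C^{N-k}}\mathbf P_N(\zeta_1,\dots,\zeta_N)\prod_{j=k+1}^N dA(\zeta_j) $$ be its $k$-point correlation function. Let $p=\sqrt2$ or $p=-\sqrt2$,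 let $\theta$ be the angle of the outward normal of the disc $\{|\zeta|\le\sqrt2\}$ at $p$ (so $e^{i\theta}=p/|p|$), and let $\gamma_N=1/\sqrt{N\delta}$ with $\delta=\frac12\,\partial\bar\partial Q(p)=\frac12$ (derivatives taken from within the disc), i.e. $\gamma_N=\sqrt{2/N}$. Let $$ R_{N,k}(z_1,\dots,z_k)=\gamma_N^{2k}\,\mathbf R_{N,k}\big(p+e^{i\theta}\gamma_Nz_1,\dots,p+e^{i\theta}\gamma_Nz_k\big) $$ be the $k$-point correlation function of the rescaled process $z_j=e^{-i\theta}\gamma_N^{-1}(\zeta_j-p)$. Then for every $k$, as $N\to\infty$, $R_{N,k}$ converges locally uniformly on $\{(z_1,\dots,z_k)\in\mathbb C^k:\operatorname{Re}z_j<0 \text{ for all } j\}$ to $$ R_k(z_1,\dots,z_k)=\prod_{j=1}^k(\overline z_j-z_j)\ \mathrm{Pf}\Big[e^{-|z_j|^2-|z_l|^2}\begin{pmatrix}\kappa(z_j,z_l)&\kappa(z_j,\overline z_l)\\ \kappa(\overline z_j,z_l)&\kappa(\overline z_j,\overline z_l)\end{pmatrix}\Big]_{j,l=1}^k, $$ where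 $\mathrm{Pf}(A)=\frac1{2^nn!}\sum_{\sigma\in S_{2n}}\operatorname{sgn}(\sigma)\prod_{j=1}^na_{\sigma(2j-1),\sigma(2j)}$ for a skew-symmetric $2n\times2n$ matrix $A=(a_{j,l})$, and where the pre-kernel has the Wronskian form $$ \kappa(z,w)=\sqrt\pi\,e^{z^2+w^2}\int_EW(f_w,f_z)(u)\,du,\qquad W(f,g)=fg'-gf', $$ with $$ f_z(u)=\frac2{\sqrt\pi}\int_{-\infty}^u\frac{e^{-2(z-t)^2}}{\sqrt{\operatorname{erfc}(2t)}}\,dt,\qquad E=(-\infty,0),\qquad \operatorname{erfc}(x)=\frac2{\sqrt\pi}\int_x^\infty e^{-t^2}\,dt . $$ -/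

import Mathlib

open scoped ComplexConjugate

noncomputable section

namespace PlanarSymplectic

/-- The measure `dA = d²ζ / π` on the complex plane. -/
def areaMeasure : MeasureTheory.Measure ℂ :=
  NNReal.pi⁻¹ • (MeasureTheory.volume : MeasureTheory.Measure ℂ)

instance sigmaFinite_areaMeasure : MeasureTheory.SigmaFinite areaMeasure := by
  unfold areaMeasure
  infer_instance

/-- The soft/hard edge Ginibre potential: `|ζ|²` for `|ζ| ≤ √2` and `+∞` otherwise. -/
def softHardPotential (ζ : ℂ) : EReal :=
  if ‖ζ‖ ≤ √2 then ((‖ζ‖ ^ 2 : ℝ) : EReal) else ⊤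

/-- The Boltzmann factor `e^{-N Q(ζ)}`; it vanishes where `Q = +∞` (for `N ≥ 1`). -/
def boltzmann (N : ℕ) (Q : ℂ → EReal) (ζ : ℂ) : ℝ :=
  (EReal.exp (-((N : EReal) * Q ζ))).toReal

/-- The unnormalised joint density, with respect to `∏ dA(ζ_j)`, of the planar symplectic
ensemble of `N` particles in the external potential `Q`. -/
def gibbsWeight (N : ℕ) (Q : ℂ → EReal) (ζ : Fin N → ℂ) : ℝ :=
  (∏ j : Fin N, ∏ k ∈ Finset.Iio j, ‖ζ j - ζ k‖ ^ 2 * ‖ζ j - conj (ζ k)‖ ^ 2) *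
    ∏ j : Fin N, ‖ζ j - conj (ζ j)‖ ^ 2 * boltzmann N Q (ζ j)

/-- The partition function `Z_N`. -/
def partitionFunction (N : ℕ) (Q : ℂ → EReal) : ℝ :=
  ∫ ζ : Fin N → ℂ, gibbsWeight N Q ζ ∂(MeasureTheory.Measure.pi fun _ => areaMeasure)

/-- The joint probability density `P_N`. -/
def gibbsDensity (N : ℕ) (Q : ℂ → EReal) (ζ : Fin N → ℂ) : ℝ :=
  gibbsWeight N Q ζ / partitionFunction N Q

/-- The configuration `(ζ_1, …, ζ_k, η_1, …, η_{N-k})` of `N` points (for `k > N`, the first `N`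
of the points `ζ_j`). -/
def joinConfig (N k : ℕ) (ζ : Fin k → ℂ) (η : Fin (N - k) → ℂ) : Fin N → ℂ := fun i =>
  if h : (i : ℕ) < k then ζ ⟨i, h⟩ else η ⟨i - k, by have := i.isLt; omega⟩

/-- The `k`-point correlation function
`N! / (N-k)! ∫ P_N(ζ_1, …, ζ_N) dA(ζ_{k+1}) ⋯ dA(ζ_N)`. The prefactor is the falling factorial
`N (N-1) ⋯ (N-k+1)`, which is `0` for `k > N`. -/
def corrFun (N : ℕ) (Q : ℂ → EReal) (k : ℕ) (ζ : Fin k → ℂ) : ℝ :=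
  (N.descFactorial k : ℝ) *
    ∫ η : Fin (N - k) → ℂ, gibbsDensity N Q (joinConfig N k ζ η)
      ∂(MeasureTheory.Measure.pi fun _ => areaMeasure)

/-- `∂∂̄ Q (p)`, a quarter of the usual Laplacian of `Q` at `p`. Derivatives are taken within the
set where `Q` is finite, so that this makes sense at points of the hard wall. -/
def ddbar (Q : ℂ → EReal) (p : ℂ) : ℝ :=
  InnerProductSpace.laplacianWithin (fun ζ => (Q ζ).toReal) {ζ | Q ζ ≠ ⊤} p / 4

/-- The microscopic scale `γ_N = 1 / √(N δ)` with `δ = ∂∂̄ Q (p) / 2`. -/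
def microScale (N : ℕ) (Q : ℂ → EReal) (p : ℂ) : ℝ :=
  1 / √((N : ℝ) * (ddbar Q p / 2))

/-- The `k`-point correlation function, with respect to `∏ dA(z_j)`, of the rescaled process
`z_j = e^{-iθ} γ_N⁻¹ (ζ_j - p)`, that is, `γ_N^{2k}` times the correlation function at
`ζ_j = p + e^{iθ} γ_N z_j`. -/
def rescaledCorrFun (N : ℕ) (Q : ℂ → EReal) (p : ℂ) (θ : ℝ) (k : ℕ) (z : Fin k → ℂ) : ℝ :=
  microScale N Q p ^ (2 * k) *
    corrFun N Q k fun j => p + Complex.exp (θ * Complex.I) * microScale N Q p * z j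

/-- The Pfaffian of a `2n × 2n` matrix. The rows and columns are indexed by `Fin n × Fin 2`, where
`(j, 0)` and `(j, 1)` stand for the positions `2j - 1` and `2j` (`j = 1, …, n`). -/
def pfaffian {n : ℕ} (A : Matrix (Fin n × Fin 2) (Fin n × Fin 2) ℂ) : ℂ :=
  1 / ((2 : ℂ) ^ n * (n.factorial : ℂ)) *
    ∑ σ : Equiv.Perm (Fin n × Fin 2),
      ((Equiv.Perm.sign σ : ℤ) : ℂ) * ∏ j : Fin n, A (σ (j, 0)) (σ (j, 1))

/-- The Wronskian `W(f, g) = f g' - g f'` of functions of a real variable. -/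
def wronskian (f g : ℝ → ℂ) (u : ℝ) : ℂ :=
  f u * deriv g u - g u * deriv f u

/-- The pre-kernel of Wronskian form
`κ(z, w) = √π e^{z² + w²} ∫_E W(f_w, f_z)(u) du`. -/
def wronskianPreKernel (E : Set ℝ) (f : ℂ → ℝ → ℂ) (z w : ℂ) : ℂ :=
  (√Real.pi : ℂ) * Complex.exp (z ^ 2 + w ^ 2) * ∫ u in E, wronskian (f w) (f z) u

/-- The `2k × 2k` matrix made of the `2 × 2` blocks
`e^{-|z_j|² - |z_l|²} (κ(z_j, z_l), κ(z_j, z̄_l); κ(z̄_j, z_l), κ(z̄_j, z̄_l))`. -/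
def pfaffianMatrix (κ : ℂ → ℂ → ℂ) {k : ℕ} (z : Fin k → ℂ) :
    Matrix (Fin k × Fin 2) (Fin k × Fin 2) ℂ :=
  Matrix.of fun r c =>
    Complex.exp (-((‖z r.1‖ : ℂ) ^ 2) - (‖z c.1‖ : ℂ) ^ 2) *
      !![κ (z r.1) (z c.1), κ (z r.1) (conj (z c.1));
         κ (conj (z r.1)) (z c.1), κ (conj (z r.1)) (conj (z c.1))] r.2 c.2

/-- The Pfaffian `k`-point function
`∏_j (z̄_j - z_j) Pf [e^{-|z_j|² - |z_l|²} (…)]` with pre-kernel `κ`. -/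
def pfaffianCorrFun (κ : ℂ → ℂ → ℂ) (k : ℕ) (z : Fin k → ℂ) : ℂ :=
  (∏ j : Fin k, (conj (z j) - z j)) * pfaffian (pfaffianMatrix κ z)

/-- The complementary error function. -/
def erfc (x : ℝ) : ℝ :=
  2 / √Real.pi * ∫ t in Set.Ioi x, Real.exp (-t ^ 2)

/-- The function
`f_z(u) = (2 / √π) ∫_{-∞}^u e^{-2 (z - t)²} / √(erfc (2 t)) dt`. -/
def softHardEdgeFun (z : ℂ) (u : ℝ) : ℂ :=
  (2 / √Real.pi : ℂ) *
    ∫ t in Set.Iic u, Complex.exp (-2 * (z - (t : ℂ)) ^ 2) / (√(erfc (2 * t)) : ℂ)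

end PlanarSymplectic

end

/-! The weight is radial, so the skew product `∫ (ζ - ζ̄) f(ζ) g(ζ̄) e^{-NQ} dA` couples only
monomials of adjacent degree and its skew-orthogonal polynomials are explicit: the odd ones are
monomials, the even ones have coefficients built from ratios of radial moments. The joint density
is, up to the weight, a Vandermonde determinant in `ζ_1, ζ̄_1, ζ_2, ζ̄_2, …`. Written in these
polynomials, it can be integrated slot by slot, each integrated pair becoming a standard symplectic
form, and finite-dimensional algebra collapses what is left to a Pfaffian
(`factorial_mul_pairSum_sympForm`, `corrFun_eq_pfaffian`). This is exact for every `N`.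

For the asymptotics, the normalised moment of index `m` is the probability `T_m` that a Poisson
variable of mean `2N` exceeds `m`. The hard wall enters only through these tails. The even
polynomials contain `∏ T_{2j+2} / T_{2j+1}`, which does not telescope, but log-concavity of `T`
(`poissonTail_mul_le_sq`) traps its square between two telescoping products. With index `l = N + 2√N
t` the product therefore tends to `√(erfc(2t) / 2)`; this is the origin of the square root in `f_z`.

The remaining factors are Poisson probabilities of mean `N` (a local limit theorem from Stirling's
formula), a tilt `(1 + z/√N)^{2l} e^{-2√N z}` tending to `e^{4tz - z²}`, and a Wallis ratio. Hence
the even summands tend to `e^{z²} f_z'`, their partial sums to `e^{z²} f_z`, and the odd summands to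
`√π/2` times `e^{z²} f_z'`. The double sum defining the kernel is then a Riemann sum for the
Wronskian integral, with Gaussian domination (`tendsto_sum_of_gaussian_bound`,
`tendsto_rescaledPreKernel`).

The kernel converges for all complex arguments. The condition `Re z_j < 0` only ensures that the
rescaled points eventually lie inside the disc, where the weight is the plain exponential. Limits
are taken along a filter on pairs `(N, z)`, so that local uniformity follows from joint convergence.
-/

namespace PlanarSymplectic

open Equiv Finset

/-! ### Pfaffian algebra for integrating out pairs -/

section Combinatorics

variable {α β J : Type*} [Fintype α] [DecidableEq α] [Fintype β] [DecidableEq β]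

/-- The signed sum over all arrangements of the index set in pairs `(σ (j, 0), σ (j, 1))`, with
the `j`-th pair evaluated by the bilinear symbol `F j`. -/
def pairSum (F : α → α × Fin 2 → α × Fin 2 → ℂ) : ℂ :=
  ∑ σ : Perm (α × Fin 2), ((Perm.sign σ : ℤ) : ℂ) * ∏ j : α, F j (σ (j, 0)) (σ (j, 1))

/-- Each difference is a signed sum over the permutations of one pair. Expanding the product gives a
choice of such a permutation for every pair, and all choices contribute equally, since the
relabelling of `σ` by the block permutation absorbs the sign. -/
theorem pairSum_antisymm (F : α → α × Fin 2 → α × Fin 2 → ℂ) :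
    pairSum (fun j x y => F j x y - F j y x) = 2 ^ Fintype.card α * pairSum F := by
  have h1 (σ : Perm (α × Fin 2)) (j : α) :
      F j (σ (j, 0)) (σ (j, 1)) - F j (σ (j, 1)) (σ (j, 0)) =
        ∑ π : Perm (Fin 2), ((Perm.sign π : ℤ) : ℂ) * F j (σ (j, π 0)) (σ (j, π 1)) := by
    have h2 : (univ : Finset (Perm (Fin 2))) = {1, swap 0 1} := by decide
    have h3 : (1 : Perm (Fin 2)) ≠ swap 0 1 := by decide
    rw [h2, sum_pair h3, Perm.sign_swap (by decide)]
    simp [sub_eq_add_neg]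
  unfold pairSum
  simp_rw [h1, Fintype.prod_sum, mul_sum]
  rw [sum_comm]
  have h4 (π : α → Perm (Fin 2)) :
      ∑ σ : Perm (α × Fin 2), ((Perm.sign σ : ℤ) : ℂ) *
          ∏ j, ((Perm.sign (π j) : ℤ) : ℂ) * F j (σ (j, π j 0)) (σ (j, π j 1)) =
        ∑ σ : Perm (α × Fin 2), ((Perm.sign σ : ℤ) : ℂ) * ∏ j : α, F j (σ (j, 0)) (σ (j, 1)) := by
    rw [← Equiv.sum_comp (Equiv.mulRight (prodCongrRight π))
      (fun σ : Perm (α × Fin 2) =>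
        ((Perm.sign σ : ℤ) : ℂ) * ∏ j : α, F j (σ (j, 0)) (σ (j, 1)))]
    refine sum_congr rfl fun σ _ => ?_
    simp only [Equiv.coe_mulRight, Perm.sign_mul, Perm.sign_prodCongrRight, Perm.mul_apply,
      prodCongrRight_apply, prod_mul_distrib, Units.val_mul, Int.cast_mul]
    simp [mul_assoc]
  rw [sum_congr rfl fun π _ => h4 π, sum_const, card_univ, nsmul_eq_mul, Fintype.card_fun,
    Fintype.card_perm, mul_sum]
  simp

theorem pairSum_mul_eq_det (u : α × Fin 2 → α × Fin 2 → ℂ) :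
    pairSum (fun j x y => u (j, 0) x * u (j, 1) y) = (Matrix.of fun x r => u r x).det := by
  rw [Matrix.det_apply', pairSum]
  simp [Fintype.prod_prod_type]

theorem pairSum_sum_mul [Fintype J] (c : α → J → ℂ) (u : α → J → Fin 2 → α × Fin 2 → ℂ) :
    pairSum (fun j x y => ∑ s, c j s * (u j s 0 x * u j s 1 y)) =
      ∑ s : α → J, (∏ j, c j (s j)) * (Matrix.of fun x r => u r.1 (s r.1) r.2 x).det := by
  have h (s : α → J) := pairSum_mul_eq_det (fun r : α × Fin 2 => u r.1 (s r.1) r.2)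
  simp only at h
  simp_rw [← h]
  unfold pairSum
  simp_rw [Fintype.prod_sum, mul_sum]
  rw [sum_comm]
  refine sum_congr rfl fun s _ => sum_congr rfl fun σ _ => ?_
  rw [prod_mul_distrib]
  ring

/-- One extension `τ₀` exists because the complement of the range of `s` has the size of `α`; every
other extension differs from it by a permutation of `α`. -/
theorem card_equiv_extending [Fintype J] [DecidableEq J]
    (hJ : Fintype.card J = Fintype.card α + Fintype.card β)
    (s : β → J) (hs : Function.Injective s) :
    #{τ : α ⊕ β ≃ J | τ ∘ Sum.inr = s} = (Fintype.card α).factorial := by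
  classical
  have hc : Fintype.card α = Fintype.card ((Set.range s)ᶜ : Set J) := by
    rw [Fintype.card_compl_set, Set.card_range_of_injective hs, hJ]
    omega
  let e : α ≃ ((Set.range s)ᶜ : Set J) := Fintype.equivOfCardEq hc
  let τ₀ : α ⊕ β ≃ J := (Equiv.sumComm α β).trans
    ((Equiv.sumCongr (Equiv.ofInjective s hs) e).trans (Equiv.Set.sumCompl (Set.range s)))
  have h0 (b : β) : τ₀ (Sum.inr b) = s b := by simp [τ₀]
  have h0' (b : β) : τ₀.symm (s b) = Sum.inr b := by rw [← h0, symm_apply_apply]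
  rw [← Fintype.card_perm, ← card_univ]
  symm
  refine card_bij (fun π _ => (Equiv.sumCongr π (Equiv.refl β)).trans τ₀) ?_ ?_ ?_
  · intro π _
    simp only [mem_filter, mem_univ, true_and]
    ext b
    simp [h0]
  · intro π _ π' _ h
    ext a
    have := congrArg (fun τ : α ⊕ β ≃ J => τ (Sum.inl a)) h
    simpa using this
  · intro τ hτ
    simp only [mem_filter, mem_univ, true_and] at hτ
    have h1 : (τ.trans τ₀.symm : Perm (α ⊕ β)) ∈ (Perm.sumCongrHom α β).range := by
      apply Perm.mem_sumCongrHom_range_of_perm_mapsTo_inl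
      rintro _ ⟨a, rfl⟩
      by_contra hne
      rcases hx : (τ.trans τ₀.symm : Perm (α ⊕ β)) (Sum.inl a) with a' | b
      · exact hne ⟨a', hx.symm⟩
      · have h2 : τ (Sum.inl a) = τ (Sum.inr b) := by
          have h3 : τ (Sum.inl a) = τ₀ (Sum.inr b) := by
            rw [← hx]; simp
          rw [h3, h0, ← hτ]; rfl
        simpa using τ.injective h2
    obtain ⟨⟨π, π'⟩, hπ⟩ := h1
    refine ⟨π, mem_univ _, ?_⟩
    ext x
    rcases x with a | b
    · have := congrArg (fun g : Perm (α ⊕ β) => τ₀ (g (Sum.inl a))) hπ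
      simpa using this
    · simp [h0, ← hτ]

/-- Choices of indices for the `β` slots become bijections of the whole index set, which remember
the complementary choice for the `α` slots. -/
theorem sum_equiv_comp_inr [Fintype J] [DecidableEq J]
    (hJ : Fintype.card J = Fintype.card α + Fintype.card β)
    (f : (β → J) → ℂ) (hf : ∀ s, ¬ Function.Injective s → f s = 0) :
    ∑ τ : α ⊕ β ≃ J, f (τ ∘ Sum.inr) = (Fintype.card α).factorial * ∑ s, f s := by
  rw [← sum_fiberwise univ (fun τ : α ⊕ β ≃ J => (τ ∘ Sum.inr : β → J)), mul_sum]
  refine sum_congr rfl fun s _ => ?_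
  rw [sum_congr rfl (g := fun _ => f s) (fun τ hτ => by rw [(mem_filter.1 hτ).2]), sum_const,
    nsmul_eq_mul]
  by_cases hs : Function.Injective s
  · rw [card_equiv_extending hJ s hs]
  · rw [hf s hs]; simp

theorem sum_equiv_comp_inl [Fintype J] [DecidableEq J]
    (hJ : Fintype.card J = Fintype.card α + Fintype.card β)
    (f : (α → J) → ℂ) (hf : ∀ s, ¬ Function.Injective s → f s = 0) :
    ∑ τ : α ⊕ β ≃ J, f (τ ∘ Sum.inl) = (Fintype.card β).factorial * ∑ s, f s := by
  rw [← sum_equiv_comp_inr (α := β) (β := α) (by rw [hJ, add_comm]) f hf,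
    ← Equiv.sum_comp ((Equiv.sumComm α β).equivCongr (Equiv.refl J))]
  refine sum_congr rfl fun τ _ => ?_
  congr 1

/-- The standard symplectic form on the index set `J × Fin 2` with weights `ρ`. -/
def sympForm [Fintype J] [DecidableEq J] (ρ : J → ℂ) (x y : J × Fin 2) : ℂ :=
  ∑ s, ρ s * ((if x = (s, 0) then 1 else 0) * (if y = (s, 1) then 1 else 0)) -
    ∑ s, ρ s * ((if y = (s, 0) then 1 else 0) * (if x = (s, 1) then 1 else 0))

/-- Permuting the rows by `τ` makes the matrix block triangular with an identity block, so only the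
minor of the unused rows survives. -/
theorem det_unit_columns (φ : (α ⊕ β) × Fin 2 → α × Fin 2 → ℂ) (τ : Perm (α ⊕ β)) :
    (Matrix.of fun (x r : (α ⊕ β) × Fin 2) =>
      Sum.elim (fun j => φ x (j, r.2))
        (fun j => if x = (τ (Sum.inr j), r.2) then (1 : ℂ) else 0) r.1).det =
      (Matrix.of fun (x r : α × Fin 2) => φ (τ (Sum.inl r.1), r.2) x).det := by
  set A : Matrix ((α ⊕ β) × Fin 2) ((α ⊕ β) × Fin 2) ℂ := Matrix.of fun x r =>
      Sum.elim (fun j => φ x (j, r.2))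
        (fun j => if x = (τ (Sum.inr j), r.2) then (1 : ℂ) else 0) r.1 with hA
  let T : Perm ((α ⊕ β) × Fin 2) := prodCongrLeft fun _ : Fin 2 => τ
  -- Rows move in pairs, so `τ` acts twice and its sign is squared.
  have hT : Perm.sign T = 1 := by
    simp [T, Perm.sign_prodCongrLeft]
  have h1 : A.det = (A.submatrix T id).det := by
    rw [Matrix.det_permute, hT]; simp
  let e : (α ⊕ β) × Fin 2 ≃ (α × Fin 2) ⊕ (β × Fin 2) := Equiv.sumProdDistrib α β (Fin 2)
  rw [h1, ← Matrix.det_submatrix_equiv_self e.symm, ← Matrix.det_transpose (Matrix.of _)]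
  have h2 : (A.submatrix T id).submatrix e.symm e.symm =
      Matrix.fromBlocks (Matrix.of fun (x r : α × Fin 2) => φ (τ (Sum.inl x.1), x.2) r) 0
        (Matrix.of fun (x : β × Fin 2) (r : α × Fin 2) => φ (τ (Sum.inr x.1), x.2) r) 1 := by
    ext x r
    rcases x with x | x <;> rcases r with r | r <;> obtain ⟨x, i⟩ := x <;> obtain ⟨r, j⟩ := r <;>
      simp [A, T, e, Matrix.one_apply, Prod.ext_iff]
  rw [h2, Matrix.det_fromBlocks_zero₁₂, Matrix.det_one, mul_one]
  congr 1

theorem det_unit_columns_eq_zero (φ : (α ⊕ β) × Fin 2 → α × Fin 2 → ℂ) (s : β → α ⊕ β)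
    (hs : ¬ Function.Injective s) :
    (Matrix.of fun (x r : (α ⊕ β) × Fin 2) =>
      Sum.elim (fun j => φ x (j, r.2))
        (fun j => if x = (s j, r.2) then (1 : ℂ) else 0) r.1).det = 0 := by
  simp only [Function.Injective, not_forall] at hs
  obtain ⟨a, b, hab, hne⟩ := hs
  refine Matrix.det_zero_of_column_eq (i := (Sum.inr a, 0)) (j := (Sum.inr b, 0))
    (by simpa using hne) fun x => ?_
  simp [hab]

theorem det_columns_eq_zero (φ : J × Fin 2 → α × Fin 2 → ℂ) (s : α → J)
    (hs : ¬ Function.Injective s) :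
    (Matrix.of fun (x r : α × Fin 2) => φ (s r.1, r.2) x).det = 0 := by
  simp only [Function.Injective, not_forall] at hs
  obtain ⟨a, b, hab, hne⟩ := hs
  refine Matrix.det_zero_of_column_eq (i := (a, 0)) (j := (b, 0))
    (by simpa using hne) fun x => ?_
  simp [hab]

/-- Only the antisymmetric part of a slot matters for the signed sum, and the symplectic form has
twice the antisymmetrisation of its first half. -/
theorem pairSum_sympForm_eq (φ : (α ⊕ β) × Fin 2 → α × Fin 2 → ℂ) (ρ : α ⊕ β → ℂ) :
    pairSum (Sum.elim (fun j x y => φ x (j, 0) * φ y (j, 1)) (fun _ => sympForm ρ)) =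
      2 ^ Fintype.card β * pairSum (Sum.elim (fun j x y => φ x (j, 0) * φ y (j, 1))
        (fun (_ : β) (x y : (α ⊕ β) × Fin 2) =>
          ∑ s, ρ s * ((if x = (s, 0) then 1 else 0) * (if y = (s, 1) then 1 else 0)))) := by
  set F := (Sum.elim (fun (j : α) x y => φ x (j, 0) * φ y (j, 1)) (fun (_ : β) => sympForm ρ))
    with hF
  set G := (Sum.elim (fun j x y => φ x (j, 0) * φ y (j, 1))
        (fun (_ : β) (x y : (α ⊕ β) × Fin 2) =>
          ∑ s, ρ s * ((if x = (s, 0) then 1 else 0) * (if y = (s, 1) then 1 else 0)))) with hG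
  have h : pairSum (fun j x y => F j x y - F j y x) =
      2 ^ Fintype.card β * pairSum (fun j x y => G j x y - G j y x) := by
    unfold pairSum
    rw [mul_sum]
    refine sum_congr rfl fun σ _ => ?_
    rw [Fintype.prod_sum_type, Fintype.prod_sum_type]
    have h2 : ∏ b : β, (F (Sum.inr b) (σ (Sum.inr b, 0)) (σ (Sum.inr b, 1)) -
          F (Sum.inr b) (σ (Sum.inr b, 1)) (σ (Sum.inr b, 0))) =
        2 ^ Fintype.card β * ∏ b : β, (G (Sum.inr b) (σ (Sum.inr b, 0)) (σ (Sum.inr b, 1)) -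
          G (Sum.inr b) (σ (Sum.inr b, 1)) (σ (Sum.inr b, 0))) := by
      rw [← card_univ, ← prod_const, ← prod_mul_distrib]
      refine prod_congr rfl fun b _ => ?_
      simp only [hF, hG, Sum.elim_inr, sympForm]
      ring
    rw [h2]
    simp only [hF, hG, Sum.elim_inl]
    ring
  rw [pairSum_antisymm, pairSum_antisymm] at h
  have h2 : (2 : ℂ) ^ Fintype.card (α ⊕ β) ≠ 0 := pow_ne_zero _ two_ne_zero
  apply mul_left_cancel₀ h2
  rw [h]
  ring

/-- The algebraic heart of the Pfaffian structure. The symplectic slots use up a set of index pairs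
and the `α` slots see a minor on the complement. Both sides are sums over bijections `τ` of such
minors; the product of `ρ` over the used indices equals the full product times the inverses over the
complement, which yields the kernel weights `ρ⁻¹`. The factorials count bijections with the same
restriction. -/
theorem factorial_mul_pairSum_sympForm (φ : (α ⊕ β) × Fin 2 → α × Fin 2 → ℂ) (ρ : α ⊕ β → ℂ)
    (hρ : ∀ s, ρ s ≠ 0) :
    (Fintype.card α).factorial *
      pairSum (Sum.elim (fun j x y => φ x (j, 0) * φ y (j, 1)) (fun _ => sympForm ρ)) =
      2 ^ Fintype.card β * (Fintype.card β).factorial * (∏ s, ρ s) *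
        pairSum (fun (_ : α) (x y : α × Fin 2) =>
          ∑ s, (ρ s)⁻¹ * (φ (s, 0) x * φ (s, 1) y)) := by
  rw [pairSum_sympForm_eq, pairSum_sum_mul (fun _ s => (ρ s)⁻¹) (fun _ s i x => φ (s, i) x)]
  have h1 : pairSum (Sum.elim (fun j x y => φ x (j, 0) * φ y (j, 1))
        (fun (_ : β) (x y : (α ⊕ β) × Fin 2) =>
          ∑ s, ρ s * ((if x = (s, 0) then 1 else 0) * (if y = (s, 1) then 1 else 0)))) =
      ∑ s : β → α ⊕ β, (∏ j, ρ (s j)) *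
        (Matrix.of fun (x r : (α ⊕ β) × Fin 2) =>
          Sum.elim (fun j => φ x (j, r.2))
            (fun j => if x = (s j, r.2) then (1 : ℂ) else 0) r.1).det := by
    have h (s : β → α ⊕ β) := pairSum_mul_eq_det (fun (r x : (α ⊕ β) × Fin 2) =>
          Sum.elim (fun j => φ x (j, r.2))
            (fun j => if x = (s j, r.2) then (1 : ℂ) else 0) r.1)
    simp only at h
    simp_rw [← h]
    unfold pairSum
    simp_rw [Fintype.prod_sum_type, Sum.elim_inl, Sum.elim_inr, Fintype.prod_sum, mul_sum]
    rw [sum_comm]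
    refine sum_congr rfl fun s _ => sum_congr rfl fun σ _ => ?_
    rw [prod_mul_distrib (f := fun i => ρ (s i))]
    ring
  have h2 := sum_equiv_comp_inr (α := α) (β := β) (J := α ⊕ β) (by simp)
    (fun s => (∏ j, ρ (s j)) *
        (Matrix.of fun (x r : (α ⊕ β) × Fin 2) =>
          Sum.elim (fun j => φ x (j, r.2))
            (fun j => if x = (s j, r.2) then (1 : ℂ) else 0) r.1).det)
    (fun s hs => by rw [det_unit_columns_eq_zero φ s hs, mul_zero])
  have h3 := sum_equiv_comp_inl (α := α) (β := β) (J := α ⊕ β) (by simp)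
    (fun s => (∏ j, (ρ (s j))⁻¹) *
        (Matrix.of fun (x r : α × Fin 2) => φ (s r.1, r.2) x).det)
    (fun s hs => by rw [det_columns_eq_zero φ s hs, mul_zero])
  rw [h1, mul_left_comm, ← h2, mul_right_comm, mul_assoc (2 ^ Fintype.card β : ℂ),
    mul_right_comm, mul_assoc, ← h3, mul_sum, mul_sum, mul_sum]
  refine sum_congr rfl fun τ _ => ?_
  simp only [Function.comp_apply]
  rw [det_unit_columns φ τ]
  have h4 : ∏ s, ρ s = (∏ j, ρ (τ (Sum.inl j))) * ∏ j, ρ (τ (Sum.inr j)) := by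
    rw [← Fintype.prod_sum_type (fun s => ρ (τ s)), Equiv.prod_comp τ ρ]
  have h5 : (∏ j, ρ (τ (Sum.inl j))) * (∏ j, (ρ (τ (Sum.inl j)))⁻¹) = 1 := by
    rw [← prod_mul_distrib]
    exact prod_eq_one fun j _ => mul_inv_cancel₀ (hρ _)
  rw [h4]
  linear_combination (-(2 : ℂ) ^ Fintype.card β * (∏ j, ρ (τ (Sum.inr j))) *
    (Matrix.of fun (x r : α × Fin 2) => φ (τ (Sum.inl r.1), r.2) x).det) * h5

theorem pairSum_reindex (e : β ≃ α) (F : α → α × Fin 2 → α × Fin 2 → ℂ) :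
    pairSum F = pairSum fun j x y => F (e j) (e x.1, x.2) (e y.1, y.2) := by
  unfold pairSum
  rw [← Equiv.sum_comp (Equiv.permCongr (e.prodCongr (Equiv.refl (Fin 2))))]
  refine sum_congr rfl fun σ _ => ?_
  rw [Perm.sign_permCongr, ← Equiv.prod_comp e]
  simp [Equiv.permCongr_apply]
  rfl

theorem pfaffian_antisymm {k : ℕ} (K : Fin k × Fin 2 → Fin k × Fin 2 → ℂ) :
    pfaffian (Matrix.of fun x y => K x y - K y x) =
      1 / (k.factorial : ℂ) * pairSum fun _ : Fin k => K := by
  have h := pairSum_antisymm fun _ : Fin k => K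
  rw [Fintype.card_fin] at h
  rw [pfaffian]
  unfold pairSum at h ⊢
  simp only [Matrix.of_apply] at h ⊢
  rw [h]
  have : (2 : ℂ) ^ k ≠ 0 := pow_ne_zero _ two_ne_zero
  field_simp

/-- The preceding identity with its right-hand side recognised as a Pfaffian by antisymmetrising the
kernel. -/
theorem pairSum_sympForm_eq_pfaffian {k : ℕ} (φ : (Fin k ⊕ β) × Fin 2 → Fin k × Fin 2 → ℂ)
    (ρ : Fin k ⊕ β → ℂ) (hρ : ∀ s, ρ s ≠ 0) :
    pairSum (Sum.elim (fun j x y => φ x (j, 0) * φ y (j, 1)) (fun _ => sympForm ρ)) =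
      2 ^ Fintype.card β * (Fintype.card β).factorial * (∏ s, ρ s) *
        pfaffian (Matrix.of fun x y => ∑ s, (ρ s)⁻¹ *
          (φ (s, 0) x * φ (s, 1) y - φ (s, 1) x * φ (s, 0) y)) := by
  have h := factorial_mul_pairSum_sympForm φ ρ hρ
  have h2 := pfaffian_antisymm fun x y => ∑ s, (ρ s)⁻¹ * (φ (s, 0) x * φ (s, 1) y)
  have h3 : (Matrix.of fun x y : Fin k × Fin 2 => ∑ s, (ρ s)⁻¹ *
          (φ (s, 0) x * φ (s, 1) y - φ (s, 1) x * φ (s, 0) y)) =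
      Matrix.of fun x y => ∑ s, (ρ s)⁻¹ * (φ (s, 0) x * φ (s, 1) y) -
        ∑ s, (ρ s)⁻¹ * (φ (s, 0) y * φ (s, 1) x) := by
    ext x y
    simp only [Matrix.of_apply]
    rw [← sum_sub_distrib]
    exact sum_congr rfl fun s _ => by ring
  rw [h3, h2]
  rw [Fintype.card_fin] at h
  have h4 : (k.factorial : ℂ) ≠ 0 := by exact_mod_cast k.factorial_ne_zero
  apply mul_left_cancel₀ h4
  rw [h]
  generalize (pairSum fun (_ : Fin k) x y => ∑ s, (ρ s)⁻¹ * (φ (s, 0) x * φ (s, 1) y)) = P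
  field_simp

end Combinatorics

end PlanarSymplectic

/-! ### The joint density as a Vandermonde determinant -/

namespace PlanarSymplectic

open Finset

/-- The points `ζ_1, ζ̄_1, ζ_2, ζ̄_2, …`. -/
def doubledConfig {α : Type*} (ζ : α → ℂ) (r : α × Fin 2) : ℂ :=
  if r.2 = 0 then ζ r.1 else conj (ζ r.1)

/-- `finProdFinEquiv` orders the doubled points lexicographically. Two distinct particles contribute
four differences, which pair up with their conjugates; a single particle contributes one. -/
theorem det_vandermonde_doubledConfig (N : ℕ) (ζ : Fin N → ℂ) :
    (Matrix.vandermonde (doubledConfig ζ ∘ (finProdFinEquiv (m := N) (n := 2)).symm)).det =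
      (∏ j : Fin N, ∏ k ∈ Iio j, ((‖ζ j - ζ k‖ ^ 2 * ‖ζ j - conj (ζ k)‖ ^ 2 : ℝ) : ℂ)) *
        ∏ j, (conj (ζ j) - ζ j) := by
  have hn (z : ℂ) : ((‖z‖ ^ 2 : ℝ) : ℂ) = z * conj z := by
    rw [Complex.mul_conj, Complex.normSq_eq_norm_sq]
  have h1 (i : Fin (N * 2)) (f : Fin (N * 2) → ℂ) :
      ∏ j ∈ Ioi i, f j = ∏ j, if i < j then f j else 1 := by
    rw [← prod_filter]; congr 1; ext; simp
  have h2 (j : Fin N) (f : Fin N → ℂ) :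
      ∏ k ∈ Iio j, f k = ∏ k, if k < j then f k else 1 := by
    rw [← prod_filter]; congr 1; ext; simp
  rw [Matrix.det_vandermonde]
  simp_rw [h1, h2]
  rw [← Equiv.prod_comp finProdFinEquiv]
  simp_rw [← Equiv.prod_comp (finProdFinEquiv (m := N) (n := 2)) (fun j => ite _ _ _)]
  simp only [Function.comp_apply, Equiv.symm_apply_apply, Fintype.prod_prod_type,
    Fin.prod_univ_two]
  have h3 (a b : Fin N) (i j : Fin 2) : (finProdFinEquiv (a, i) < finProdFinEquiv (b, j)) ↔
      (a < b ∨ (a = b ∧ i < j)) := by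
    rw [Fin.lt_def, Fin.lt_def, Fin.lt_def, Fin.ext_iff]
    simp only [finProdFinEquiv_apply_val]
    omega
  simp only [h3]
  have h4 : ∏ j, (conj (ζ j) - ζ j) = ∏ a : Fin N, ∏ b : Fin N,
      if a = b then (conj (ζ a) - ζ a) else 1 := by
    simp
  rw [h4, prod_comm (f := fun j k => ite (k < j) _ _)]
  simp_rw [← prod_mul_distrib]
  refine prod_congr rfl fun a _ => prod_congr rfl fun b _ => ?_
  rcases lt_trichotomy a b with h | h | h
  · simp only [h, h.ne, true_or, if_true, if_false, Complex.ofReal_mul, hn, doubledConfig]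
    simp
    ring
  · subst h
    simp [doubledConfig]
  · simp [h.not_gt, h.ne']

/-- Replacing powers by monic polynomials of the same degrees leaves the Vandermonde determinant
unchanged. Of `|ζ - ζ̄|² = (ζ - ζ̄)(ζ̄ - ζ)`, the second factor is already in the determinant and
the first stays as the weight. -/
theorem gibbsWeight_eq_pairSum (N : ℕ) (Q : ℂ → EReal) (ζ : Fin N → ℂ)
    (q : Fin N × Fin 2 → Polynomial ℂ) (hmonic : ∀ x, (q x).Monic)
    (hdeg : ∀ x, (q x).natDegree = finProdFinEquiv x) :
    (gibbsWeight N Q ζ : ℂ) =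
      pairSum fun j x y => (ζ j - conj (ζ j)) * boltzmann N Q (ζ j) *
        ((q x).eval (ζ j) * (q y).eval (conj (ζ j))) := by
  have h1 := Matrix.det_eval_matrixOfPolynomials_eq_det_vandermonde
    (doubledConfig ζ ∘ (finProdFinEquiv (m := N) (n := 2)).symm)
    (q ∘ finProdFinEquiv.symm) (fun i => by rw [Function.comp_apply, hdeg, Equiv.apply_symm_apply]) (fun i => hmonic _)
  rw [det_vandermonde_doubledConfig, ← Matrix.det_submatrix_equiv_self finProdFinEquiv,
    ← Matrix.det_transpose] at h1
  have h2 := pairSum_mul_eq_det fun r x : Fin N × Fin 2 => (q x).eval (doubledConfig ζ r)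
  have h3 : (pairSum fun j x y => (ζ j - conj (ζ j)) * boltzmann N Q (ζ j) *
        ((q x).eval (ζ j) * (q y).eval (conj (ζ j)))) =
      (∏ j, (ζ j - conj (ζ j)) * boltzmann N Q (ζ j)) *
        pairSum fun j x y => (q x).eval (doubledConfig ζ (j, 0)) *
          (q y).eval (doubledConfig ζ (j, 1)) := by
    unfold pairSum
    rw [mul_sum]
    refine sum_congr rfl fun σ _ => ?_
    rw [prod_mul_distrib]
    simp only [doubledConfig, if_true, one_ne_zero, if_false]
    ring
  have h4 : (Matrix.of fun x r : Fin N × Fin 2 => (q x).eval (doubledConfig ζ r)) =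
      (((Matrix.of fun i j => Polynomial.eval
        ((doubledConfig ζ ∘ finProdFinEquiv.symm) i) ((q ∘ finProdFinEquiv.symm) j)).submatrix
          finProdFinEquiv finProdFinEquiv).transpose) := by
    ext; simp only [Matrix.of_apply, Matrix.transpose_apply, Matrix.submatrix_apply,
      Function.comp_apply, Equiv.symm_apply_apply]
  rw [h3, h2, h4, ← h1, gibbsWeight]
  have hn (z : ℂ) : ((‖z - conj z‖ ^ 2 : ℝ) : ℂ) = (z - conj z) * (conj z - z) := by
    rw [← Complex.normSq_eq_norm_sq, ← Complex.mul_conj, map_sub, Complex.conj_conj]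
  have h5 (j : Fin N) : ((‖ζ j - conj (ζ j)‖ ^ 2 * boltzmann N Q (ζ j) : ℝ) : ℂ) =
      (ζ j - conj (ζ j)) * boltzmann N Q (ζ j) * (conj (ζ j) - ζ j) := by
    rw [Complex.ofReal_mul, hn]; ring
  rw [Complex.ofReal_mul, Complex.ofReal_prod, Complex.ofReal_prod, prod_congr rfl fun j _ => h5 j,
    prod_mul_distrib, prod_congr rfl fun j _ => Complex.ofReal_prod _ _]
  ring

end PlanarSymplectic

/-! ### Radial moments and the skew product of monomials -/

noncomputable section

namespace PlanarSymplectic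

open Finset MeasureTheory

/-- The weight `e^{-N|ζ|²}` on the closed disc of radius `√2`. -/
def diskWeight (N : ℕ) : ℂ → ℝ :=
  Set.indicator (Metric.closedBall 0 √2) fun ζ => Real.exp (-(N * ‖ζ‖ ^ 2))

/-- The radial moments of `diskWeight`. -/
def diskMoment (N m : ℕ) : ℝ :=
  ∫ y in (0 : ℝ)..√2, 2 * y ^ (2 * m + 1) * Real.exp (-(N * y ^ 2))

theorem boltzmann_softHardPotential {N : ℕ} (hN : N ≠ 0) (ζ : ℂ) :
    boltzmann N softHardPotential ζ = diskWeight N ζ := by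
  unfold boltzmann softHardPotential diskWeight
  by_cases h : ‖ζ‖ ≤ √2
  · have h1 : ζ ∈ Metric.closedBall (0 : ℂ) √2 := by simpa using h
    rw [if_pos h, Set.indicator_of_mem h1]
    have h2 : -((N : EReal) * ((‖ζ‖ ^ 2 : ℝ) : EReal)) = ((-(N * ‖ζ‖ ^ 2) : ℝ) : EReal) := by
      push_cast; rfl
    rw [h2, EReal.exp_coe, ENNReal.toReal_ofReal (Real.exp_pos _).le]
  · have h1 : ζ ∉ Metric.closedBall (0 : ℂ) √2 := by simpa using h
    rw [if_neg h, Set.indicator_of_notMem h1]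
    have h2 : (0 : EReal) < N := by exact_mod_cast Nat.pos_of_ne_zero hN
    rw [EReal.mul_top_of_pos h2]
    simp

theorem integral_areaMeasure (f : ℂ → ℂ) :
    ∫ ζ, f ζ ∂areaMeasure = (Real.pi : ℂ)⁻¹ * ∫ ζ, f ζ := by
  rw [areaMeasure, integral_smul_nnreal_measure, NNReal.smul_def]
  simp

theorem integrable_diskWeight_mul (N : ℕ) {f : ℂ → ℂ} (hf : Continuous f) :
    Integrable (fun ζ => diskWeight N ζ * f ζ) areaMeasure := by
  unfold areaMeasure
  apply Integrable.smul_measure_nnreal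
  have h : (fun ζ => (diskWeight N ζ : ℂ) * f ζ) = Set.indicator (Metric.closedBall 0 √2)
      fun ζ => (Real.exp (-(N * ‖ζ‖ ^ 2)) : ℂ) * f ζ := by
    ext ζ
    by_cases h : ζ ∈ Metric.closedBall (0 : ℂ) √2 <;> simp only [diskWeight, h, Set.indicator_of_mem,
      Set.indicator_of_notMem, not_false_eq_true, Complex.ofReal_zero, zero_mul]
  rw [h, integrable_indicator_iff Metric.isClosed_closedBall.measurableSet]
  refine ContinuousOn.integrableOn_compact (isCompact_closedBall _ _) ?_
  fun_prop

theorem integral_diskWeight_monomial (N a b : ℕ) :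
    ∫ ζ, (diskWeight N ζ : ℂ) * (ζ ^ a * conj ζ ^ b) ∂areaMeasure =
      if a = b then (diskMoment N a : ℂ) else 0 := by
  classical
  rw [integral_areaMeasure]
  split_ifs with h
  · subst h
    have h1 (ζ : ℂ) : (diskWeight N ζ : ℂ) * (ζ ^ a * conj ζ ^ a) =
        (fun y : ℝ => (((if y ≤ √2 then Real.exp (-(N * y ^ 2)) else 0) * y ^ (2 * a) : ℝ) : ℂ))
          ‖ζ‖ := by
      rw [← mul_pow, Complex.mul_conj, Complex.normSq_eq_norm_sq, diskWeight, Set.indicator_apply]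
      simp only [mem_closedBall_zero_iff]
      push_cast
      ring
    rw [integral_congr_ae (ae_of_all _ h1), integral_fun_norm_addHaar volume
      (fun y : ℝ => (((if y ≤ √2 then Real.exp (-(N * y ^ 2)) else 0) * y ^ (2 * a) : ℝ) : ℂ))]
    have h2 : (volume : Measure ℂ).real (Metric.ball 0 1) = Real.pi := by
      simp [Measure.real, Complex.volume_ball]
    have h3 : ∫ y in Set.Ioi (0 : ℝ), y ^ (Module.finrank ℝ ℂ - 1) •
        (((if y ≤ √2 then Real.exp (-(N * y ^ 2)) else 0) * y ^ (2 * a) : ℝ) : ℂ) =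
        ((∫ y in (0 : ℝ)..√2, y ^ (2 * a + 1) * Real.exp (-(N * y ^ 2)) : ℝ) : ℂ) := by
      rw [intervalIntegral.integral_of_le (Real.sqrt_nonneg 2), ← integral_complex_ofReal,
        ← integral_indicator measurableSet_Ioi, ← integral_indicator measurableSet_Ioc]
      congr 1
      ext y
      simp only [Set.indicator_apply, Set.mem_Ioi, Set.mem_Ioc, Complex.finrank_real_complex]
      by_cases hy : 0 < y <;> by_cases hy' : y ≤ √2 <;> simp [hy, hy']
      ring
    rw [h3, h2, Complex.finrank_real_complex, diskMoment]
    simp_rw [mul_assoc]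
    rw [intervalIntegral.integral_const_mul]
    have : (Real.pi : ℂ) ≠ 0 := by exact_mod_cast Real.pi_ne_zero
    simp
    field_simp
  · rw [mul_eq_zero]
    right
    set I := ∫ ζ, (diskWeight N ζ : ℂ) * (ζ ^ a * conj ζ ^ b) with hI
    -- Rotation by one radian serves all `a ≠ b` at once: it multiplies the integral by
    -- `e^{i(a-b)}`, which is not `1` because `π` is irrational.
    let u : Circle := Circle.exp 1
    have h1 : I = (u : ℂ) ^ a * conj (u : ℂ) ^ b * I := by
      have h2 := ((rotation u).measurePreserving).integral_comp
        (rotation u).toHomeomorph.measurableEmbedding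
        (fun ζ : ℂ => (diskWeight N ζ : ℂ) * (ζ ^ a * conj ζ ^ b))
      conv_lhs => rw [hI, ← h2]
      rw [← integral_const_mul]
      congr 1
      ext ζ
      have h3 : diskWeight N (rotation u ζ) = diskWeight N ζ := by
        simp only [diskWeight, Set.indicator_apply, mem_closedBall_zero_iff,
          LinearIsometryEquiv.norm_map]
      rw [h3, rotation_apply, map_mul, mul_pow, mul_pow]
      ring
    have h4 : (u : ℂ) ^ a * conj (u : ℂ) ^ b ≠ 1 := by
      simp only [u, Circle.coe_exp, ← Complex.exp_conj, ← Complex.exp_nat_mul, ← Complex.exp_add]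
      intro h5
      rw [Complex.exp_eq_one_iff] at h5
      obtain ⟨n, hn⟩ := h5
      have h6 : ((a : ℝ) - b) = n * (2 * Real.pi) := by
        have := congrArg Complex.im hn
        simp at this
        linarith
      have h7 : (a : ℤ) - b ≠ 0 := by omega
      have h8 : n ≠ 0 := by
        rintro rfl
        apply h7
        have : ((a : ℝ) - b) = 0 := by rw [h6]; simp
        exact_mod_cast this
      have h9 : Irrational Real.pi := irrational_pi
      apply h9
      refine ⟨((a : ℚ) - b) / (2 * n), ?_⟩
      have : (n : ℝ) ≠ 0 := by exact_mod_cast h8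
      push_cast
      rw [h6]
      field_simp
    have h10 : (1 - (u : ℂ) ^ a * conj (u : ℂ) ^ b) * I = 0 := by linear_combination h1
    exact (mul_eq_zero.1 h10).resolve_left (sub_ne_zero.2 h4.symm)

theorem integral_skew_monomial (N a b : ℕ) :
    ∫ ζ, (ζ - conj ζ) * diskWeight N ζ * (ζ ^ a * conj ζ ^ b) ∂areaMeasure =
      (if a + 1 = b then (diskMoment N b : ℂ) else 0) -
        if a = b + 1 then (diskMoment N a : ℂ) else 0 := by
  have h1 (ζ : ℂ) : (ζ - conj ζ) * diskWeight N ζ * (ζ ^ a * conj ζ ^ b) =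
      diskWeight N ζ * (ζ ^ (a + 1) * conj ζ ^ b) - diskWeight N ζ * (ζ ^ a * conj ζ ^ (b + 1)) := by
    ring
  simp_rw [h1]
  rw [integral_sub (integrable_diskWeight_mul N (by fun_prop))
    (integrable_diskWeight_mul N (by fun_prop)), integral_diskWeight_monomial,
    integral_diskWeight_monomial]
  congr 1
  split_ifs with h
  · rw [h]
  · rfl

theorem diskMoment_pos (N m : ℕ) : 0 < diskMoment N m := by
  apply intervalIntegral.intervalIntegral_pos_of_pos_on
  · apply Continuous.intervalIntegrable; fun_prop
  · intro y hy
    have := hy.1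
    positivity
  · positivity

end PlanarSymplectic

end

/-! ### Skew-orthogonal polynomials -/

noncomputable section

namespace PlanarSymplectic

open Finset MeasureTheory Polynomial

/-- The products `∏_{j < l} h_{2j+2} / h_{2j+1}`. -/
def momentRatio (h : ℕ → ℝ) (l : ℕ) : ℝ := ∏ j ∈ range l, h (2 * j + 2) / h (2 * j + 1)

/-- The coefficients of the skew-orthogonal polynomials of a radially symmetric weight. -/
def skewCoeff (h : ℕ → ℝ) (s : ℕ) (i : Fin 2) (l : ℕ) : ℝ :=
  if i = 0 then momentRatio h s / momentRatio h l else if l = s then 1 else 0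

/-- The skew-orthogonal polynomials of a radially symmetric weight with radial moments `h`. -/
def skewPoly (h : ℕ → ℝ) (s : ℕ) (i : Fin 2) : ℂ[X] :=
  ∑ l ∈ range (s + 1), C (skewCoeff h s i l : ℂ) * X ^ (2 * l + i : ℕ)

theorem momentRatio_pos {h : ℕ → ℝ} (hh : ∀ m, 0 < h m) (l : ℕ) : 0 < momentRatio h l :=
  prod_pos fun _ _ => div_pos (hh _) (hh _)

theorem skewCoeff_self {h : ℕ → ℝ} (hh : ∀ m, 0 < h m) (s : ℕ) (i : Fin 2) :
    skewCoeff h s i s = 1 := by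
  unfold skewCoeff
  split_ifs
  · exact div_self (momentRatio_pos hh s).ne'
  · simp_all
  · simp_all

theorem skewPoly_eq_X_pow_add {h : ℕ → ℝ} (hh : ∀ m, 0 < h m) (s : ℕ) (i : Fin 2) :
    skewPoly h s i = X ^ (2 * s + i : ℕ) +
      ∑ l ∈ range s, C (skewCoeff h s i l : ℂ) * X ^ (2 * l + i : ℕ) := by
  rw [skewPoly, sum_range_succ, skewCoeff_self hh, add_comm]
  simp

theorem degree_skewPoly_tail (h : ℕ → ℝ) (s : ℕ) (i : Fin 2) :
    (∑ l ∈ range s, C (skewCoeff h s i l : ℂ) * X ^ (2 * l + i : ℕ)).degree <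
      ((2 * s + i : ℕ) : WithBot ℕ) := by
  refine (degree_sum_le _ _).trans_lt ?_
  rw [Finset.sup_lt_iff (WithBot.bot_lt_coe _)]
  intro l hl
  refine (degree_C_mul_X_pow_le _ _).trans_lt ?_
  have := mem_range.1 hl
  exact_mod_cast (by omega : 2 * l + (i : ℕ) < 2 * s + i)

theorem monic_skewPoly {h : ℕ → ℝ} (hh : ∀ m, 0 < h m) (s : ℕ) (i : Fin 2) :
    (skewPoly h s i).Monic := by
  rw [skewPoly_eq_X_pow_add hh]
  exact monic_X_pow_add (degree_skewPoly_tail h s i)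

theorem natDegree_skewPoly {h : ℕ → ℝ} (hh : ∀ m, 0 < h m) (s : ℕ) (i : Fin 2) :
    (skewPoly h s i).natDegree = 2 * s + i := by
  rw [skewPoly_eq_X_pow_add hh]
  apply natDegree_eq_of_degree_eq_some
  rw [degree_add_eq_left_of_degree_lt, degree_X_pow]
  rw [degree_X_pow]
  exact degree_skewPoly_tail h s i

theorem eval_skewPoly (h : ℕ → ℝ) (s : ℕ) (i : Fin 2) (z : ℂ) :
    (skewPoly h s i).eval z =
      ∑ l ∈ range (s + 1), (skewCoeff h s i l : ℂ) * z ^ (2 * l + i : ℕ) := by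
  simp [skewPoly, eval_finsetSum]

/-- This cancellation dictates `momentRatio`: for `s > t` both `l = t` and `l = t + 1` occur, and
the quotient of their coefficients is exactly `h (2t+2) / h (2t+1)`. -/
theorem sum_skewCoeff_eq {h : ℕ → ℝ} (hh : ∀ m, 0 < h m) (s t : ℕ) :
    ∑ l ∈ range (s + 1), skewCoeff h s 0 l *
      ((if l = t then h (2 * t + 1) else 0) - if l = t + 1 then h (2 * t + 2) else 0) =
      if s = t then h (2 * t + 1) else 0 := by
  have h1 : momentRatio h (t + 1) = momentRatio h t * (h (2 * t + 2) / h (2 * t + 1)) :=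
    prod_range_succ _ _
  have h2 := (momentRatio_pos hh t).ne'
  have h3 := (hh (2 * t + 1)).ne'
  have h4 := (hh (2 * t + 2)).ne'
  simp_rw [mul_sub, sum_sub_distrib, mul_ite, mul_zero, sum_ite_eq', mem_range]
  rcases lt_trichotomy s t with hst | hst | hst
  · rw [if_neg (by omega), if_neg (by omega), if_neg (by omega), sub_zero]
  · rw [if_pos (by omega), if_neg (by omega), if_pos (by omega), hst, skewCoeff_self hh]
    ring
  · rw [if_pos (by omega), if_pos (by omega), if_neg (by omega)]
    simp only [skewCoeff, if_true, h1]
    field_simp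
    ring

/-- Polynomials of equal parity are skew-orthogonal because only adjacent degrees interact; for
opposite parity the odd polynomial is a monomial and `sum_skewCoeff_eq` applies. -/
theorem integral_skewPoly (N s t : ℕ) (i j : Fin 2) :
    ∫ ζ, (ζ - conj ζ) * diskWeight N ζ * ((skewPoly (diskMoment N) s i).eval ζ *
        (skewPoly (diskMoment N) t j).eval (conj ζ)) ∂areaMeasure =
      if s = t then
        ((diskMoment N (2 * t + 1) : ℝ) : ℂ) *
          ((if i = 0 ∧ j = 1 then 1 else 0) - if i = 1 ∧ j = 0 then 1 else 0) else 0 := by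
  have h1 (ζ : ℂ) : (ζ - conj ζ) * diskWeight N ζ * ((skewPoly (diskMoment N) s i).eval ζ *
        (skewPoly (diskMoment N) t j).eval (conj ζ)) =
      ∑ l ∈ range (s + 1), ∑ m ∈ range (t + 1),
        ((skewCoeff (diskMoment N) s i l : ℂ) * (skewCoeff (diskMoment N) t j m : ℂ)) *
          ((ζ - conj ζ) * diskWeight N ζ * (ζ ^ (2 * l + i : ℕ) * conj ζ ^ (2 * m + j : ℕ))) := by
    rw [eval_skewPoly, eval_skewPoly, sum_mul_sum, mul_sum]
    refine sum_congr rfl fun l _ => ?_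
    rw [mul_sum]
    exact sum_congr rfl fun m _ => by ring
  have hint (l m : ℕ) : Integrable (fun ζ : ℂ =>
      ((skewCoeff (diskMoment N) s i l : ℂ) * (skewCoeff (diskMoment N) t j m : ℂ)) *
          ((ζ - conj ζ) * diskWeight N ζ * (ζ ^ (2 * l + i : ℕ) * conj ζ ^ (2 * m + j : ℕ))))
      areaMeasure := by
    refine Integrable.const_mul ?_ _
    have := integrable_diskWeight_mul N
      (f := fun ζ => (ζ - conj ζ) * (ζ ^ (2 * l + i : ℕ) * conj ζ ^ (2 * m + j : ℕ))) (by fun_prop)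
    refine this.congr (ae_of_all _ fun ζ => ?_)
    ring
  simp_rw [h1]
  rw [integral_finsetSum _ fun l _ => integrable_finsetSum _ fun m _ => hint l m]
  simp_rw [integral_finsetSum _ fun m _ => hint _ m, integral_const_mul, integral_skew_monomial]
  have key (s t : ℕ) :=
    congrArg (fun x : ℝ => (x : ℂ)) (sum_skewCoeff_eq (h := diskMoment N) (diskMoment_pos N) s t)
  simp only [Complex.ofReal_sum, Complex.ofReal_mul, Complex.ofReal_sub, apply_ite Complex.ofReal,
    Complex.ofReal_zero] at key
  have hodd (t l : ℕ) : skewCoeff (diskMoment N) t 1 l = if l = t then 1 else 0 := rfl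
  have e1 (l m : ℕ) : (2 * l + 1 = 2 * m + 1) ↔ l = m := by omega
  have e2 (l m : ℕ) : (2 * l = 2 * m + 1 + 1) ↔ l = m + 1 := by omega
  have e3 (l m : ℕ) : ¬ (2 * l + 1 = 2 * m) := by omega
  have e4 (l m : ℕ) : ¬ (2 * l = 2 * m + 1) := by omega
  have e5 (l m : ℕ) : ¬ (2 * l + 1 + 1 = 2 * m + 1) := by omega
  have e6 (l m : ℕ) : ¬ (2 * l + 1 = 2 * m + 1 + 1) := by omega
  have e7 (l m : ℕ) : (2 * l + 1 + 1 = 2 * m) ↔ m = l + 1 := by omega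
  fin_cases i <;> fin_cases j
  · simp [e3, e4]
  · simp only [Fin.mk_one, Fin.zero_eta, add_zero, hodd]
    simp only [e1, e2]
    have h2 (l : ℕ) : ∑ m ∈ range (t + 1), (skewCoeff (diskMoment N) s 0 l : ℂ) *
        ((if m = t then (1 : ℝ) else 0 : ℝ) : ℂ) *
        ((if l = m then ((diskMoment N (2 * m + 1) : ℝ) : ℂ) else 0) -
          if l = m + 1 then ((diskMoment N (2 * l) : ℝ) : ℂ) else 0) =
        (skewCoeff (diskMoment N) s 0 l : ℂ) *
        ((if l = t then ((diskMoment N (2 * t + 1) : ℝ) : ℂ) else 0) -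
          if l = t + 1 then ((diskMoment N (2 * t + 2) : ℝ) : ℂ) else 0) := by
      rw [sum_eq_single t]
      · by_cases h3 : l = t
        · subst h3; simp
        · by_cases h4 : l = t + 1
          · subst h4; simp [mul_add]
          · simp [h3, h4]
      · intro m _ hm; simp [hm]
      · simp
    rw [sum_congr rfl fun l _ => h2 l, key]
    simp
  · simp only [Fin.mk_one, Fin.zero_eta, add_zero, hodd]
    simp only [e1, e7]
    rw [sum_comm]
    have h2 (m : ℕ) : ∑ l ∈ range (s + 1), ((if l = s then (1 : ℝ) else 0 : ℝ) : ℂ) *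
        (skewCoeff (diskMoment N) t 0 m : ℂ) *
        ((if m = l + 1 then ((diskMoment N (2 * m) : ℝ) : ℂ) else 0) -
          if l = m then ((diskMoment N (2 * l + 1) : ℝ) : ℂ) else 0) =
        -((skewCoeff (diskMoment N) t 0 m : ℂ) *
        ((if m = s then ((diskMoment N (2 * s + 1) : ℝ) : ℂ) else 0) -
          if m = s + 1 then ((diskMoment N (2 * s + 2) : ℝ) : ℂ) else 0)) := by
      rw [sum_eq_single s]
      · by_cases h3 : m = s
        · subst h3; simp
        · by_cases h4 : m = s + 1
          · subst h4; simp [mul_add]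
          · simp [h3, h4, Ne.symm h3]
      · intro l _ hl; simp [hl]
      · simp
    rw [sum_congr rfl fun m _ => h2 m, sum_neg_distrib, key]
    by_cases h3 : s = t
    · subst h3; simp
    · simp [h3, Ne.symm h3]
  · simp [e3, e4]

theorem sympForm_apply {J : Type*} [Fintype J] [DecidableEq J] (ρ : J → ℂ) (s t : J)
    (i j : Fin 2) :
    sympForm ρ (s, i) (t, j) = if s = t then
        ρ t * ((if i = 0 ∧ j = 1 then 1 else 0) - if i = 1 ∧ j = 0 then 1 else 0) else 0 := by
  unfold sympForm
  by_cases h : s = t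
  · subst h
    fin_cases i <;> fin_cases j <;> simp
  · fin_cases i <;> fin_cases j <;> simp [h, Ne.symm h]

end PlanarSymplectic

end

/-! ### Exact Pfaffian formula at finite `N` -/

noncomputable section

namespace PlanarSymplectic

open Finset MeasureTheory

/-- The skew-orthogonal polynomial kernel of the ensemble with `N` particles. -/
def finitePreKernel (N : ℕ) (a b : ℂ) : ℂ :=
  ∑ s ∈ range N, (2 * (diskMoment N (2 * s + 1) : ℂ))⁻¹ *
    ((skewPoly (diskMoment N) s 1).eval a * (skewPoly (diskMoment N) s 0).eval b -
      (skewPoly (diskMoment N) s 0).eval a * (skewPoly (diskMoment N) s 1).eval b)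

theorem pfaffian_smul {k : ℕ} (c : ℂ) (K : Fin k × Fin 2 → Fin k × Fin 2 → ℂ) :
    pfaffian (Matrix.of fun x y => c * K x y) = c ^ k * pfaffian (Matrix.of K) := by
  simp only [pfaffian, Matrix.of_apply, prod_mul_distrib, prod_const, card_univ, Fintype.card_fin]
  rw [mul_left_comm (c ^ k), mul_sum univ _ (c ^ k)]
  congr 1
  exact sum_congr rfl fun σ _ => by ring

theorem pfaffian_zero (A : Matrix (Fin 0 × Fin 2) (Fin 0 × Fin 2) ℂ) : pfaffian A = 1 := by
  simp [pfaffian]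

/-- By Fubini each integrated slot becomes a skew product, that is, an entry of the symplectic form.
The factor `-2` undoes the halving and the odd-before-even order in `finitePreKernel`. -/
theorem integral_gibbsWeight_joinConfig {N k : ℕ} (hN : N ≠ 0) (hk : k ≤ N) (ζ : Fin k → ℂ) :
    ∫ η : Fin (N - k) → ℂ, (gibbsWeight N softHardPotential (joinConfig N k ζ η) : ℂ)
        ∂(Measure.pi fun _ => areaMeasure) =
      (∏ j, (ζ j - conj (ζ j)) * diskWeight N (ζ j)) *
        (2 ^ (N - k) * (N - k).factorial * (∏ s : Fin N, (diskMoment N (2 * s + 1) : ℂ)) *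
        pfaffian (Matrix.of fun x y =>
          (-2) * finitePreKernel N (doubledConfig ζ x) (doubledConfig ζ y))) := by
  let e : Fin k ⊕ Fin (N - k) ≃ Fin N :=
    finSumFinEquiv.trans (finCongr (Nat.add_sub_cancel' hk))
  have he1 (j : Fin k) : (e (Sum.inl j) : ℕ) = j := by simp [e]
  have he2 (j : Fin (N - k)) : (e (Sum.inr j) : ℕ) = k + j := by simp [e]
  have hj1 (η : Fin (N - k) → ℂ) (j : Fin k) : joinConfig N k ζ η (e (Sum.inl j)) = ζ j := by
    simp [joinConfig, he1]
  have hj2 (η : Fin (N - k) → ℂ) (j : Fin (N - k)) :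
      joinConfig N k ζ η (e (Sum.inr j)) = η j := by
    simp [joinConfig, he2]
  let q : (Fin k ⊕ Fin (N - k)) × Fin 2 → Polynomial ℂ := fun x =>
    skewPoly (diskMoment N) (e x.1) x.2
  let ρ : Fin k ⊕ Fin (N - k) → ℂ := fun s => diskMoment N (2 * (e s : ℕ) + 1)
  let φ : (Fin k ⊕ Fin (N - k)) × Fin 2 → Fin k × Fin 2 → ℂ := fun x r =>
    (q x).eval (doubledConfig ζ r)
  have hρ (s) : ρ s ≠ 0 := Complex.ofReal_ne_zero.2 (diskMoment_pos N _).ne'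
  have hw (η : Fin (N - k) → ℂ) :
      (gibbsWeight N softHardPotential (joinConfig N k ζ η) : ℂ) =
        (∏ j, (ζ j - conj (ζ j)) * diskWeight N (ζ j)) *
          pairSum (Sum.elim (fun j x y => φ x (j, 0) * φ y (j, 1)) (fun j x y =>
            (η j - conj (η j)) * diskWeight N (η j) *
              ((q x).eval (η j) * (q y).eval (conj (η j))))) := by
    rw [gibbsWeight_eq_pairSum N _ _ (fun x => skewPoly (diskMoment N) x.1 x.2)
      (fun x => monic_skewPoly (diskMoment_pos N) _ _)
      (fun x => by rw [natDegree_skewPoly (diskMoment_pos N), finProdFinEquiv_apply_val, add_comm]),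
      pairSum_reindex e]
    unfold pairSum
    rw [mul_sum]
    refine sum_congr rfl fun σ _ => ?_
    simp only [Fintype.prod_sum_type, hj1, hj2, Sum.elim_inl, Sum.elim_inr,
      boltzmann_softHardPotential hN]
    have h1 : ∏ x : Fin k, ((ζ x - conj (ζ x)) * diskWeight N (ζ x) *
        ((skewPoly (diskMoment N) (e (σ (Sum.inl x, 0)).1) (σ (Sum.inl x, 0)).2).eval (ζ x) *
          (skewPoly (diskMoment N) (e (σ (Sum.inl x, 1)).1) (σ (Sum.inl x, 1)).2).eval
            (conj (ζ x)))) =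
        (∏ j, (ζ j - conj (ζ j)) * diskWeight N (ζ j)) *
          ∏ x, φ (σ (Sum.inl x, 0)) (x, 0) * φ (σ (Sum.inl x, 1)) (x, 1) := by
      rw [← prod_mul_distrib]
      rfl
    rw [h1]
    ring
  have hint (x y : (Fin k ⊕ Fin (N - k)) × Fin 2) : Integrable (fun z : ℂ =>
      (z - conj z) * diskWeight N z * ((q x).eval z * (q y).eval (conj z))) areaMeasure := by
    have := integrable_diskWeight_mul N
      (f := fun z => (z - conj z) * ((q x).eval z * (q y).eval (conj z))) (by fun_prop)
    refine this.congr (ae_of_all _ fun z => ?_)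
    ring
  have hval (x y : (Fin k ⊕ Fin (N - k)) × Fin 2) : ∫ z : ℂ,
      (z - conj z) * diskWeight N z * ((q x).eval z * (q y).eval (conj z)) ∂areaMeasure =
        sympForm ρ x y := by
    obtain ⟨s, i⟩ := x
    obtain ⟨t, j⟩ := y
    have h : ((e s : Fin N) : ℕ) = e t ↔ s = t := by
      rw [← Fin.ext_iff, e.apply_eq_iff_eq]
    rw [integral_skewPoly, sympForm_apply]
    simp only [h, ρ]
  simp_rw [hw]
  rw [integral_const_mul]
  have hI : ∫ η : Fin (N - k) → ℂ,
      pairSum (Sum.elim (fun j x y => φ x (j, 0) * φ y (j, 1)) (fun j x y =>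
            (η j - conj (η j)) * diskWeight N (η j) *
              ((q x).eval (η j) * (q y).eval (conj (η j))))) ∂(Measure.pi fun _ => areaMeasure) =
      pairSum (Sum.elim (fun j x y => φ x (j, 0) * φ y (j, 1)) (fun _ => sympForm ρ)) := by
    unfold pairSum
    simp only [Fintype.prod_sum_type, Sum.elim_inl, Sum.elim_inr]
    rw [integral_finsetSum]
    · refine sum_congr rfl fun σ _ => ?_
      rw [integral_const_mul, integral_const_mul,
        integral_fintype_prod_eq_prod (fun (j : Fin (N - k)) (z : ℂ) =>
          (z - conj z) * diskWeight N z * ((q (σ (Sum.inr j, 0))).eval z *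
            (q (σ (Sum.inr j, 1))).eval (conj z)))]
      simp only [hval]
    · intro σ _
      refine Integrable.const_mul (Integrable.const_mul ?_ _) _
      exact Integrable.fintype_prod (f := fun (j : Fin (N - k)) (z : ℂ) =>
          (z - conj z) * diskWeight N z * ((q (σ (Sum.inr j, 0))).eval z *
            (q (σ (Sum.inr j, 1))).eval (conj z))) fun j => hint _ _
  rw [hI, pairSum_sympForm_eq_pfaffian φ ρ hρ, Fintype.card_fin]
  congr 3
  · exact Equiv.prod_comp e fun s => (diskMoment N (2 * (s : ℕ) + 1) : ℂ)
  · ext x y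
    simp only [Matrix.of_apply, finitePreKernel]
    rw [← Fin.sum_univ_eq_sum_range, ← Equiv.sum_comp e, mul_sum]
    refine sum_congr rfl fun s _ => ?_
    simp only [φ, q, ρ, mul_inv]
    ring

/-- The case `k = 0` of the integral evaluates the partition function. In the quotient, `(-2)^k`
supplies the missing powers of two and turns `ζ - ζ̄` into `ζ̄ - ζ`. -/
theorem corrFun_eq_pfaffian {N k : ℕ} (hN : N ≠ 0) (hk : k ≤ N) (ζ : Fin k → ℂ) :
    (corrFun N softHardPotential k ζ : ℂ) =
      (∏ j, (conj (ζ j) - ζ j) * diskWeight N (ζ j)) *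
        pfaffian (Matrix.of fun x y =>
          finitePreKernel N (doubledConfig ζ x) (doubledConfig ζ y)) := by
  have hZ : (partitionFunction N softHardPotential : ℂ) =
      2 ^ N * N.factorial * (∏ s : Fin N, (diskMoment N (2 * s + 1) : ℂ)) := by
    have h := integral_gibbsWeight_joinConfig hN (Nat.zero_le N) Fin.elim0
    rw [pfaffian_zero] at h
    simp only [univ_eq_empty, prod_empty, one_mul, mul_one, Nat.sub_zero] at h
    rw [← h, partitionFunction, ← integral_complex_ofReal]
    refine integral_congr_ae (ae_of_all _ fun η => ?_)
    congr 2
  have hI := integral_gibbsWeight_joinConfig hN hk ζ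
  rw [corrFun]
  simp_rw [gibbsDensity]
  rw [integral_div, Complex.ofReal_mul, Complex.ofReal_div, ← integral_complex_ofReal, hI, hZ,
    pfaffian_smul (-2) fun x y => finitePreKernel N (doubledConfig ζ x) (doubledConfig ζ y)]
  have h1 : (∏ s : Fin N, (diskMoment N (2 * s + 1) : ℂ)) ≠ 0 :=
    prod_ne_zero_iff.2 fun s _ => Complex.ofReal_ne_zero.2 (diskMoment_pos N _).ne'
  have h2 : (N.factorial : ℂ) ≠ 0 := by exact_mod_cast N.factorial_ne_zero
  have h3 : ((N - k).factorial : ℂ) * N.descFactorial k = N.factorial := by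
    exact_mod_cast Nat.factorial_mul_descFactorial hk
  have h4 : (2 : ℂ) ^ N = 2 ^ (N - k) * 2 ^ k := by
    rw [← pow_add, Nat.sub_add_cancel hk]
  have h5 : ∏ j, (conj (ζ j) - ζ j) * (diskWeight N (ζ j) : ℂ) =
      (-1) ^ k * ∏ j, (ζ j - conj (ζ j)) * (diskWeight N (ζ j) : ℂ) := by
    have : (-1 : ℂ) ^ k = ∏ _j : Fin k, (-1) := by simp
    rw [this, ← prod_mul_distrib]
    exact prod_congr rfl fun j _ => by ring
  have h6 : (-2 : ℂ) ^ k = (-1) ^ k * 2 ^ k := by rw [← mul_pow]; norm_num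
  rw [h5, h4, h6, Complex.ofReal_natCast]
  have h7 : (2 : ℂ) ^ k ≠ 0 := pow_ne_zero _ two_ne_zero
  have h8 : (2 : ℂ) ^ (N - k) ≠ 0 := pow_ne_zero _ two_ne_zero
  rw [mul_div_assoc', div_eq_iff (by simp [h1, h2])]
  rw [← h3]
  ring

end PlanarSymplectic

end

/-! ### Moments as Poisson tails; the rescaled kernel -/

noncomputable section

namespace PlanarSymplectic

open Finset MeasureTheory

/-- Integration by parts; the boundary term at radius `√2` becomes a Poisson probability of mean
`2N` after normalisation. -/
theorem diskMoment_succ (N m : ℕ) :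
    (m + 1) * diskMoment N m - N * diskMoment N (m + 1) =
      2 ^ (m + 1) * Real.exp (-(2 * N)) := by
  have hd (y : ℝ) : HasDerivAt (fun y : ℝ => y ^ (2 * m + 2) * Real.exp (-(N * y ^ 2)))
      ((m + 1) * (2 * y ^ (2 * m + 1) * Real.exp (-(N * y ^ 2))) -
        N * (2 * y ^ (2 * (m + 1) + 1) * Real.exp (-(N * y ^ 2)))) y := by
    have h := (hasDerivAt_pow (2 * m + 2) y).mul
      (((hasDerivAt_pow 2 y).const_mul (N : ℝ)).neg.exp)
    refine h.congr_deriv ?_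
    push_cast
    simp only [Pi.neg_apply]
    ring
  have hc : Continuous fun y : ℝ => (m + 1) * (2 * y ^ (2 * m + 1) * Real.exp (-(N * y ^ 2))) -
        N * (2 * y ^ (2 * (m + 1) + 1) * Real.exp (-(N * y ^ 2))) := by fun_prop
  have h := intervalIntegral.integral_eq_sub_of_hasDerivAt (a := 0) (b := √2) (fun y _ => hd y)
    (hc.intervalIntegrable _ _)
  rw [intervalIntegral.integral_sub (Continuous.intervalIntegrable (by fun_prop) _ _)
    (Continuous.intervalIntegrable (by fun_prop) _ _), intervalIntegral.integral_const_mul,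
    intervalIntegral.integral_const_mul] at h
  rw [diskMoment, diskMoment, h, show 2 * m + 2 = 2 * (m + 1) by ring, pow_mul, Real.sq_sqrt two_pos.le]
  simp [mul_comm]

theorem diskMoment_zero {N : ℕ} : N * diskMoment N 0 = 1 - Real.exp (-(2 * N)) := by
  have hd (y : ℝ) : HasDerivAt (fun y : ℝ => -Real.exp (-(N * y ^ 2)))
      (N * (2 * y ^ (2 * 0 + 1) * Real.exp (-(N * y ^ 2)))) y := by
    refine (((hasDerivAt_pow 2 y).const_mul (N : ℝ)).neg.exp.neg).congr_deriv ?_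
    push_cast
    simp only [Pi.neg_apply]
    ring
  have hc : Continuous fun y : ℝ => N * (2 * y ^ (2 * 0 + 1) * Real.exp (-(N * y ^ 2))) := by
    fun_prop
  have h := intervalIntegral.integral_eq_sub_of_hasDerivAt (a := 0) (b := √2) (fun y _ => hd y)
    (hc.intervalIntegrable _ _)
  rw [intervalIntegral.integral_const_mul] at h
  rw [diskMoment, h, Real.sq_sqrt two_pos.le]
  simp
  ring_nf

theorem diskMoment_succ_le (N m : ℕ) : diskMoment N (m + 1) ≤ 2 * diskMoment N m := by
  rw [diskMoment, diskMoment, ← intervalIntegral.integral_const_mul]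
  refine intervalIntegral.integral_mono_on (Real.sqrt_nonneg 2)
    (Continuous.intervalIntegrable (by fun_prop) _ _)
    (Continuous.intervalIntegrable (by fun_prop) _ _) fun y hy => ?_
  have h1 : y ^ 2 ≤ 2 := by
    have := pow_le_pow_left₀ hy.1 hy.2 2
    rwa [Real.sq_sqrt two_pos.le] at this
  have h2 : 0 ≤ 2 * y ^ (2 * m + 1) * Real.exp (-(N * y ^ 2)) := by
    have := hy.1
    positivity
  calc 2 * y ^ (2 * (m + 1) + 1) * Real.exp (-(N * y ^ 2))
      = y ^ 2 * (2 * y ^ (2 * m + 1) * Real.exp (-(N * y ^ 2))) := by ring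
    _ ≤ _ := mul_le_mul_of_nonneg_right h1 h2

/-- The Poisson probabilities `e^{-M} M^l / l!`. -/
def poissonTerm (M l : ℕ) : ℝ := (M : ℝ) ^ l / l.factorial * Real.exp (-M)

/-- The normalised moments: the probability that a Poisson variable of mean `2N` exceeds `m`. -/
def poissonTail (N m : ℕ) : ℝ := (N : ℝ) ^ (m + 1) / m.factorial * diskMoment N m

theorem poissonTail_pos {N : ℕ} (hN : N ≠ 0) (m : ℕ) : 0 < poissonTail N m := by
  have := diskMoment_pos N m
  have : (0 : ℝ) < N := by exact_mod_cast Nat.pos_of_ne_zero hN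
  unfold poissonTail
  positivity

theorem poissonTerm_nonneg (M l : ℕ) : 0 ≤ poissonTerm M l := by
  unfold poissonTerm
  positivity

theorem poissonTail_succ (N m : ℕ) :
    poissonTail N (m + 1) = poissonTail N m - poissonTerm (2 * N) (m + 1) := by
  have h := diskMoment_succ N m
  have h1 : (m.factorial : ℝ) ≠ 0 := by exact_mod_cast m.factorial_ne_zero
  have h2 : (m + 1 : ℝ) ≠ 0 := by positivity
  rw [poissonTail, poissonTail, poissonTerm, Nat.factorial_succ]
  push_cast
  field_simp
  rw [mul_pow]
  linear_combination (-(N : ℝ) ^ (m + 1)) * h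

theorem poissonTail_eq (N m : ℕ) :
    poissonTail N m = 1 - ∑ i ∈ range (m + 1), poissonTerm (2 * N) i := by
  induction m with
  | zero =>
    rw [poissonTail]
    simp [poissonTerm, diskMoment_zero]
  | succ m ih => rw [poissonTail_succ, ih, sum_range_succ _ (m + 1)]; ring

theorem poissonTail_antitone (N : ℕ) : Antitone (poissonTail N) :=
  antitone_nat_of_succ_le fun m => by
    rw [poissonTail_succ]
    linarith [poissonTerm_nonneg (2 * N) (m + 1)]

theorem poissonTail_le_one (N m : ℕ) : poissonTail N m ≤ 1 := by
  rw [poissonTail_eq]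
  linarith [sum_nonneg fun i (_ : i ∈ range (m + 1)) => poissonTerm_nonneg (2 * N) i]

/-- Log-concavity of the tails. The recursion factors the defect as `p_{m+1} (2N T_{m+1} - (m+2)
T_{m+2})` up to `m + 2`, where `p` is the Poisson probability; the bracket is nonnegative because
`y² ≤ 2` on the disc. -/
theorem poissonTail_mul_le_sq (N m : ℕ) :
    poissonTail N m * poissonTail N (m + 2) ≤ poissonTail N (m + 1) ^ 2 := by
  have h1 : (m + 2) * poissonTail N (m + 2) ≤ 2 * N * poissonTail N (m + 1) := by
    have h2 : (m + 2) * poissonTail N (m + 2) =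
        (N : ℝ) ^ (m + 3) / (m + 1).factorial * diskMoment N (m + 2) := by
      have h3 : ((m + 1).factorial : ℝ) ≠ 0 := by exact_mod_cast (m + 1).factorial_ne_zero
      have h4 : (m + 2 : ℝ) ≠ 0 := by positivity
      rw [poissonTail, Nat.factorial_succ (m + 1)]
      push_cast
      rw [show (m + 1 + 1 : ℝ) = m + 2 by ring]
      field_simp
    have h3 : 2 * N * poissonTail N (m + 1) =
        (N : ℝ) ^ (m + 3) / (m + 1).factorial * (2 * diskMoment N (m + 1)) := by
      rw [poissonTail]; ring
    rw [h2, h3]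
    exact mul_le_mul_of_nonneg_left (diskMoment_succ_le N (m + 1)) (by positivity)
  have h4 : (m + 2) * poissonTerm (2 * N) (m + 2) = 2 * N * poissonTerm (2 * N) (m + 1) := by
    have h3 : ((m + 1).factorial : ℝ) ≠ 0 := by exact_mod_cast (m + 1).factorial_ne_zero
    have h4 : (m + 2 : ℝ) ≠ 0 := by positivity
    rw [poissonTerm, poissonTerm, Nat.factorial_succ (m + 1)]
    push_cast
    rw [show (m + 1 + 1 : ℝ) = m + 2 by ring]
    field_simp
    ring
  have h5 := poissonTail_succ N m
  have h6 := poissonTail_succ N (m + 1)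
  have h7 := poissonTerm_nonneg (2 * N) (m + 1)
  have h8 : (0 : ℝ) < m + 2 := by positivity
  have h9 : (m + 2) * (poissonTail N (m + 1) ^ 2 - poissonTail N m * poissonTail N (m + 2)) =
      poissonTerm (2 * N) (m + 1) *
        (2 * N * poissonTail N (m + 1) - (m + 2) * poissonTail N (m + 2)) := by
    rw [show m + 1 + 1 = m + 2 by ring] at h6
    rw [mul_sub, mul_sub]
    linear_combination (-(m + 2 : ℝ) * poissonTail N (m + 1)) * h6 +
      ((m + 2 : ℝ) * poissonTail N (m + 2)) * h5 + poissonTail N (m + 1) * h4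
  have h10 : 0 ≤ (m + 2) *
      (poissonTail N (m + 1) ^ 2 - poissonTail N m * poissonTail N (m + 2)) := by
    rw [h9]
    exact mul_nonneg h7 (by linarith)
  have := (mul_nonneg_iff_of_pos_left h8).1 h10
  linarith

/-- Every other factor of the telescoping product of ratios of consecutive tails. -/
def tailRatio (N l : ℕ) : ℝ := ∏ j ∈ range l, poissonTail N (2 * j + 2) / poissonTail N (2 * j + 1)

theorem tailRatio_pos {N : ℕ} (hN : N ≠ 0) (l : ℕ) : 0 < tailRatio N l :=
  prod_pos fun _ _ => div_pos (poissonTail_pos hN _) (poissonTail_pos hN _)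

/-- Log-concavity at `2j` gives `(T_{2j+2} / T_{2j+1})² ≤ T_{2j+2} / T_{2j}`, and these bounds
telescope. -/
theorem tailRatio_sq_le {N : ℕ} (hN : N ≠ 0) (l : ℕ) :
    tailRatio N l ^ 2 ≤ poissonTail N (2 * l) / poissonTail N 0 := by
  induction l with
  | zero => simp [tailRatio, (poissonTail_pos hN 0).ne']
  | succ l ih =>
    have h0 := poissonTail_pos hN 0
    have h1 := poissonTail_pos hN (2 * l + 1)
    have h2 := poissonTail_pos hN (2 * l + 2)
    have h3 := poissonTail_mul_le_sq N (2 * l)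
    rw [tailRatio, prod_range_succ, ← tailRatio, mul_pow]
    refine (mul_le_mul_of_nonneg_right ih (by positivity)).trans ?_
    rw [show 2 * (l + 1) = 2 * l + 2 by ring, div_pow, div_mul_div_comm,
      div_le_div_iff₀ (by positivity) h0]
    nlinarith [mul_pos h0 h2]

/-- Log-concavity one index higher gives `(T_{2j+2} / T_{2j+1})² ≥ T_{2j+3} / T_{2j+1}`, which
telescopes over odd indices. -/
theorem le_tailRatio_sq {N : ℕ} (hN : N ≠ 0) (l : ℕ) :
    poissonTail N (2 * l + 1) / poissonTail N 1 ≤ tailRatio N l ^ 2 := by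
  induction l with
  | zero => simp [tailRatio, (poissonTail_pos hN 1).ne']
  | succ l ih =>
    have h0 := poissonTail_pos hN 1
    have h1 := poissonTail_pos hN (2 * l + 1)
    have h2 := poissonTail_pos hN (2 * l + 2)
    have h3 := poissonTail_mul_le_sq N (2 * l + 1)
    rw [tailRatio, prod_range_succ, ← tailRatio, mul_pow]
    refine le_trans ?_ (mul_le_mul_of_nonneg_right ih (by positivity))
    rw [show 2 * (l + 1) + 1 = 2 * l + 1 + 2 by ring, div_pow, div_mul_div_comm,
      div_le_div_iff₀ h0 (by positivity)]
    nlinarith [mul_pos h0 h1]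

/-- Separates the factor that would be present without the wall from the correction `tailRatio`. -/
theorem momentRatio_diskMoment {N : ℕ} (hN : N ≠ 0) (l : ℕ) :
    momentRatio (diskMoment N) l = 2 ^ l * l.factorial / (N : ℝ) ^ l * tailRatio N l := by
  have hN' : (N : ℝ) ≠ 0 := by exact_mod_cast hN
  induction l with
  | zero => simp [momentRatio, tailRatio]
  | succ l ih =>
    rw [momentRatio, tailRatio, prod_range_succ, prod_range_succ, ← momentRatio, ← tailRatio, ih,
      poissonTail, poissonTail, Nat.factorial_succ l, Nat.factorial_succ (2 * l + 1)]
    have h1 := (diskMoment_pos N (2 * l + 1)).ne'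
    have h2 : ((2 * l + 1).factorial : ℝ) ≠ 0 := by exact_mod_cast Nat.factorial_ne_zero _
    have h3 : (l + 1 : ℝ) ≠ 0 := by positivity
    push_cast
    rw [show (2 * l + 1 + 1 : ℝ) = 2 * (l + 1) by ring]
    field_simp
    ring

/-- The weights `4^k (k!)² / (2k+1)!`, that is, `(2k)!! / (2k+1)!!`. -/
def wallisTerm (k : ℕ) : ℝ := 4 ^ k * (k.factorial : ℝ) ^ 2 / (2 * k + 1).factorial

/-- The analogue of `poissonTerm` with mean `(√N + z)²`, up to normalisation. -/
def expTerm (N l : ℕ) (z : ℂ) : ℂ :=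
  ((√N : ℂ) + z) ^ (2 * l) / l.factorial * Complex.exp (-N - 2 * √N * z)

/-- The even summands of the rescaled kernel. -/
def evenTerm (N l : ℕ) (z : ℂ) : ℂ := expTerm N l z / tailRatio N l

/-- The odd summands of the rescaled kernel. -/
def oddTerm (N l : ℕ) (z : ℂ) : ℂ :=
  wallisTerm l * ((√N : ℂ) + z) * expTerm N l z * (tailRatio N l / poissonTail N (2 * l + 1) : ℝ)

/-- The rescaled kernel of the ensemble with `N` particles. -/
def rescaledPreKernel (N : ℕ) (z w : ℂ) : ℂ :=
  2 * ∑ s ∈ range N, (oddTerm N s z * ∑ l ∈ range (s + 1), evenTerm N l w -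
    oddTerm N s w * ∑ l ∈ range (s + 1), evenTerm N l z)

theorem eval_skewPoly_one (h : ℕ → ℝ) (s : ℕ) (z : ℂ) :
    (skewPoly h s 1).eval z = z ^ (2 * s + 1) := by
  rw [eval_skewPoly, sum_eq_single s]
  · simp [skewCoeff]
  · intro l _ hl; simp [skewCoeff, hl]
  · simp

theorem eval_skewPoly_zero {N : ℕ} (hN : N ≠ 0) (s : ℕ) (w : ℂ) :
    (skewPoly (diskMoment N) s 0).eval (√2 * (√N + w) / √N) =
      momentRatio (diskMoment N) s *
        ∑ l ∈ range (s + 1), ((√N : ℂ) + w) ^ (2 * l) / l.factorial / tailRatio N l := by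
  rw [eval_skewPoly, mul_sum]
  refine sum_congr rfl fun l _ => ?_
  have h1 : (tailRatio N l : ℂ) ≠ 0 := Complex.ofReal_ne_zero.2 (tailRatio_pos hN l).ne'
  have h2 : (l.factorial : ℂ) ≠ 0 := by exact_mod_cast l.factorial_ne_zero
  have h3 : (N : ℂ) ≠ 0 := by exact_mod_cast hN
  have h4 : ((√2 : ℝ) : ℂ) ^ 2 = 2 := by
    rw [← Complex.ofReal_pow, Real.sq_sqrt two_pos.le]; simp
  have h5 : ((√N : ℝ) : ℂ) ^ 2 = N := by
    rw [← Complex.ofReal_pow, Real.sq_sqrt (Nat.cast_nonneg N)]; simp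
  simp only [skewCoeff, if_true, Fin.val_zero, add_zero, momentRatio_diskMoment hN l]
  rw [pow_mul, div_pow, mul_pow, h4, h5, div_pow, mul_pow, ← pow_mul]
  push_cast
  field_simp

/-- The exponentials carry the weight: at the rescaled point it equals `e^{-2|z|²}` times these
factors at `z` and `z̄`. With them, `(√N + z)^{2l} / l!` becomes a tilted Poisson probability of
mean `N`. -/
theorem rescaledPreKernel_eq {N : ℕ} (hN : N ≠ 0) (z w : ℂ) :
    (2 * √2 / √N ^ 3 : ℂ) * (Complex.exp (-N - 2 * √N * z) * Complex.exp (-N - 2 * √N * w)) *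
      finitePreKernel N (√2 * (√N + z) / √N) (√2 * (√N + w) / √N) = rescaledPreKernel N z w := by
  have h3 : (N : ℂ) ≠ 0 := by exact_mod_cast hN
  have h3' : ((√N : ℝ) : ℂ) ≠ 0 := by
    rw [Complex.ofReal_ne_zero, Real.sqrt_ne_zero']; exact_mod_cast Nat.pos_of_ne_zero hN
  have h4 : ((√2 : ℝ) : ℂ) ^ 2 = 2 := by
    rw [← Complex.ofReal_pow, Real.sq_sqrt two_pos.le]; simp
  have h5 : ((√N : ℝ) : ℂ) ^ 2 = N := by
    rw [← Complex.ofReal_pow, Real.sq_sqrt (Nat.cast_nonneg N)]; simp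
  have key (s : ℕ) (z w : ℂ) : (2 * √2 / √N ^ 3 : ℂ) *
      (Complex.exp (-N - 2 * √N * z) * Complex.exp (-N - 2 * √N * w)) *
      ((2 * (diskMoment N (2 * s + 1) : ℂ))⁻¹ *
        ((skewPoly (diskMoment N) s 1).eval (√2 * (√N + z) / √N) *
          (skewPoly (diskMoment N) s 0).eval (√2 * (√N + w) / √N))) =
      2 * (oddTerm N s z * ∑ l ∈ range (s + 1), evenTerm N l w) := by
    have h6 : ∑ l ∈ range (s + 1), evenTerm N l w = Complex.exp (-N - 2 * √N * w) *
        ∑ l ∈ range (s + 1), ((√N : ℂ) + w) ^ (2 * l) / l.factorial / tailRatio N l := by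
      rw [mul_sum]
      refine sum_congr rfl fun l _ => ?_
      rw [evenTerm, expTerm]
      ring
    have h7 : (diskMoment N (2 * s + 1) : ℂ) =
        poissonTail N (2 * s + 1) * (2 * s + 1).factorial / (N : ℂ) ^ (2 * s + 2) := by
      rw [poissonTail]
      push_cast
      have : ((2 * s + 1).factorial : ℂ) ≠ 0 := by exact_mod_cast Nat.factorial_ne_zero _
      field_simp
    have h8 : (poissonTail N (2 * s + 1) : ℂ) ≠ 0 :=
      Complex.ofReal_ne_zero.2 (poissonTail_pos hN _).ne'
    have h9 : (s.factorial : ℂ) ≠ 0 := by exact_mod_cast s.factorial_ne_zero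
    have h10 : ((2 * s + 1).factorial : ℂ) ≠ 0 := by exact_mod_cast Nat.factorial_ne_zero _
    have h11 : ((√2 : ℂ) * (√N + z) / √N) ^ (2 * s + 1) =
        2 ^ s * (√N + z) ^ (2 * s) / N ^ s * (√2 * (√N + z) / √N) := by
      rw [pow_succ, pow_mul, div_pow, mul_pow, h4, h5, div_pow, mul_pow, ← pow_mul]
    have h12 : ((√N : ℝ) : ℂ) ^ 4 = (N : ℂ) ^ 2 := by rw [← h5]; ring
    rw [h6, eval_skewPoly_zero hN, eval_skewPoly_one, h7, momentRatio_diskMoment hN, h11, oddTerm,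
      expTerm, wallisTerm]
    generalize (∑ l ∈ range (s + 1), ((√N : ℂ) + w) ^ (2 * l) / l.factorial / tailRatio N l) = U
    generalize Complex.exp (-N - 2 * √N * z) = X₁
    generalize Complex.exp (-N - 2 * √N * w) = X₂
    push_cast
    have h13 : (4 : ℂ) ^ s = 2 ^ s * 2 ^ s := by rw [← mul_pow]; norm_num
    rw [h13]
    field_simp
    rw [h4, h12]
    ring
  rw [finitePreKernel, rescaledPreKernel, mul_sum, mul_sum]
  refine sum_congr rfl fun s _ => ?_
  have k1 := key s z w
  have k2 := key s w z
  rw [mul_sub, mul_sub, mul_sub, ← k1, ← k2]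
  ring

end PlanarSymplectic

end

/-! ### Riemann sums with Gaussian domination -/

noncomputable section

namespace PlanarSymplectic

open Finset MeasureTheory Filter Topology

/-- The step function on the grid of mesh `1 / (2r)` whose integral is `∑ k < n, F k`. -/
def gridFun (N n : ℕ) (r : ℝ) (F : ℕ → ℂ) (t : ℝ) : ℂ :=
  if 0 ≤ N + 2 * r * t ∧ ⌊N + 2 * r * t⌋₊ < n then 2 * r * F ⌊N + 2 * r * t⌋₊ else 0

theorem gridFun_eq_sum (N n : ℕ) {r : ℝ} (hr : 0 < r) (F : ℕ → ℂ) :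
    gridFun N n r F = fun t => ∑ k ∈ range n,
      (Set.Ico (((k : ℝ) - N) / (2 * r)) (((k : ℝ) + 1 - N) / (2 * r))).indicator
        (fun _ => 2 * r * F k) t := by
  ext t
  have hmem (k : ℕ) : t ∈ Set.Ico (((k : ℝ) - N) / (2 * r)) (((k : ℝ) + 1 - N) / (2 * r)) ↔
      (k : ℝ) ≤ N + 2 * r * t ∧ N + 2 * r * t < k + 1 := by
    rw [Set.mem_Ico, div_le_iff₀ (by positivity), lt_div_iff₀ (by positivity)]
    constructor <;> rintro ⟨h1, h2⟩ <;> constructor <;> linarith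
  simp only [Set.indicator_apply, hmem]
  by_cases h0 : 0 ≤ N + 2 * r * t
  · have h1 (k : ℕ) : ((k : ℝ) ≤ N + 2 * r * t ∧ N + 2 * r * t < k + 1) ↔
        ⌊N + 2 * r * t⌋₊ = k := (Nat.floor_eq_iff h0).symm
    simp only [h1, sum_ite_eq, mem_range, gridFun, h0, true_and]
  · rw [gridFun, if_neg (by tauto), sum_eq_zero]
    intro k _
    rw [if_neg]
    rintro ⟨h1, -⟩
    exact h0 (le_trans (Nat.cast_nonneg k) h1)

theorem integral_gridFun (N n : ℕ) {r : ℝ} (hr : 0 < r) (F : ℕ → ℂ) :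
    ∫ t, gridFun N n r F t = ∑ k ∈ range n, F k := by
  rw [gridFun_eq_sum N n hr, integral_finsetSum]
  · refine sum_congr rfl fun k _ => ?_
    rw [integral_indicator measurableSet_Ico, setIntegral_const, Measure.real, Real.volume_Ico,
      ENNReal.toReal_ofReal (by rw [← sub_div]; apply div_nonneg <;> linarith),
      Complex.real_smul]
    have : (r : ℂ) ≠ 0 := by exact_mod_cast hr.ne'
    push_cast
    field_simp
    ring
  · intro k _
    rw [integrable_indicator_iff measurableSet_Ico]
    exact integrableOn_const (by simp)

theorem aestronglyMeasurable_gridFun (N n : ℕ) {r : ℝ} (hr : 0 < r) (F : ℕ → ℂ) :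
    AEStronglyMeasurable (gridFun N n r F) volume := by
  rw [gridFun_eq_sum N n hr]
  refine Measurable.aestronglyMeasurable ?_
  exact Finset.measurable_fun_sum _ fun k _ => measurable_const.indicator measurableSet_Ico

/-- The sum is the integral of a step function in `t`, with index `⌊N + 2√N t⌋`, so dominated
convergence applies. The limit hypothesis ranges over all index families `κ` with the right scaling
so that these floors can be inserted. -/
theorem tendsto_sum_of_gaussian_bound {ι : Type*} {l : Filter ι} [l.IsCountablyGenerated]
    {N n : ι → ℕ} (hN : Tendsto N l atTop) {F : ι → ℕ → ℂ} {G : ℝ → ℂ} {τ C D : ℝ}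
    (hτ : τ ≤ 0) (hC : 0 ≤ C) (hD : 0 ≤ D) (hn : ∀ᶠ i in l, n i ≤ N i)
    (hnτ : Tendsto (fun i => ((n i : ℝ) - N i) / (2 * √(N i))) l (𝓝 τ))
    (hbound : ∀ᶠ i in l, ∀ k < N i, ‖F i k‖ * √(N i) ≤
      C * Real.exp (D * (((N i : ℝ) - k) / √(N i)) - (((N i : ℝ) - k) / √(N i)) ^ 2 / 2))
    (hlim : ∀ t < 0, ∀ κ : ι → ℕ, (∀ᶠ i in l, κ i < N i) →
      Tendsto (fun i => ((κ i : ℝ) - N i) / (2 * √(N i))) l (𝓝 t) →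
      Tendsto (fun i => (2 * √(N i) : ℂ) * F i (κ i)) l (𝓝 (G t))) :
    Tendsto (fun i => ∑ k ∈ range (n i), F i k) l (𝓝 (∫ t in Set.Iio τ, G t)) := by
  have hNpos : ∀ᶠ i in l, 1 ≤ N i := hN.eventually_ge_atTop 1
  have hr : Tendsto (fun i => √(N i)) l atTop :=
    Real.tendsto_sqrt_atTop.comp (tendsto_natCast_atTop_atTop.comp hN)
  have hsum : (fun i => ∫ t, gridFun (N i) (n i) √(N i) (F i) t) =ᶠ[l]
      fun i => ∑ k ∈ range (n i), F i k := by
    filter_upwards [hNpos] with i hi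
    exact integral_gridFun _ _ (Real.sqrt_pos.2 (by exact_mod_cast hi)) _
  refine Tendsto.congr' hsum ?_
  rw [← integral_indicator measurableSet_Iio]
  refine tendsto_integral_filter_of_dominated_convergence
    -- On a grid cell `x = (N - k)/√N` lies in `[-2t, -2t + 1]`, so `Dx - x²/2 ≤ D - 2Dt - 2t²`, and
    -- `(D + t)² ≥ 0` bounds this by `D + D² - t²`.
    (fun t => 2 * C * Real.exp (D + D ^ 2) * Real.exp (-1 * t ^ 2)) ?_ ?_ ?_ ?_
  · filter_upwards [hNpos] with i hi
    exact aestronglyMeasurable_gridFun _ _ (Real.sqrt_pos.2 (by exact_mod_cast hi)) _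
  · filter_upwards [hNpos, hn, hbound] with i hi hni hb
    refine ae_of_all _ fun t => ?_
    have hr1 : 1 ≤ √(N i) := Real.one_le_sqrt.2 (by exact_mod_cast hi)
    set r := √(N i)
    unfold gridFun
    split_ifs with h
    · obtain ⟨h0, h1⟩ := h
      set k := ⌊N i + 2 * r * t⌋₊ with hk
      have hk1 : (k : ℝ) ≤ N i + 2 * r * t := Nat.floor_le h0
      have hk2 : N i + 2 * r * t < k + 1 := Nat.lt_floor_add_one _
      have hkN : k < N i := h1.trans_le hni
      have hkN' : (k : ℝ) + 1 ≤ N i := by exact_mod_cast hkN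
      have ht : t < 0 := by
        by_contra! ht
        have : 0 ≤ 2 * r * t := by positivity
        linarith
      have hb' := hb k hkN
      set x := ((N i : ℝ) - k) / r with hx
      have hx1 : -2 * t ≤ x := by
        rw [hx, le_div_iff₀ (by positivity)]; linarith
      have hx2 : x ≤ -2 * t + 1 := by
        rw [hx, div_le_iff₀ (by positivity)]; nlinarith
      have h3 : D * x - x ^ 2 / 2 ≤ (D + D ^ 2) + -1 * t ^ 2 := by
        have h4 : D * x ≤ D * (-2 * t + 1) := mul_le_mul_of_nonneg_left hx2 hD
        have h5 : (-2 * t) ^ 2 ≤ x ^ 2 := pow_le_pow_left₀ (by linarith) hx1 2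
        nlinarith [sq_nonneg (D + t)]
      rw [norm_mul, norm_mul, Complex.norm_real, Real.norm_of_nonneg (by positivity : 0 ≤ r),
        Complex.norm_ofNat]
      calc 2 * r * ‖F i k‖ = 2 * (‖F i k‖ * r) := by ring
        _ ≤ 2 * (C * Real.exp ((D + D ^ 2) + -1 * t ^ 2)) := by
          refine mul_le_mul_of_nonneg_left (hb'.trans ?_) two_pos.le
          exact mul_le_mul_of_nonneg_left (Real.exp_le_exp.2 h3) hC
        _ = _ := by rw [Real.exp_add]; ring
    · rw [norm_zero]; positivity
  · exact (integrable_exp_neg_mul_sq one_pos).const_mul _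
  · have hτne : ∀ᵐ t : ℝ, t ≠ τ := by
      simp [ae_iff]
    filter_upwards [hτne] with t ht
    rcases lt_or_gt_of_ne ht with ht | ht
    · rw [Set.indicator_of_mem (by exact ht)]
      have h1 : ∀ᶠ i in l, 0 ≤ N i + 2 * √(N i) * t := by
        filter_upwards [hr.eventually_ge_atTop (-2 * t)] with i hi
        have h2 : √(N i) * √(N i) = N i := Real.mul_self_sqrt (Nat.cast_nonneg _)
        nlinarith [Real.sqrt_nonneg (N i)]
      have h2 : ∀ᶠ i in l, ⌊N i + 2 * √(N i) * t⌋₊ < n i := by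
        filter_upwards [h1, hNpos, hnτ.eventually (lt_mem_nhds ht)] with i hi hi' hi''
        have hrp : 0 < √(N i) := Real.sqrt_pos.2 (by exact_mod_cast hi')
        rw [Nat.floor_lt hi]
        rw [lt_div_iff₀ (by positivity)] at hi''
        linarith
      have h3 : Tendsto (fun i => ((⌊N i + 2 * √(N i) * t⌋₊ : ℝ) - N i) / (2 * √(N i))) l
          (𝓝 t) := by
        have h4 : Tendsto (fun i => t - 1 / (2 * √(N i))) l (𝓝 t) := by
          have h5 : Tendsto (fun i => 1 / (2 * √(N i))) l (𝓝 0) :=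
            tendsto_const_nhds.div_atTop (hr.const_mul_atTop two_pos)
          simpa using tendsto_const_nhds.sub h5
        refine tendsto_of_tendsto_of_tendsto_of_le_of_le' h4 tendsto_const_nhds ?_ ?_
        · filter_upwards [h1, hNpos] with i hi hi'
          have hrp : 0 < √(N i) := Real.sqrt_pos.2 (by exact_mod_cast hi')
          have := Nat.lt_floor_add_one (N i + 2 * √(N i) * t)
          rw [le_div_iff₀ (by positivity), sub_mul, one_div_mul_cancel (by positivity)]
          linarith
        · filter_upwards [h1, hNpos] with i hi hi'
          have hrp : 0 < √(N i) := Real.sqrt_pos.2 (by exact_mod_cast hi')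
          have := Nat.floor_le hi
          rw [div_le_iff₀ (by positivity)]
          linarith
      refine (hlim t (ht.trans_le hτ) (fun i => ⌊N i + 2 * √(N i) * t⌋₊) ?_ h3).congr' ?_
      · filter_upwards [h2, hn] with i hi hi' using hi.trans_le hi'
      · filter_upwards [h1, h2] with i hi hi'
        rw [gridFun, if_pos ⟨hi, hi'⟩]
    · rw [Set.indicator_of_notMem (by simpa using ht.le)]
      refine tendsto_const_nhds.congr' ?_
      filter_upwards [hNpos, hnτ.eventually (gt_mem_nhds ht)] with i hi hi'
      have hrp : 0 < √(N i) := Real.sqrt_pos.2 (by exact_mod_cast hi)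
      rw [div_lt_iff₀ (by positivity)] at hi'
      rw [gridFun, if_neg]
      rintro ⟨-, h⟩
      exact absurd h (not_lt.2 (Nat.le_floor (by linarith)))

end PlanarSymplectic

end

/-! ### Poisson local limit and Wallis asymptotics -/

noncomputable section

namespace PlanarSymplectic

open Finset MeasureTheory Filter Topology

theorem poissonTerm_self_mul_sqrt {N : ℕ} (hN : N ≠ 0) :
    poissonTerm N N * √N = (√2 * Stirling.stirlingSeq N)⁻¹ := by
  have hN' : (0 : ℝ) < N := by exact_mod_cast Nat.pos_of_ne_zero hN
  have h1 : (N.factorial : ℝ) ≠ 0 := by exact_mod_cast N.factorial_ne_zero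
  rw [poissonTerm, Stirling.stirlingSeq, Real.sqrt_mul two_pos.le, div_pow, ← Real.exp_nat_mul,
    mul_one, Real.exp_neg]
  have h3 : √(2 : ℝ) * √2 = 2 := Real.mul_self_sqrt two_pos.le
  have h4 : √(N : ℝ) ≠ 0 := (Real.sqrt_pos.2 hN').ne'
  have h5 : √(2 : ℝ) ≠ 0 := (Real.sqrt_pos.2 two_pos).ne'
  field_simp

theorem poissonTerm_self_mul_sqrt_le {N : ℕ} (hN : N ≠ 0) : poissonTerm N N * √N ≤ 1 := by
  rw [poissonTerm_self_mul_sqrt hN]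
  apply inv_le_one_of_one_le₀
  have h1 := Stirling.sqrt_pi_le_stirlingSeq hN
  have h2 : (1 : ℝ) ≤ √2 := Real.one_le_sqrt.2 one_le_two
  have h3 : 1 ≤ √Real.pi := Real.one_le_sqrt.2 (by linarith [Real.pi_gt_three])
  exact one_le_mul_of_one_le_of_one_le h2 (h3.trans h1)

theorem tendsto_poissonTerm_self_mul_sqrt :
    Tendsto (fun N : ℕ => poissonTerm N N * √N) atTop (𝓝 (1 / √(2 * Real.pi))) := by
  have h : Tendsto (fun N : ℕ => (√2 * Stirling.stirlingSeq N)⁻¹) atTop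
      (𝓝 (√2 * √Real.pi)⁻¹) :=
    (Stirling.tendsto_stirlingSeq_sqrt_pi.const_mul _).inv₀
      (mul_ne_zero (by positivity) (Real.sqrt_pos.2 Real.pi_pos).ne')
  rw [one_div, Real.sqrt_mul two_pos.le]
  refine h.congr' ?_
  filter_upwards [eventually_ne_atTop 0] with N hN
  rw [poissonTerm_self_mul_sqrt hN]

theorem poissonTerm_sub_succ {N m : ℕ} (hm : m + 1 ≤ N) :
    poissonTerm N (N - (m + 1)) = poissonTerm N (N - m) * (1 - m / N) := by
  have hN : (N : ℝ) ≠ 0 := by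
    have : N ≠ 0 := by omega
    exact_mod_cast this
  obtain ⟨a, rfl⟩ : ∃ a, N = a + m + 1 := ⟨N - m - 1, by omega⟩
  rw [show a + m + 1 - (m + 1) = a by omega, show a + m + 1 - m = a + 1 by omega, poissonTerm,
    poissonTerm, Nat.factorial_succ, pow_succ]
  have h1 : (a.factorial : ℝ) ≠ 0 := by exact_mod_cast a.factorial_ne_zero
  have h2 : (a + 1 : ℝ) ≠ 0 := by positivity
  have h3 : (a + m + 1 : ℝ) ≠ 0 := by positivity
  push_cast
  field_simp
  ring

/-- Descending from the mode multiplies by `1 - j/N ≤ e^{-j/N}`, and the exponents sum to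
`m(m-1)/(2N)`. -/
theorem poissonTerm_sub_le {N : ℕ} (hN : N ≠ 0) (m : ℕ) (hm : m ≤ N) :
    poissonTerm N (N - m) ≤ poissonTerm N N * Real.exp (-(m * (m - 1) / (2 * N))) := by
  have hN' : (0 : ℝ) < N := by exact_mod_cast Nat.pos_of_ne_zero hN
  induction m with
  | zero => simp
  | succ m ih =>
    have h1 : (1 : ℝ) - m / N ≤ Real.exp (-(m / N)) := by
      linarith [Real.add_one_le_exp (-((m : ℝ) / N))]
    rw [poissonTerm_sub_succ hm]
    calc poissonTerm N (N - m) * (1 - m / N)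
        ≤ poissonTerm N (N - m) * Real.exp (-(m / N)) :=
          mul_le_mul_of_nonneg_left h1 (poissonTerm_nonneg _ _)
      _ ≤ poissonTerm N N * Real.exp (-(m * (m - 1) / (2 * N))) * Real.exp (-(m / N)) :=
          mul_le_mul_of_nonneg_right (ih (by omega)) (Real.exp_pos _).le
      _ = _ := by
        rw [mul_assoc, ← Real.exp_add]
        congr 2
        push_cast
        field_simp
        ring

/-- Here `1 - u ≥ e^{-u-u²}` for `0 ≤ u ≤ 1/2`. The squares accumulate to the cubic error, which
vanishes in the limit when `m` is of order `√N`. -/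
theorem le_poissonTerm_sub {N : ℕ} (hN : N ≠ 0) (m : ℕ) (hm : 2 * m ≤ N) :
    poissonTerm N N * Real.exp (-((m : ℝ) ^ 2 / (2 * N) + (m : ℝ) ^ 3 / (N : ℝ) ^ 2)) ≤
      poissonTerm N (N - m) := by
  have hN' : (0 : ℝ) < N := by exact_mod_cast Nat.pos_of_ne_zero hN
  induction m with
  | zero => simp
  | succ m ih =>
    have hm' : 2 * ((m : ℝ) / N) ≤ 1 := by
      rw [mul_div_assoc', div_le_one hN']
      exact_mod_cast (by omega : 2 * m ≤ N)
    have hu0 : 0 ≤ (m : ℝ) / N := by positivity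
    have h1 : Real.exp (-((m : ℝ) / N + ((m : ℝ) / N) ^ 2)) ≤ 1 - m / N := by
      set u := (m : ℝ) / N
      have h2 : 1 + (u + u ^ 2) + (u + u ^ 2) ^ 2 / 2 ≤ Real.exp (u + u ^ 2) :=
        Real.quadratic_le_exp_of_nonneg (by positivity)
      rw [Real.exp_neg]
      apply inv_le_of_inv_le₀ (by linarith)
      refine le_trans ?_ h2
      rw [inv_le_iff_one_le_mul₀ (by linarith)]
      have h3 : 2 * u ≤ (1 + u) ^ 2 * (1 - u) := by
        nlinarith [mul_nonneg hu0 (sub_nonneg.2 hm'), mul_nonneg hu0 hu0]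
      nlinarith [mul_le_mul_of_nonneg_left h3 (mul_nonneg hu0 hu0)]
    rw [poissonTerm_sub_succ (by omega)]
    refine le_trans ?_ (mul_le_mul_of_nonneg_left h1 (poissonTerm_nonneg _ _))
    refine le_trans ?_ (mul_le_mul_of_nonneg_right (ih (by omega)) (Real.exp_pos _).le)
    rw [mul_assoc, ← Real.exp_add]
    refine mul_le_mul_of_nonneg_left (Real.exp_le_exp.2 ?_) (poissonTerm_nonneg _ _)
    have h3 : ((m + 1 : ℕ) : ℝ) ^ 2 / (2 * N) =
        (m : ℝ) ^ 2 / (2 * N) + m / N + 1 / (2 * N) := by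
      push_cast; field_simp; ring
    have h4 : ((m + 1 : ℕ) : ℝ) ^ 3 / (N : ℝ) ^ 2 =
        (m : ℝ) ^ 3 / (N : ℝ) ^ 2 + (3 * m ^ 2 + 3 * m + 1) / (N : ℝ) ^ 2 := by
      push_cast; field_simp; ring
    have h5 : ((m : ℝ) / N) ^ 2 ≤ (3 * m ^ 2 + 3 * m + 1) / (N : ℝ) ^ 2 := by
      rw [div_pow]
      gcongr
      nlinarith [(Nat.cast_nonneg m : (0 : ℝ) ≤ m)]
    have h6 : 0 ≤ 1 / (2 * (N : ℝ)) := by positivity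
    linarith

theorem poissonTerm_mul_sqrt_le {N k : ℕ} (hN : N ≠ 0) (hk : k < N) :
    poissonTerm N k * √N ≤
      Real.exp (((N : ℝ) - k) / √N - (((N : ℝ) - k) / √N) ^ 2 / 2) := by
  have hN' : (1 : ℝ) ≤ N := by exact_mod_cast Nat.one_le_iff_ne_zero.2 hN
  have h1 := poissonTerm_sub_le hN (N - k) (Nat.sub_le _ _)
  rw [Nat.sub_sub_self hk.le, Nat.cast_sub hk.le] at h1
  have hr : 1 ≤ √(N : ℝ) := Real.one_le_sqrt.2 hN'
  have hr2 : √(N : ℝ) ^ 2 = N := Real.sq_sqrt (Nat.cast_nonneg N)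
  have hk' : (0 : ℝ) < N - k := by
    have : (k : ℝ) < N := by exact_mod_cast hk
    linarith
  calc poissonTerm N k * √N
      ≤ poissonTerm N N * Real.exp (-(((N : ℝ) - k) * (((N : ℝ) - k) - 1) / (2 * N))) * √N :=
        mul_le_mul_of_nonneg_right h1 (Real.sqrt_nonneg _)
    _ = (poissonTerm N N * √N) * Real.exp (-(((N : ℝ) - k) * (((N : ℝ) - k) - 1) / (2 * N))) := by
        ring
    _ ≤ 1 * Real.exp (-(((N : ℝ) - k) * (((N : ℝ) - k) - 1) / (2 * N))) :=
        mul_le_mul_of_nonneg_right (poissonTerm_self_mul_sqrt_le hN) (Real.exp_pos _).le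
    _ ≤ _ := by
        rw [one_mul]
        apply Real.exp_le_exp.2
        set y := (N : ℝ) - k
        rw [div_pow, hr2]
        have h2 : -(y * (y - 1) / (2 * N)) = y / (2 * N) - y ^ 2 / N / 2 := by
          field_simp; ring
        have h3 : y / (2 * N) ≤ y / √N := by
          gcongr
          nlinarith
        linarith

section Limits

variable {ι : Type*} {l : Filter ι} {N κ : ι → ℕ} {t : ℝ}

theorem tendsto_sqrt_natCast (hN : Tendsto N l atTop) :
    Tendsto (fun i => √(N i : ℝ)) l atTop :=
  Real.tendsto_sqrt_atTop.comp (tendsto_natCast_atTop_atTop.comp hN)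

theorem tendsto_sub_div_sqrt
    (hκ : Tendsto (fun i => ((κ i : ℝ) - N i) / (2 * √(N i))) l (𝓝 t)) :
    Tendsto (fun i => ((N i : ℝ) - κ i) / √(N i)) l (𝓝 (-2 * t)) := by
  refine (hκ.const_mul (-2)).congr fun i => ?_
  rw [mul_div_assoc', mul_div_mul_comm]
  ring

theorem tendsto_index_div (hN : Tendsto N l atTop)
    (hκ : Tendsto (fun i => ((κ i : ℝ) - N i) / (2 * √(N i))) l (𝓝 t)) :
    Tendsto (fun i => (κ i : ℝ) / N i) l (𝓝 1) := by
  have h := (tendsto_sub_div_sqrt hκ).mul (tendsto_sqrt_natCast hN).inv_tendsto_atTop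
  have h2 := h.const_sub 1
  rw [mul_zero, sub_zero] at h2
  refine h2.congr' ?_
  filter_upwards [hN.eventually_ge_atTop 1] with i hi
  have h3 : (0 : ℝ) < N i := by exact_mod_cast hi
  have h4 : √(N i : ℝ) * √(N i) = N i := Real.mul_self_sqrt h3.le
  simp only [Pi.inv_apply]
  rw [← div_eq_mul_inv, div_div, h4]
  field_simp
  ring

theorem tendsto_index_atTop (hN : Tendsto N l atTop)
    (hκ : Tendsto (fun i => ((κ i : ℝ) - N i) / (2 * √(N i))) l (𝓝 t)) :
    Tendsto κ l atTop := by
  rw [← tendsto_natCast_atTop_iff (R := ℝ)]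
  refine ((tendsto_index_div hN hκ).pos_mul_atTop one_pos
    (tendsto_natCast_atTop_atTop.comp hN)).congr' ?_
  filter_upwards [hN.eventually_ge_atTop 1] with i hi
  have h3 : (N i : ℝ) ≠ 0 := by
    have : N i ≠ 0 := by omega
    exact_mod_cast this
  simp only [Function.comp_apply]
  field_simp

/-- Squeeze between the two bounds, whose exponents differ by multiples of `1/√N`; Stirling's
formula supplies the value at the mode. -/
theorem tendsto_poissonTerm (hN : Tendsto N l atTop) (hκN : ∀ᶠ i in l, κ i < N i)
    (hκ : Tendsto (fun i => ((κ i : ℝ) - N i) / (2 * √(N i))) l (𝓝 t)) :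
    Tendsto (fun i => √(N i) * poissonTerm (N i) (κ i)) l
      (𝓝 (1 / √(2 * Real.pi) * Real.exp (-2 * t ^ 2))) := by
  have hx := tendsto_sub_div_sqrt hκ
  have hr := (tendsto_sqrt_natCast hN).inv_tendsto_atTop
  have hp := tendsto_poissonTerm_self_mul_sqrt.comp hN
  have hup : Tendsto (fun i => poissonTerm (N i) (N i) * √(N i) *
      Real.exp (-((((N i : ℝ) - κ i) / √(N i)) ^ 2 / 2 -
        ((N i : ℝ) - κ i) / √(N i) * (√(N i))⁻¹ / 2))) l
      (𝓝 (1 / √(2 * Real.pi) * Real.exp (-2 * t ^ 2))) := by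
    refine hp.mul (Real.continuous_exp.tendsto _ |>.comp ?_)
    have := ((hx.pow 2).div_const 2).sub ((hx.mul hr).div_const 2)
    convert! this.neg using 2
    ring
  have hlo : Tendsto (fun i => poissonTerm (N i) (N i) * √(N i) *
      Real.exp (-((((N i : ℝ) - κ i) / √(N i)) ^ 2 / 2 +
        (((N i : ℝ) - κ i) / √(N i)) ^ 3 * (√(N i))⁻¹))) l
      (𝓝 (1 / √(2 * Real.pi) * Real.exp (-2 * t ^ 2))) := by
    refine hp.mul (Real.continuous_exp.tendsto _ |>.comp ?_)
    have := ((hx.pow 2).div_const 2).add ((hx.pow 3).mul hr)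
    convert! this.neg using 2
    ring
  refine tendsto_of_tendsto_of_tendsto_of_le_of_le' hlo hup ?_ ?_
  · filter_upwards [hN.eventually_ge_atTop 1, hκN,
      (tendsto_index_div hN hκ).eventually (lt_mem_nhds (by norm_num : (1 / 2 : ℝ) < 1))]
      with i hi hk hh
    have h3 : (0 : ℝ) < N i := by exact_mod_cast hi
    have h4 : √(N i : ℝ) ^ 2 = N i := Real.sq_sqrt h3.le
    have h5 : 0 < √(N i : ℝ) := Real.sqrt_pos.2 h3
    rw [lt_div_iff₀ h3] at hh
    have h6 : N i < 2 * κ i := by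
      have : (N i : ℝ) < 2 * κ i := by linarith
      exact_mod_cast this
    have h1 := le_poissonTerm_sub (by omega) (N i - κ i) (by omega : 2 * (N i - κ i) ≤ N i)
    rw [Nat.sub_sub_self hk.le, Nat.cast_sub hk.le] at h1
    have h7 : (((N i : ℝ) - κ i) / √(N i)) ^ 2 / 2 +
        (((N i : ℝ) - κ i) / √(N i)) ^ 3 * (√(N i))⁻¹ =
        ((N i : ℝ) - κ i) ^ 2 / (2 * N i) + ((N i : ℝ) - κ i) ^ 3 / (N i : ℝ) ^ 2 := by
      have h8 : √(N i : ℝ) ^ 3 * √(N i) = (N i : ℝ) ^ 2 := by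
        calc √(N i : ℝ) ^ 3 * √(N i) = (√(N i : ℝ) ^ 2) ^ 2 := by ring
          _ = _ := by rw [h4]
      rw [div_pow, div_pow, h4, ← div_eq_mul_inv, div_div, div_div, h8, mul_comm (N i : ℝ) 2]
    rw [h7, mul_right_comm, mul_comm]
    exact mul_le_mul_of_nonneg_left h1 h5.le
  · filter_upwards [hN.eventually_ge_atTop 1, hκN] with i hi hk
    have h3 : (0 : ℝ) < N i := by exact_mod_cast hi
    have h4 : √(N i : ℝ) ^ 2 = N i := Real.sq_sqrt h3.le
    have h5 : 0 < √(N i : ℝ) := Real.sqrt_pos.2 h3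
    have h1 := poissonTerm_sub_le (by omega : N i ≠ 0) (N i - κ i) (Nat.sub_le _ _)
    rw [Nat.sub_sub_self hk.le, Nat.cast_sub hk.le] at h1
    have h7 : (((N i : ℝ) - κ i) / √(N i)) ^ 2 / 2 -
        ((N i : ℝ) - κ i) / √(N i) * (√(N i))⁻¹ / 2 =
        ((N i : ℝ) - κ i) * (((N i : ℝ) - κ i) - 1) / (2 * N i) := by
      have h8 : ((N i : ℝ) - κ i) / √(N i) * (√(N i))⁻¹ = ((N i : ℝ) - κ i) / N i := by
        rw [← div_eq_mul_inv, div_div, ← pow_two, h4]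
      rw [h8, div_pow, h4]
      field_simp
    rw [h7, mul_right_comm, mul_comm]
    exact mul_le_mul_of_nonneg_right h1 h5.le

theorem wallisTerm_sq (k : ℕ) : wallisTerm k ^ 2 = Real.Wallis.W k / (2 * k + 1) := by
  rw [Real.Wallis.W_eq_factorial_ratio, wallisTerm, Nat.factorial_succ]
  have h1 : ((2 * k).factorial : ℝ) ≠ 0 := by exact_mod_cast Nat.factorial_ne_zero _
  have h2 : (2 * k + 1 : ℝ) ≠ 0 := by positivity
  have h3 : (2 : ℝ) ^ (4 * k) = (4 ^ k) ^ 2 := by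
    rw [← pow_mul, mul_comm k 2, pow_mul, pow_mul]; norm_num
  push_cast
  rw [h3]
  field_simp

theorem wallisTerm_nonneg (k : ℕ) : 0 ≤ wallisTerm k := by
  unfold wallisTerm
  positivity

theorem wallisTerm_mul_sqrt_le {N k : ℕ} (hk : k < N) :
    wallisTerm k * √N ≤ 4 * Real.exp (((N : ℝ) - k) / √N) := by
  have hN' : (1 : ℝ) ≤ N := by exact_mod_cast (by omega : 1 ≤ N)
  have hr2 : √(N : ℝ) ^ 2 = N := Real.sq_sqrt (Nat.cast_nonneg N)
  have hk' : (k : ℝ) + 1 ≤ N := by exact_mod_cast hk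
  have hk0 : (0 : ℝ) ≤ k := Nat.cast_nonneg k
  have hrp : 0 < √(N : ℝ) := Real.sqrt_pos.2 (by linarith)
  set x := ((N : ℝ) - k) / √N with hx
  have hx0 : 0 ≤ x := div_nonneg (by linarith) (Real.sqrt_nonneg _)
  have hex : 1 + x ≤ Real.exp x := by linarith [Real.add_one_le_exp x]
  have hsq : (wallisTerm k * √N) ^ 2 ≤ (4 * Real.exp x) ^ 2 := by
    have h1 : (wallisTerm k * √N) ^ 2 ≤ 2 * N / (k + 1) := by
      rw [mul_pow, wallisTerm_sq, hr2, div_mul_eq_mul_div, div_le_div_iff₀ (by positivity)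
        (by positivity)]
      have h2 : Real.Wallis.W k ≤ 2 := by
        linarith [Real.Wallis.W_le k, Real.pi_le_four]
      have h3 : Real.Wallis.W k * N ≤ 2 * N := mul_le_mul_of_nonneg_right h2 (by linarith)
      nlinarith
    refine h1.trans ?_
    rw [div_le_iff₀ (by positivity)]
    have h4 : (1 + x) ^ 2 ≤ Real.exp x ^ 2 := pow_le_pow_left₀ (by linarith) hex 2
    have h7 : 1 ≤ Real.exp x ^ 2 := by nlinarith
    have h8 : (4 * Real.exp x) ^ 2 * (k + 1) = 16 * (Real.exp x ^ 2 * (k + 1)) := by ring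
    rw [h8]
    -- Either `k + 1` is comparable to `N`, or `x ≥ √N / 2` and the exponential absorbs the factor
    -- `√N`.
    rcases le_or_gt (N : ℝ) (2 * (k + 1)) with h | h
    · nlinarith [mul_le_mul_of_nonneg_right h7 (by linarith : (0 : ℝ) ≤ k + 1)]
    · have h5 : √(N : ℝ) ≤ 2 * x := by
        rw [hx, mul_div_assoc', le_div_iff₀ hrp, ← pow_two, hr2]
        linarith
      have h6 : (N : ℝ) ≤ 4 * x ^ 2 := by
        rw [← hr2]
        nlinarith
      have h9 : Real.exp x ^ 2 ≤ Real.exp x ^ 2 * (k + 1) :=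
        le_mul_of_one_le_right (by positivity) (by linarith)
      nlinarith
  exact (sq_le_sq₀ (mul_nonneg (wallisTerm_nonneg k) hrp.le) (by positivity)).1 hsq

theorem tendsto_wallisTerm (hN : Tendsto N l atTop)
    (hκ : Tendsto (fun i => ((κ i : ℝ) - N i) / (2 * √(N i))) l (𝓝 t)) :
    Tendsto (fun i => wallisTerm (κ i) * √(N i)) l (𝓝 (√Real.pi / 2)) := by
  have h1 := tendsto_index_div hN hκ
  have h2 := tendsto_index_atTop hN hκ
  have h3 : Tendsto (fun i => Real.Wallis.W (κ i) / (2 * ((κ i : ℝ) / N i) + (N i : ℝ)⁻¹)) l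
      (𝓝 ((Real.pi / 2) / (2 * 1 + 0))) :=
    (Real.Wallis.tendsto_W_nhds_pi_div_two.comp h2).div
      ((h1.const_mul 2).add (tendsto_natCast_atTop_atTop.comp hN).inv_tendsto_atTop) (by norm_num)
  have h4 := h3.sqrt
  have h5 : √(Real.pi / 2 / (2 * 1 + 0)) = √Real.pi / 2 := by
    rw [show Real.pi / 2 / (2 * 1 + 0) = Real.pi / 2 ^ 2 by ring,
      Real.sqrt_div Real.pi_pos.le, Real.sqrt_sq two_pos.le]
  rw [h5] at h4
  refine h4.congr' ?_
  filter_upwards [hN.eventually_ge_atTop 1] with i hi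
  have h6 : (0 : ℝ) < N i := by exact_mod_cast hi
  rw [← Real.sqrt_sq (mul_nonneg (wallisTerm_nonneg (κ i)) (Real.sqrt_nonneg (N i : ℝ))), mul_pow,
    wallisTerm_sq, Real.sq_sqrt h6.le]
  congr 1
  have h7 : (2 * (κ i : ℝ) + 1) ≠ 0 := by positivity
  field_simp

end Limits

end PlanarSymplectic

end

/-! ### The complex tilt and the limit of the tails -/

noncomputable section

namespace PlanarSymplectic

open Finset MeasureTheory Filter Topology

theorem expTerm_eq {N : ℕ} (hN : N ≠ 0) (k : ℕ) (z : ℂ) :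
    expTerm N k z = poissonTerm N k * ((1 + z / √N) ^ (2 * k) * Complex.exp (-2 * √N * z)) := by
  have h3' : ((√N : ℝ) : ℂ) ≠ 0 := by
    rw [Complex.ofReal_ne_zero, Real.sqrt_ne_zero']; exact_mod_cast Nat.pos_of_ne_zero hN
  have h5 : ((√N : ℝ) : ℂ) ^ 2 = N := by
    rw [← Complex.ofReal_pow, Real.sq_sqrt (Nat.cast_nonneg N)]; simp
  have h1 : (√N : ℂ) + z = √N * (1 + z / √N) := by field_simp
  rw [expTerm, poissonTerm, h1, mul_pow, pow_mul, h5,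
    show -(N : ℂ) - 2 * √N * z = -N + -2 * √N * z by ring, Complex.exp_add]
  push_cast
  ring

/-- After `|1 + z/√N|² ≤ exp(2 Re z/√N + |z|²/N)`, the part of order `√N` cancels against the
exponential, leaving a term linear in `(N - k)/√N`. -/
theorem norm_tilt_le {N k : ℕ} (hk : k < N) (z : ℂ) :
    ‖(1 + z / √N) ^ (2 * k) * Complex.exp (-2 * √N * z)‖ ≤
      Real.exp (2 * ‖z‖ * (((N : ℝ) - k) / √N) + ‖z‖ ^ 2) := by
  have hN' : (1 : ℝ) ≤ N := by exact_mod_cast (by omega : 1 ≤ N)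
  have hr2 : √(N : ℝ) ^ 2 = N := Real.sq_sqrt (Nat.cast_nonneg N)
  have hrp : 0 < √(N : ℝ) := Real.sqrt_pos.2 (by linarith)
  have hk' : (k : ℝ) ≤ N := by exact_mod_cast hk.le
  have h1 : ‖1 + z / √N‖ ^ 2 ≤ Real.exp (2 * z.re / √N + ‖z‖ ^ 2 / N) := by
    have h2 : ‖1 + z / √N‖ ^ 2 = 1 + (2 * z.re / √N + ‖z‖ ^ 2 / N) := by
      have h3 : z / (√N : ℂ) = ((√N)⁻¹ : ℝ) * z := by push_cast; field_simp
      rw [← Complex.normSq_eq_norm_sq, ← Complex.normSq_eq_norm_sq, h3, Complex.normSq_add,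
        Complex.normSq_mul, Complex.normSq_one, Complex.normSq_ofReal]
      simp only [map_mul, Complex.conj_ofReal, one_mul, Complex.re_ofReal_mul, Complex.conj_re]
      rw [← mul_inv, ← pow_two, hr2]
      ring
    rw [h2]
    linarith [Real.add_one_le_exp (2 * z.re / √N + ‖z‖ ^ 2 / N)]
  rw [norm_mul, norm_pow, pow_mul, Complex.norm_exp]
  calc (‖1 + z / √N‖ ^ 2) ^ k * Real.exp (-2 * √N * z).re
      ≤ Real.exp (2 * z.re / √N + ‖z‖ ^ 2 / N) ^ k * Real.exp (-2 * √N * z).re := by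
        gcongr
    _ = Real.exp (k * (2 * z.re / √N + ‖z‖ ^ 2 / N) + -2 * √N * z.re) := by
        rw [← Real.exp_nat_mul, ← Real.exp_add]
        congr 2
        have : (-2 * √N * z : ℂ) = ((-2 * √N : ℝ) : ℂ) * z := by push_cast; ring
        rw [this, Complex.re_ofReal_mul]
    _ ≤ _ := by
        apply Real.exp_le_exp.2
        have h4 : k * (2 * z.re / √N + ‖z‖ ^ 2 / N) + -2 * √N * z.re =
            2 * (-z.re) * (((N : ℝ) - k) / √N) + ‖z‖ ^ 2 * (k / N) := by
          rw [show -2 * √(N : ℝ) * z.re = -2 * (√N ^ 2 / √N) * z.re by field_simp, hr2]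
          ring
        rw [h4]
        have h5 : 0 ≤ ((N : ℝ) - k) / √N := div_nonneg (by linarith) hrp.le
        have h6 : -z.re ≤ ‖z‖ := (neg_le_abs _).trans (Complex.abs_re_le_norm z)
        have h7 : (k : ℝ) / N ≤ 1 := (div_le_one (by linarith)).2 hk'
        have h8 : ‖z‖ ^ 2 * (k / N) ≤ ‖z‖ ^ 2 * 1 := mul_le_mul_of_nonneg_left h7 (by positivity)
        have h9 := mul_le_mul_of_nonneg_right h6 h5
        linarith

theorem norm_expTerm_mul_sqrt_le {N k : ℕ} (hk : k < N) (z : ℂ) :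
    ‖expTerm N k z‖ * √N ≤ Real.exp (‖z‖ ^ 2) *
      Real.exp ((1 + 2 * ‖z‖) * (((N : ℝ) - k) / √N) - (((N : ℝ) - k) / √N) ^ 2 / 2) := by
  have hN : N ≠ 0 := by omega
  rw [expTerm_eq hN, norm_mul, Complex.norm_real, Real.norm_of_nonneg (poissonTerm_nonneg N k),
    mul_right_comm]
  refine (mul_le_mul (poissonTerm_mul_sqrt_le hN hk) (norm_tilt_le hk z) (norm_nonneg _)
    (Real.exp_pos _).le).trans_eq ?_
  rw [← Real.exp_add, ← Real.exp_add]
  congr 1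
  ring

section Limits

variable {ι : Type*} {l : Filter ι} {N κ : ι → ℕ} {t : ℝ} {z : ι → ℂ} {z₀ : ℂ}

theorem tendsto_div_sqrt (hN : Tendsto N l atTop) (hz : Tendsto z l (𝓝 z₀)) :
    Tendsto (fun i => z i / (√(N i) : ℂ)) l (𝓝 0) := by
  have h2 : Tendsto (fun i => (((√(N i))⁻¹ : ℝ) : ℂ)) l (𝓝 ((0 : ℝ) : ℂ)) :=
    (Complex.continuous_ofReal.tendsto _).comp (tendsto_sqrt_natCast hN).inv_tendsto_atTop
  have h3 := hz.mul h2
  simp only [Complex.ofReal_zero, mul_zero, Complex.ofReal_inv] at h3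
  exact h3.congr fun i => by rw [div_eq_mul_inv]

/-- Second-order expansion of the logarithm in `u = z/√N`. The cubic remainder, multiplied by `2κ ≤
2N`, is still of order `1/√N`. -/
theorem tendsto_tilt (hN : Tendsto N l atTop) (hκN : ∀ᶠ i in l, κ i < N i)
    (hκ : Tendsto (fun i => ((κ i : ℝ) - N i) / (2 * √(N i))) l (𝓝 t))
    (hz : Tendsto z l (𝓝 z₀)) :
    Tendsto (fun i => (1 + z i / √(N i)) ^ (2 * κ i) * Complex.exp (-2 * √(N i) * z i)) l
      (𝓝 (Complex.exp (4 * t * z₀ - z₀ ^ 2))) := by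
  set u : ι → ℂ := fun i => z i / √(N i) with hu
  have hu0 : Tendsto u l (𝓝 0) := tendsto_div_sqrt hN hz
  set R : ι → ℂ := fun i => Complex.log (1 + u i) - (u i - u i ^ 2 / 2) with hR
  have hsmall : ∀ᶠ i in l, ‖u i‖ < 1 / 2 := by
    have := hu0.norm
    rw [norm_zero] at this
    exact this.eventually (gt_mem_nhds (by norm_num))
  have hRbound : ∀ᶠ i in l, ‖2 * (κ i : ℂ) * R i‖ ≤ 2 * ‖z i‖ ^ 3 * (√(N i))⁻¹ := by
    filter_upwards [hsmall, hκN] with i hi hk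
    have hN0 : (0 : ℝ) < N i := by exact_mod_cast (by omega : 0 < N i)
    have hk' : (κ i : ℝ) ≤ N i := by exact_mod_cast hk.le
    have hrp : 0 < √(N i : ℝ) := Real.sqrt_pos.2 hN0
    have hr2 : √(N i : ℝ) ^ 2 = N i := Real.sq_sqrt hN0.le
    have h1 := Complex.norm_log_sub_logTaylor_le 2 (z := u i) (by linarith)
    have h2 : Complex.logTaylor (2 + 1) (u i) = u i - u i ^ 2 / 2 := by
      simp [Complex.logTaylor_succ, Complex.logTaylor_zero]
      ring
    rw [h2] at h1
    have h3 : (1 - ‖u i‖)⁻¹ ≤ 2 := inv_le_of_inv_le₀ two_pos (by linarith)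
    have h4 : ‖R i‖ ≤ ‖u i‖ ^ 3 := by
      refine h1.trans ?_
      have h5 : ‖u i‖ ^ (2 + 1) * (1 - ‖u i‖)⁻¹ ≤ ‖u i‖ ^ (2 + 1) * 2 :=
        mul_le_mul_of_nonneg_left h3 (by positivity)
      have h6 : 0 ≤ ‖u i‖ ^ 3 := by positivity
      norm_num at h5 ⊢
      linarith
    have h5 : ‖u i‖ = ‖z i‖ / √(N i) := by
      rw [hu]
      simp [abs_of_pos hrp]
    rw [norm_mul, norm_mul, Complex.norm_natCast, Complex.norm_ofNat]
    calc 2 * (κ i : ℝ) * ‖R i‖ ≤ 2 * (N i : ℝ) * (‖u i‖ ^ 3) := by gcongr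
      _ = _ := by
        rw [h5, ← hr2, Real.sqrt_sq hrp.le]
        field_simp
  have hR0 : Tendsto (fun i => 2 * (κ i : ℂ) * R i) l (𝓝 0) := by
    refine squeeze_zero_norm' hRbound ?_
    have := ((hz.norm.pow 3).const_mul 2).mul (tendsto_sqrt_natCast hN).inv_tendsto_atTop
    rw [mul_zero] at this
    exact this
  have hκ' : Tendsto (fun i => ((((κ i : ℝ) - N i) / (2 * √(N i)) : ℝ) : ℂ)) l (𝓝 (t : ℂ)) :=
    (Complex.continuous_ofReal.tendsto _).comp hκ
  have hρ : Tendsto (fun i => (((κ i : ℝ) / N i : ℝ) : ℂ)) l (𝓝 ((1 : ℝ) : ℂ)) :=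
    (Complex.continuous_ofReal.tendsto _).comp (tendsto_index_div hN hκ)
  have hexp : Tendsto (fun i => 4 * ((((κ i : ℝ) - N i) / (2 * √(N i)) : ℝ) : ℂ) * z i -
      (((κ i : ℝ) / N i : ℝ) : ℂ) * z i ^ 2 + 2 * (κ i : ℂ) * R i) l
      (𝓝 (4 * t * z₀ - z₀ ^ 2)) := by
    have := (((hκ'.const_mul 4).mul hz).sub (hρ.mul (hz.pow 2))).add hR0
    simpa using this
  refine ((Complex.continuous_exp.tendsto _).comp hexp).congr' ?_
  filter_upwards [hsmall, hκN] with i hi hk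
  have hN0 : (0 : ℝ) < N i := by exact_mod_cast (by omega : 0 < N i)
  have hrp : 0 < √(N i : ℝ) := Real.sqrt_pos.2 hN0
  have hrp' : ((√(N i : ℝ) : ℝ) : ℂ) ≠ 0 := Complex.ofReal_ne_zero.2 hrp.ne'
  have hN0' : (N i : ℂ) ≠ 0 := by exact_mod_cast hN0.ne'
  have hr2 : ((√(N i : ℝ) : ℝ) : ℂ) ^ 2 = N i := by
    rw [← Complex.ofReal_pow, Real.sq_sqrt hN0.le]; simp
  have h1 : 1 + u i ≠ 0 := by
    intro h
    have h2 : u i = -1 := by linear_combination h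
    rw [h2] at hi
    norm_num at hi
  have h2 : (1 + z i / √(N i)) = Complex.exp (Complex.log (1 + u i)) := (Complex.exp_log h1).symm
  simp only [Function.comp_apply]
  rw [h2, ← Complex.exp_nat_mul, ← Complex.exp_add]
  congr 1
  have h3 : Complex.log (1 + u i) = u i - u i ^ 2 / 2 + R i := by simp only [hR]; ring
  rw [h3]
  have h4 : u i ^ 2 = z i ^ 2 / N i := by simp only [hu]; rw [div_pow, hr2]
  have h5 : u i = z i / √(N i) := rfl
  have h6 : (N i : ℂ) / √(N i) = √(N i) := by rw [← hr2, pow_two]; field_simp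
  have h7 : (((((κ i : ℝ) - N i) / (2 * √(N i)) : ℝ)) : ℂ) =
      (κ i / √(N i) - √(N i)) / 2 := by
    push_cast; field_simp; rw [hr2]
  rw [h4, h5, h7]
  push_cast
  ring

theorem tendsto_expTerm (hN : Tendsto N l atTop) (hκN : ∀ᶠ i in l, κ i < N i)
    (hκ : Tendsto (fun i => ((κ i : ℝ) - N i) / (2 * √(N i))) l (𝓝 t))
    (hz : Tendsto z l (𝓝 z₀)) :
    Tendsto (fun i => √(N i) * expTerm (N i) (κ i) (z i)) l
      (𝓝 ((1 / √(2 * Real.pi) : ℝ) *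
        (Complex.exp (z₀ ^ 2) * Complex.exp (-2 * (z₀ - t) ^ 2)))) := by
  have h1 : Tendsto (fun i => (((√(N i) * poissonTerm (N i) (κ i) : ℝ)) : ℂ)) l
      (𝓝 ((1 / √(2 * Real.pi) * Real.exp (-2 * t ^ 2) : ℝ) : ℂ)) :=
    (Complex.continuous_ofReal.tendsto _).comp (tendsto_poissonTerm hN hκN hκ)
  have h2 := h1.mul (tendsto_tilt hN hκN hκ hz)
  have h3 : ((1 / √(2 * Real.pi) * Real.exp (-2 * t ^ 2) : ℝ) : ℂ) *
      Complex.exp (4 * t * z₀ - z₀ ^ 2) = ((1 / √(2 * Real.pi) : ℝ) *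
        (Complex.exp (z₀ ^ 2) * Complex.exp (-2 * (z₀ - t) ^ 2))) := by
    rw [Complex.ofReal_mul, Complex.ofReal_exp, mul_assoc, ← Complex.exp_add, ← Complex.exp_add]
    congr 2
    push_cast
    ring
  rw [h3] at h2
  refine h2.congr' ?_
  filter_upwards [hκN] with i hi
  rw [expTerm_eq (by omega)]
  push_cast
  ring

theorem one_sub_integral_gaussian (t : ℝ) :
    1 - ∫ s in Set.Iio (√2 * t), 2 / √(2 * Real.pi) * Real.exp (-2 * s ^ 2) =
      erfc (2 * t) / 2 := by
  have hint : Integrable fun s : ℝ => 2 / √(2 * Real.pi) * Real.exp (-2 * s ^ 2) :=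
    (integrable_exp_neg_mul_sq two_pos).const_mul _
  have h1 : ∫ s : ℝ, 2 / √(2 * Real.pi) * Real.exp (-2 * s ^ 2) = 1 := by
    rw [integral_const_mul, integral_gaussian, ← Real.sqrt_sq (by norm_num : (0 : ℝ) ≤ 2),
      ← Real.sqrt_div (by positivity), ← Real.sqrt_mul (by positivity)]
    rw [Real.sqrt_eq_one]
    rw [Real.sqrt_sq (by norm_num : (0 : ℝ) ≤ 2)]
    have := Real.pi_ne_zero
    field_simp
  have h2 := integral_add_compl (measurableSet_Iio (a := √2 * t)) hint
  rw [h1, Set.compl_Iio, integral_Ici_eq_integral_Ioi] at h2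
  have h3 : ∫ s in Set.Ioi (√2 * t), 2 / √(2 * Real.pi) * Real.exp (-2 * s ^ 2) =
      erfc (2 * t) / 2 := by
    have h4 := integral_comp_mul_left_Ioi (fun x : ℝ => Real.exp (-x ^ 2)) (√2 * t)
      (b := √2) (by positivity)
    have h5 : √(2 : ℝ) * √2 = 2 := Real.mul_self_sqrt two_pos.le
    have h6 (s : ℝ) : -(√2 * s) ^ 2 = -2 * s ^ 2 := by
      rw [mul_pow, Real.sq_sqrt two_pos.le]; ring
    simp only [h6, ← mul_assoc, h5] at h4
    rw [integral_const_mul, h4, erfc, Real.sqrt_mul two_pos.le, smul_eq_mul]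
    have h7 : √Real.pi ≠ 0 := (Real.sqrt_pos.2 Real.pi_pos).ne'
    have h8 : √(2 : ℝ) ≠ 0 := (Real.sqrt_pos.2 two_pos).ne'
    field_simp
    rw [Real.sq_sqrt two_pos.le]
  linarith

/-- Central limit theorem for a Poisson variable of mean `2N`, by summing the local limit. The
endpoint is `√2 t` because the natural scale is `2√(2N)` rather than `4√N`. -/
theorem tendsto_poissonTail [l.IsCountablyGenerated] (hN : Tendsto N l atTop) (ht : t ≤ 0)
    (hκN : ∀ᶠ i in l, κ i + 1 ≤ 2 * N i)
    (hκ : Tendsto (fun i => ((κ i : ℝ) - 2 * N i) / (4 * √(N i))) l (𝓝 t)) :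
    Tendsto (fun i => poissonTail (N i) (κ i)) l (𝓝 (erfc (2 * t) / 2)) := by
  have hN2 : Tendsto (fun i => 2 * N i) l atTop :=
    hN.const_mul_atTop' two_pos
  have key := tendsto_sum_of_gaussian_bound (l := l) (N := fun i => 2 * N i)
    (n := fun i => κ i + 1) hN2 (F := fun i k => (poissonTerm (2 * N i) k : ℂ))
    (G := fun s => ((2 / √(2 * Real.pi) * Real.exp (-2 * s ^ 2) : ℝ) : ℂ)) (τ := √2 * t)
    (C := 1) (D := 1) (mul_nonpos_of_nonneg_of_nonpos (Real.sqrt_nonneg 2) ht) zero_le_one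
    zero_le_one hκN ?_ ?_ ?_
  · rw [integral_complex_ofReal] at key
    have h1 := (Complex.continuous_re.tendsto _).comp key
    simp only [Complex.ofReal_re] at h1
    rw [← one_sub_integral_gaussian]
    refine (h1.const_sub 1).congr fun i => ?_
    rw [poissonTail_eq]
    simp only [Function.comp_apply, ← Complex.ofReal_sum, Complex.ofReal_re]
  · have h2 := (hκ.const_mul √2).add
      ((tendsto_sqrt_natCast hN2).inv_tendsto_atTop.const_mul (1 / 2))
    rw [mul_zero, add_zero] at h2
    refine h2.congr' ?_
    filter_upwards [hN.eventually_ge_atTop 1] with i hi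
    have hN0 : (0 : ℝ) < N i := by exact_mod_cast hi
    have hrp : √(N i : ℝ) ≠ 0 := (Real.sqrt_pos.2 hN0).ne'
    have h8 : √(2 : ℝ) ≠ 0 := (Real.sqrt_pos.2 two_pos).ne'
    simp only [Pi.inv_apply]
    push_cast
    rw [Real.sqrt_mul two_pos.le]
    field_simp
    rw [Real.sq_sqrt two_pos.le]
    ring
  · filter_upwards [hN.eventually_ge_atTop 1] with i hi k hk
    rw [Complex.norm_real, Real.norm_of_nonneg (poissonTerm_nonneg _ _), one_mul, one_mul]
    exact poissonTerm_mul_sqrt_le (by omega) hk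
  · intro s _ κ' h1 h2
    have h3 := ((Complex.continuous_ofReal.tendsto _).comp
      (tendsto_poissonTerm hN2 h1 h2)).const_mul 2
    convert! h3 using 2
    · simp only [Function.comp_apply]; push_cast; ring
    · push_cast; ring

end Limits

end PlanarSymplectic

end

/-! ### Regularity of `erfc` and of the edge function -/

noncomputable section

namespace PlanarSymplectic

open Finset MeasureTheory Filter Topology

theorem integrable_exp_neg_sq : Integrable fun t : ℝ => Real.exp (-t ^ 2) := by
  simpa using integrable_exp_neg_mul_sq one_pos

theorem erfc_antitone : Antitone erfc := by
  intro a b hab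
  unfold erfc
  refine mul_le_mul_of_nonneg_left ?_ (by positivity)
  exact setIntegral_mono_set integrable_exp_neg_sq.integrableOn
    (ae_of_all _ fun t => (Real.exp_pos _).le) (Set.Ioi_subset_Ioi hab).eventuallyLE

theorem erfc_pos (x : ℝ) : 0 < erfc x := by
  unfold erfc
  have h : 0 < ∫ t in Set.Ioi x, Real.exp (-t ^ 2) := by
    rw [setIntegral_pos_iff_support_of_nonneg_ae (ae_of_all _ fun t => (Real.exp_pos _).le)
      integrable_exp_neg_sq.integrableOn]
    have : Function.support (fun t : ℝ => Real.exp (-t ^ 2)) = Set.univ := by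
      ext t; simp [(Real.exp_pos _).ne']
    rw [this, Set.univ_inter, Real.volume_Ioi]
    exact ENNReal.zero_lt_top
  have := Real.pi_pos
  positivity

theorem continuous_erfc : Continuous erfc := by
  unfold erfc
  refine continuous_const.mul ?_
  have h (x : ℝ) : ∫ t in Set.Ioi x, Real.exp (-t ^ 2) =
      (∫ t in Set.Ioi 0, Real.exp (-t ^ 2)) - ∫ t in (0 : ℝ)..x, Real.exp (-t ^ 2) := by
    rw [← intervalIntegral.integral_Ioi_sub_Ioi' integrable_exp_neg_sq.integrableOn
      integrable_exp_neg_sq.integrableOn, sub_sub_cancel]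
  rw [funext h]
  exact continuous_const.sub (intervalIntegral.continuous_primitive
    (fun a b => (by fun_prop : Continuous fun t : ℝ => Real.exp (-t ^ 2)).intervalIntegrable a b) 0)

/-- The integrand of `softHardEdgeFun`, that is, its derivative. -/
def softHardEdgeDeriv (z : ℂ) (t : ℝ) : ℂ :=
  (2 / √Real.pi : ℂ) * (Complex.exp (-2 * (z - (t : ℂ)) ^ 2) / (√(erfc (2 * t)) : ℂ))

theorem sqrt_erfc_ne_zero (t : ℝ) : (√(erfc t) : ℂ) ≠ 0 :=
  Complex.ofReal_ne_zero.2 (Real.sqrt_pos.2 (erfc_pos t)).ne'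

theorem continuous_softHardEdgeDeriv (z : ℂ) : Continuous (softHardEdgeDeriv z) := by
  unfold softHardEdgeDeriv
  refine continuous_const.mul (Continuous.div (by fun_prop) ?_ fun t => sqrt_erfc_ne_zero _)
  exact Complex.continuous_ofReal.comp (continuous_erfc.comp (by fun_prop)).sqrt

/-- On the half-line the denominator is at least its value at `u`, since `erfc` decreases; the
numerator is Gaussian. -/
theorem integrableOn_softHardEdgeDeriv (z : ℂ) (u : ℝ) :
    IntegrableOn (softHardEdgeDeriv z) (Set.Iic u) := by
  have hg : Integrable fun t : ℝ => Complex.exp (-2 * (z - (t : ℂ)) ^ 2) := by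
    have := integrable_cexp_quadratic (b := 2) (by simp) (4 * z) (-2 * z ^ 2)
    refine this.congr (ae_of_all _ fun t => ?_)
    simp only
    congr 1
    ring
  have hd := hg.norm.const_mul (2 / √Real.pi * (√(erfc (2 * u)))⁻¹)
  refine Integrable.mono' hd.integrableOn
    (continuous_softHardEdgeDeriv z).aestronglyMeasurable.restrict ?_
  refine (ae_restrict_iff' measurableSet_Iic).2 (ae_of_all _ fun t ht => ?_)
  have h1 : √(erfc (2 * u)) ≤ √(erfc (2 * t)) :=
    Real.sqrt_le_sqrt (erfc_antitone (by linarith [Set.mem_Iic.1 ht]))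
  have h2 : 0 < √(erfc (2 * u)) := Real.sqrt_pos.2 (erfc_pos _)
  rw [softHardEdgeDeriv, norm_mul, norm_div, norm_div, Complex.norm_real, Complex.norm_real,
    Complex.norm_ofNat, Real.norm_of_nonneg (Real.sqrt_nonneg _),
    Real.norm_of_nonneg (Real.sqrt_nonneg _), mul_assoc, div_eq_mul_inv ‖_‖, mul_comm ‖_‖]
  gcongr

theorem softHardEdgeFun_eq (z : ℂ) (u : ℝ) :
    softHardEdgeFun z u = ∫ t in Set.Iio u, softHardEdgeDeriv z t := by
  rw [softHardEdgeFun, ← integral_const_mul, integral_Iic_eq_integral_Iio]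
  rfl

theorem hasDerivAt_softHardEdgeFun (z : ℂ) (u : ℝ) :
    HasDerivAt (softHardEdgeFun z) (softHardEdgeDeriv z u) u := by
  have h (x : ℝ) : softHardEdgeFun z x = softHardEdgeFun z 0 +
      ∫ t in (0 : ℝ)..x, softHardEdgeDeriv z t := by
    rw [← intervalIntegral.integral_Iic_sub_Iic (integrableOn_softHardEdgeDeriv z 0)
      (integrableOn_softHardEdgeDeriv z x), softHardEdgeFun_eq, softHardEdgeFun_eq,
      integral_Iic_eq_integral_Iio, integral_Iic_eq_integral_Iio, add_sub_cancel]
  rw [funext h]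
  refine HasDerivAt.const_add _ ?_
  exact intervalIntegral.integral_hasDerivAt_right
    ((continuous_softHardEdgeDeriv z).intervalIntegrable _ _)
    ((continuous_softHardEdgeDeriv z).stronglyMeasurableAtFilter _ _)
    (continuous_softHardEdgeDeriv z).continuousAt

theorem deriv_softHardEdgeFun (z : ℂ) (u : ℝ) :
    deriv (softHardEdgeFun z) u = softHardEdgeDeriv z u :=
  (hasDerivAt_softHardEdgeFun z u).deriv

end PlanarSymplectic

end

/-! ### Convergence of the rescaled kernel -/

noncomputable section

namespace PlanarSymplectic

open Finset MeasureTheory Filter Topology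

theorem tendsto_poissonTail_zero : Tendsto (fun N => poissonTail N 0) atTop (𝓝 1) := by
  have h : Tendsto (fun N : ℕ => 1 - Real.exp (-(2 * (N : ℝ)))) atTop (𝓝 (1 - 0)) := by
    refine (Real.tendsto_exp_atBot.comp ?_).const_sub 1
    exact tendsto_neg_atTop_atBot.comp (tendsto_natCast_atTop_atTop.const_mul_atTop two_pos)
  rw [sub_zero] at h
  refine h.congr fun N => ?_
  rw [poissonTail_eq]
  simp [poissonTerm]

theorem tendsto_poissonTail_one : Tendsto (fun N => poissonTail N 1) atTop (𝓝 1) := by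
  have h1 : Tendsto (fun N : ℕ => (2 * (N : ℝ)) ^ 1 * Real.exp (-(2 * (N : ℝ)))) atTop (𝓝 0) :=
    (Real.tendsto_pow_mul_exp_neg_atTop_nhds_zero 1).comp
      (tendsto_natCast_atTop_atTop.const_mul_atTop two_pos)
  have h2 := tendsto_poissonTail_zero.sub h1
  rw [sub_zero] at h2
  refine h2.congr fun N => ?_
  rw [poissonTail_succ]
  simp [poissonTerm]

section Limits

variable {ι : Type*} {l : Filter ι} [l.IsCountablyGenerated] {N κ : ι → ℕ} {t : ℝ} {z w : ι → ℂ}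
  {z₀ w₀ : ℂ}

/-- The smallest tail that occurs has index `2N - 1` and tends to `erfc(0)/2 = 1/2`, so eventually
all exceed `1/4`; the sandwich then keeps the squared ratio between `1/4` and `4`. -/
theorem eventually_tail_bounds (hN : Tendsto N l atTop) :
    ∀ᶠ i in l, ∀ k < N i, 1 / 4 ≤ poissonTail (N i) (2 * k + 1) ∧
      1 / 2 ≤ tailRatio (N i) k ∧ tailRatio (N i) k ≤ 2 := by
  have h1 : Tendsto (fun i => poissonTail (N i) (2 * N i - 1)) l (𝓝 (erfc (2 * 0) / 2)) := by
    refine tendsto_poissonTail hN le_rfl ?_ ?_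
    · filter_upwards [hN.eventually_ge_atTop 1] with i hi
      omega
    · have h2 : Tendsto (fun i => (-1 : ℝ) / (4 * √(N i))) l (𝓝 0) :=
        tendsto_const_nhds.div_atTop ((tendsto_sqrt_natCast hN).const_mul_atTop four_pos)
      refine h2.congr' ?_
      filter_upwards [hN.eventually_ge_atTop 1] with i hi
      rw [Nat.cast_sub (by omega)]
      push_cast
      ring
  have h0 : erfc (2 * 0) / 2 = 1 / 2 := by
    rw [← one_sub_integral_gaussian, mul_zero]
    have h2 : ∫ s in Set.Iio (0 : ℝ), 2 / √(2 * Real.pi) * Real.exp (-2 * s ^ 2) = 1 / 2 := by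
      have h3 := integral_gaussian_Ioi 2
      have h4 := integral_comp_neg_Iic 0 (fun s : ℝ => Real.exp (-2 * s ^ 2))
      simp only [neg_sq, neg_zero] at h4
      rw [integral_const_mul, ← integral_Iic_eq_integral_Iio, h4, h3,
        Real.sqrt_div Real.pi_pos.le, Real.sqrt_mul two_pos.le]
      have h7 : √Real.pi ≠ 0 := (Real.sqrt_pos.2 Real.pi_pos).ne'
      have h8 : √(2 : ℝ) ≠ 0 := (Real.sqrt_pos.2 two_pos).ne'
      field_simp
      rw [Real.sq_sqrt two_pos.le]
    rw [h2]; norm_num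
  rw [h0] at h1
  filter_upwards [h1.eventually (lt_mem_nhds (by norm_num : (1 / 4 : ℝ) < 1 / 2)),
    hN.eventually_ge_atTop 1] with i hi hi1 k hk
  have hN0 : N i ≠ 0 := by omega
  have hT {m : ℕ} (hm : m ≤ 2 * N i - 1) : 1 / 4 ≤ poissonTail (N i) m :=
    hi.le.trans (poissonTail_antitone _ hm)
  have hS := (tailRatio_pos hN0 k).le
  refine ⟨hT (by omega), ?_, ?_⟩
  · have h5 := le_tailRatio_sq hN0 k
    have h6 : 1 / 4 ≤ poissonTail (N i) (2 * k + 1) / poissonTail (N i) 1 := by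
      rw [le_div_iff₀ (poissonTail_pos hN0 1)]
      have := poissonTail_le_one (N i) 1
      have := hT (m := 2 * k + 1) (by omega)
      linarith
    nlinarith
  · have h5 := tailRatio_sq_le hN0 k
    have h6 : poissonTail (N i) (2 * k) / poissonTail (N i) 0 ≤ 4 := by
      rw [div_le_iff₀ (poissonTail_pos hN0 0)]
      have := poissonTail_le_one (N i) (2 * k)
      have := hT (m := 0) (by omega)
      linarith
    nlinarith

theorem tendsto_poissonTail_even_odd (hN : Tendsto N l atTop) (ht : t < 0)
    (hκN : ∀ᶠ i in l, κ i < N i)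
    (hκ : Tendsto (fun i => ((κ i : ℝ) - N i) / (2 * √(N i))) l (𝓝 t)) :
    Tendsto (fun i => poissonTail (N i) (2 * κ i)) l (𝓝 (erfc (2 * t) / 2)) ∧
      Tendsto (fun i => poissonTail (N i) (2 * κ i + 1)) l (𝓝 (erfc (2 * t) / 2)) := by
  constructor
  · refine tendsto_poissonTail hN ht.le (hκN.mono fun i hi => by omega) (hκ.congr fun i => ?_)
    push_cast
    rw [← mul_sub, show (4 : ℝ) * √(N i) = 2 * (2 * √(N i)) by ring,
      mul_div_mul_left _ _ two_ne_zero]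
  · refine tendsto_poissonTail hN ht.le (hκN.mono fun i hi => by omega) ?_
    have h1 := hκ.add ((tendsto_sqrt_natCast hN).inv_tendsto_atTop.const_mul (1 / 4))
    rw [mul_zero, add_zero] at h1
    refine h1.congr fun i => ?_
    simp only [Pi.inv_apply]
    push_cast
    rw [show (4 : ℝ) * √(N i) = 2 * (2 * √(N i)) by ring]
    ring

/-- Both telescoped bounds have the same limit: their denominators tend to `1` and their numerators
to a common tail probability. -/
theorem tendsto_tailRatio (hN : Tendsto N l atTop) (ht : t < 0) (hκN : ∀ᶠ i in l, κ i < N i)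
    (hκ : Tendsto (fun i => ((κ i : ℝ) - N i) / (2 * √(N i))) l (𝓝 t)) :
    Tendsto (fun i => tailRatio (N i) (κ i)) l (𝓝 √(erfc (2 * t) / 2)) := by
  obtain ⟨h1, h2⟩ := tendsto_poissonTail_even_odd hN ht hκN hκ
  have h3 := h1.div (tendsto_poissonTail_zero.comp hN) one_ne_zero
  have h4 := h2.div (tendsto_poissonTail_one.comp hN) one_ne_zero
  rw [div_one] at h3 h4
  have h5 : Tendsto (fun i => tailRatio (N i) (κ i) ^ 2) l (𝓝 (erfc (2 * t) / 2)) := by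
    refine tendsto_of_tendsto_of_tendsto_of_le_of_le' h4 h3 ?_ ?_
    · filter_upwards [hN.eventually_ge_atTop 1] with i hi
      exact le_tailRatio_sq (by omega) _
    · filter_upwards [hN.eventually_ge_atTop 1] with i hi
      exact tailRatio_sq_le (by omega) _
  refine h5.sqrt.congr' ?_
  filter_upwards [hN.eventually_ge_atTop 1] with i hi
  exact Real.sqrt_sq (tailRatio_pos (by omega) _).le

theorem tendsto_evenTerm (hN : Tendsto N l atTop) (hz : Tendsto z l (𝓝 z₀)) (ht : t < 0)
    (hκN : ∀ᶠ i in l, κ i < N i)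
    (hκ : Tendsto (fun i => ((κ i : ℝ) - N i) / (2 * √(N i))) l (𝓝 t)) :
    Tendsto (fun i => (2 * √(N i) : ℂ) * evenTerm (N i) (κ i) (z i)) l
      (𝓝 (Complex.exp (z₀ ^ 2) * softHardEdgeDeriv z₀ t)) := by
  have h0 : √(erfc (2 * t) / 2) ≠ 0 := (Real.sqrt_pos.2 (half_pos (erfc_pos _))).ne'
  have h1 := ((tendsto_expTerm hN hκN hκ hz).const_mul 2).div
    ((Complex.continuous_ofReal.tendsto _).comp (tendsto_tailRatio hN ht hκN hκ))
    (Complex.ofReal_ne_zero.2 h0)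
  convert! h1 using 2
  · simp only [evenTerm, Pi.div_apply, Function.comp_apply]
    ring
  · rw [softHardEdgeDeriv, Real.sqrt_div (erfc_pos _).le, Real.sqrt_mul two_pos.le]
    have h7 : (√Real.pi : ℂ) ≠ 0 := Complex.ofReal_ne_zero.2 (Real.sqrt_pos.2 Real.pi_pos).ne'
    have h8 : ((√(2 : ℝ) : ℝ) : ℂ) ≠ 0 :=
      Complex.ofReal_ne_zero.2 (Real.sqrt_pos.2 two_pos).ne'
    have h9 := sqrt_erfc_ne_zero (2 * t)
    push_cast
    field_simp

/-- The odd term is the even one times a Wallis factor tending to `√π/2`, times `1 + z/√N`, times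
`tailRatio² / T`; the last two tend to `1`. -/
theorem tendsto_oddTerm (hN : Tendsto N l atTop) (hz : Tendsto z l (𝓝 z₀)) (ht : t < 0)
    (hκN : ∀ᶠ i in l, κ i < N i)
    (hκ : Tendsto (fun i => ((κ i : ℝ) - N i) / (2 * √(N i))) l (𝓝 t)) :
    Tendsto (fun i => (2 * √(N i) : ℂ) * oddTerm (N i) (κ i) (z i)) l
      (𝓝 ((√Real.pi / 2 : ℂ) * (Complex.exp (z₀ ^ 2) * softHardEdgeDeriv z₀ t))) := by
  have hS := tendsto_tailRatio hN ht hκN hκ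
  have hT := (tendsto_poissonTail_even_odd hN ht hκN hκ).2
  have he := half_pos (erfc_pos (2 * t))
  have hST : Tendsto (fun i => ((tailRatio (N i) (κ i) ^ 2 / poissonTail (N i) (2 * κ i + 1) : ℝ)
      : ℂ)) l (𝓝 ((1 : ℝ) : ℂ)) := by
    refine (Complex.continuous_ofReal.tendsto _).comp ?_
    have h := (hS.pow 2).div hT he.ne'
    rwa [Real.sq_sqrt he.le, div_self he.ne'] at h
  have hv : Tendsto (fun i => ((wallisTerm (κ i) * √(N i) : ℝ) : ℂ)) l
      (𝓝 ((√Real.pi / 2 : ℝ) : ℂ)) :=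
    (Complex.continuous_ofReal.tendsto _).comp (tendsto_wallisTerm hN hκ)
  have hu : Tendsto (fun i => 1 + z i / (√(N i) : ℂ)) l (𝓝 (1 + 0)) :=
    (tendsto_div_sqrt hN hz).const_add 1
  have h := ((hv.mul hu).mul (tendsto_evenTerm hN hz ht hκN hκ)).mul hST
  rw [add_zero, mul_one, Complex.ofReal_one, mul_one] at h
  push_cast at h
  refine h.congr' ?_
  filter_upwards [hN.eventually_ge_atTop 1] with i hi
  have h1 : (tailRatio (N i) (κ i) : ℂ) ≠ 0 :=
    Complex.ofReal_ne_zero.2 (tailRatio_pos (by omega) _).ne'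
  have h2 : ((√(N i : ℝ) : ℝ) : ℂ) ≠ 0 := by
    rw [Complex.ofReal_ne_zero, Real.sqrt_ne_zero']; exact_mod_cast hi
  have h3 : (poissonTail (N i) (2 * κ i + 1) : ℂ) ≠ 0 :=
    Complex.ofReal_ne_zero.2 (poissonTail_pos (by omega) _).ne'
  rw [evenTerm, oddTerm]
  push_cast
  field_simp

theorem eventually_evenTerm_le (hN : Tendsto N l atTop) (hz : Tendsto z l (𝓝 z₀)) :
    ∀ᶠ i in l, ∀ k < N i, ‖evenTerm (N i) k (z i)‖ * √(N i) ≤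
      2 * Real.exp ((‖z₀‖ + 1) ^ 2) * Real.exp ((1 + 2 * (‖z₀‖ + 1)) * (((N i : ℝ) - k) / √(N i)) -
        (((N i : ℝ) - k) / √(N i)) ^ 2 / 2) := by
  have hzb : ∀ᶠ i in l, ‖z i‖ ≤ ‖z₀‖ + 1 :=
    hz.norm.eventually (ge_mem_nhds (by linarith))
  filter_upwards [eventually_tail_bounds hN, hzb] with i hi hzi k hk
  obtain ⟨-, h1, -⟩ := hi k hk
  have hx : 0 ≤ ((N i : ℝ) - k) / √(N i) := by
    have : (k : ℝ) ≤ N i := by exact_mod_cast hk.le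
    exact div_nonneg (by linarith) (Real.sqrt_nonneg _)
  have hSpos : 0 < tailRatio (N i) k := by linarith
  rw [evenTerm, norm_div, Complex.norm_real, Real.norm_of_nonneg hSpos.le, div_mul_eq_mul_div,
    div_le_iff₀ hSpos]
  have h2 := norm_expTerm_mul_sqrt_le hk (z i)
  set x := ((N i : ℝ) - k) / √(N i)
  have h3 : Real.exp (‖z i‖ ^ 2) * Real.exp ((1 + 2 * ‖z i‖) * x - x ^ 2 / 2) ≤
      Real.exp ((‖z₀‖ + 1) ^ 2) * Real.exp ((1 + 2 * (‖z₀‖ + 1)) * x - x ^ 2 / 2) := by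
    gcongr
  have h4 : 0 ≤ Real.exp ((‖z₀‖ + 1) ^ 2) *
      Real.exp ((1 + 2 * (‖z₀‖ + 1)) * x - x ^ 2 / 2) := by positivity
  nlinarith

theorem eventually_oddTerm_le (hN : Tendsto N l atTop) (hz : Tendsto z l (𝓝 z₀)) :
    ∀ᶠ i in l, ∀ k < N i, ‖oddTerm (N i) k (z i)‖ * √(N i) ≤
      32 * (‖z₀‖ + 2) * Real.exp ((‖z₀‖ + 1) ^ 2) *
        Real.exp ((2 + 2 * (‖z₀‖ + 1)) * (((N i : ℝ) - k) / √(N i)) -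
        (((N i : ℝ) - k) / √(N i)) ^ 2 / 2) := by
  have hzb : ∀ᶠ i in l, ‖z i‖ ≤ ‖z₀‖ + 1 :=
    hz.norm.eventually (ge_mem_nhds (by linarith))
  filter_upwards [eventually_tail_bounds hN, hzb, hN.eventually_ge_atTop 1] with i hi hzi hi1 k hk
  obtain ⟨h1, h1', h1''⟩ := hi k hk
  have hx : 0 ≤ ((N i : ℝ) - k) / √(N i) := by
    have : (k : ℝ) ≤ N i := by exact_mod_cast hk.le
    exact div_nonneg (by linarith) (Real.sqrt_nonneg _)
  have hr : 1 ≤ √(N i : ℝ) := Real.one_le_sqrt.2 (by exact_mod_cast hi1)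
  have h2 := norm_expTerm_mul_sqrt_le hk (z i)
  have hw := wallisTerm_mul_sqrt_le hk
  set x := ((N i : ℝ) - k) / √(N i)
  have h3 : Real.exp (‖z i‖ ^ 2) * Real.exp ((1 + 2 * ‖z i‖) * x - x ^ 2 / 2) ≤
      Real.exp ((‖z₀‖ + 1) ^ 2) * Real.exp ((1 + 2 * (‖z₀‖ + 1)) * x - x ^ 2 / 2) := by
    gcongr
  -- The bounds `2` above and `1/4` below give `8`; with the Wallis constant `4` this makes the
  -- `32`.
  have hST : tailRatio (N i) k / poissonTail (N i) (2 * k + 1) ≤ 8 := by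
    rw [div_le_iff₀ (by linarith)]
    linarith
  have hST0 : 0 ≤ tailRatio (N i) k / poissonTail (N i) (2 * k + 1) :=
    div_nonneg (by linarith) (by linarith)
  have h4 : wallisTerm k * ‖(√(N i) : ℂ) + z i‖ ≤ 4 * Real.exp x * (‖z₀‖ + 2) := by
    have h5 : ‖(√(N i) : ℂ) + z i‖ ≤ √(N i) * (‖z₀‖ + 2) := by
      refine (norm_add_le _ _).trans ?_
      rw [Complex.norm_real, Real.norm_of_nonneg (Real.sqrt_nonneg _)]
      nlinarith [norm_nonneg z₀]
    calc wallisTerm k * ‖(√(N i) : ℂ) + z i‖ ≤ wallisTerm k * (√(N i) * (‖z₀‖ + 2)) :=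
          mul_le_mul_of_nonneg_left h5 (wallisTerm_nonneg k)
      _ = wallisTerm k * √(N i) * (‖z₀‖ + 2) := by ring
      _ ≤ _ := mul_le_mul_of_nonneg_right hw (by positivity)
  rw [oddTerm, norm_mul, norm_mul, norm_mul, Complex.norm_real, Complex.norm_real,
    Real.norm_of_nonneg (wallisTerm_nonneg k), Real.norm_of_nonneg hST0]
  calc wallisTerm k * ‖(√(N i) : ℂ) + z i‖ * ‖expTerm (N i) k (z i)‖ *
        (tailRatio (N i) k / poissonTail (N i) (2 * k + 1)) * √(N i)
      = (wallisTerm k * ‖(√(N i) : ℂ) + z i‖) * (‖expTerm (N i) k (z i)‖ * √(N i)) *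
        (tailRatio (N i) k / poissonTail (N i) (2 * k + 1)) := by ring
    _ ≤ (4 * Real.exp x * (‖z₀‖ + 2)) * (Real.exp ((‖z₀‖ + 1) ^ 2) *
          Real.exp ((1 + 2 * (‖z₀‖ + 1)) * x - x ^ 2 / 2)) * 8 := by
        have := h2.trans h3
        have := wallisTerm_nonneg k
        gcongr
    _ = 32 * (‖z₀‖ + 2) * Real.exp ((‖z₀‖ + 1) ^ 2) *
          (Real.exp x * Real.exp ((1 + 2 * (‖z₀‖ + 1)) * x - x ^ 2 / 2)) := by ring
    _ = _ := by
        rw [← Real.exp_add]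
        ring_nf

theorem tendsto_sum_evenTerm (hN : Tendsto N l atTop) (hz : Tendsto z l (𝓝 z₀)) (ht : t < 0)
    (hκN : ∀ᶠ i in l, κ i < N i)
    (hκ : Tendsto (fun i => ((κ i : ℝ) - N i) / (2 * √(N i))) l (𝓝 t)) :
    Tendsto (fun i => ∑ k ∈ range (κ i + 1), evenTerm (N i) k (z i)) l
      (𝓝 (Complex.exp (z₀ ^ 2) * softHardEdgeFun z₀ t)) := by
  rw [softHardEdgeFun_eq, ← integral_const_mul]
  refine tendsto_sum_of_gaussian_bound hN ht.le (by positivity) (by positivity)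
    (hκN.mono fun i hi => hi) ?_ (eventually_evenTerm_le hN hz)
    fun s hs κ' h1 h2 => tendsto_evenTerm hN hz hs h1 h2
  -- The upper limit is `κ + 1`, a shift by half a mesh unit `1/√N` that disappears in the limit.
  have h1 := hκ.add ((tendsto_sqrt_natCast hN).inv_tendsto_atTop.const_mul (1 / 2))
  rw [mul_zero, add_zero] at h1
  refine h1.congr fun i => ?_
  simp only [Pi.inv_apply]
  push_cast
  ring

/-- The Gaussian majorants of the terms themselves form a convergent Riemann sum, so their total is
eventually bounded, uniformly in the length of the partial sum. -/
theorem eventually_sum_norm_evenTerm_le (hN : Tendsto N l atTop) (hz : Tendsto z l (𝓝 z₀)) :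
    ∃ K : ℝ, 0 ≤ K ∧ ∀ᶠ i in l, ∀ n ≤ N i, ‖∑ k ∈ range n, evenTerm (N i) k (z i)‖ ≤ K := by
  set C := 2 * Real.exp ((‖z₀‖ + 1) ^ 2) with hC
  set D := 1 + 2 * (‖z₀‖ + 1) with hD
  have hD0 : 0 ≤ D := by positivity
  have hC0 : 0 ≤ C := by positivity
  let B : ι → ℕ → ℝ := fun i k => C * Real.exp (D * (((N i : ℝ) - k) / √(N i)) -
        (((N i : ℝ) - k) / √(N i)) ^ 2 / 2) / √(N i)
  have hr (i : ι) (hi : 1 ≤ N i) : 0 < √(N i : ℝ) := Real.sqrt_pos.2 (by exact_mod_cast hi)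
  have key := tendsto_sum_of_gaussian_bound (l := l) (n := N) (F := fun i k => (B i k : ℂ))
    (G := fun t => ((2 * C * Real.exp (D * (-2 * t) - (-2 * t) ^ 2 / 2) : ℝ) : ℂ))
    (τ := 0) (C := C) (D := D) hN le_rfl hC0 hD0 (Eventually.of_forall fun i => le_rfl)
    (by simpa using tendsto_const_nhds)
    (by
      filter_upwards [hN.eventually_ge_atTop 1] with i hi k hk
      have hb : 0 ≤ B i k := by simp only [B]; positivity
      rw [Complex.norm_real, Real.norm_of_nonneg hb]
      exact (div_mul_cancel₀ _ (hr i hi).ne').le)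
    (by
      intro t _ κ _ hκ
      have hx := tendsto_sub_div_sqrt hκ
      have h1 : Tendsto (fun i => 2 * C * Real.exp (D * (((N i : ℝ) - κ i) / √(N i)) -
          (((N i : ℝ) - κ i) / √(N i)) ^ 2 / 2)) l
          (𝓝 (2 * C * Real.exp (D * (-2 * t) - (-2 * t) ^ 2 / 2))) :=
        ((Real.continuous_exp.tendsto _).comp
          ((hx.const_mul D).sub ((hx.pow 2).div_const 2))).const_mul (2 * C)
      refine ((Complex.continuous_ofReal.tendsto _).comp h1).congr' ?_
      filter_upwards [hN.eventually_ge_atTop 1] with i hi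
      have := Complex.ofReal_ne_zero.2 (hr i hi).ne'
      simp only [Function.comp_apply, B]
      push_cast
      field_simp)
  have h2 := key.norm
  set L := ‖∫ t in Set.Iio (0 : ℝ),
    ((2 * C * Real.exp (D * (-2 * t) - (-2 * t) ^ 2 / 2) : ℝ) : ℂ)‖
  refine ⟨L + 1, by positivity, ?_⟩
  filter_upwards [h2.eventually (ge_mem_nhds (lt_add_one L)), eventually_evenTerm_le hN hz,
    hN.eventually_ge_atTop 1] with i h3 h4 hi n hn
  refine le_trans ?_ h3
  rw [← Complex.ofReal_sum, Complex.norm_real]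
  refine le_trans ?_ (le_abs_self _)
  refine (norm_sum_le _ _).trans ?_
  refine (sum_le_sum_of_subset_of_nonneg (range_mono hn) fun _ _ _ => norm_nonneg _).trans ?_
  refine sum_le_sum fun k hk => ?_
  rw [le_div_iff₀ (hr i hi)]
  exact h4 k (mem_range.1 hk)

/-- A second use of the Riemann-sum lemma: inner partial sums are bounded uniformly and converge to
`e^{w²} f_w(t)`, while the odd terms supply the Gaussian bound and the derivative in the Wronskian.
-/
theorem tendsto_rescaledPreKernel (hN : Tendsto N l atTop) (hz : Tendsto z l (𝓝 z₀))
    (hw : Tendsto w l (𝓝 w₀)) :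
    Tendsto (fun i => rescaledPreKernel (N i) (z i) (w i)) l
      (𝓝 (wronskianPreKernel (Set.Iio 0) softHardEdgeFun z₀ w₀)) := by
  obtain ⟨K₁, hK₁, hU₁⟩ := eventually_sum_norm_evenTerm_le hN hz
  obtain ⟨K₂, hK₂, hU₂⟩ := eventually_sum_norm_evenTerm_le hN hw
  set B := max ‖z₀‖ ‖w₀‖ with hB
  have hB1 : ‖z₀‖ ≤ B := le_max_left _ _
  have hB2 : ‖w₀‖ ≤ B := le_max_right _ _
  have hB0 : 0 ≤ B := (norm_nonneg _).trans hB1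
  have hlim : wronskianPreKernel (Set.Iio 0) softHardEdgeFun z₀ w₀ =
      2 * ∫ t in Set.Iio (0 : ℝ),
        ((√Real.pi / 2 : ℂ) * (Complex.exp (z₀ ^ 2) * softHardEdgeDeriv z₀ t) *
          (Complex.exp (w₀ ^ 2) * softHardEdgeFun w₀ t) -
        (√Real.pi / 2 : ℂ) * (Complex.exp (w₀ ^ 2) * softHardEdgeDeriv w₀ t) *
          (Complex.exp (z₀ ^ 2) * softHardEdgeFun z₀ t)) := by
    rw [wronskianPreKernel, ← integral_const_mul, ← integral_const_mul]
    congr 1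
    ext t
    rw [wronskian, deriv_softHardEdgeFun, deriv_softHardEdgeFun, Complex.exp_add]
    ring
  rw [hlim]
  unfold rescaledPreKernel
  refine Tendsto.const_mul 2 ?_
  refine tendsto_sum_of_gaussian_bound hN le_rfl
    (C := 32 * (B + 2) * Real.exp ((B + 1) ^ 2) * (K₁ + K₂)) (D := 2 + 2 * (B + 1))
    (by positivity) (by positivity) (Eventually.of_forall fun i => le_rfl)
    (by simpa using tendsto_const_nhds) ?_ ?_
  · filter_upwards [eventually_oddTerm_le hN hz, eventually_oddTerm_le hN hw, hU₁, hU₂]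
      with i h1 h2 h3 h4 k hk
    have hx : 0 ≤ ((N i : ℝ) - k) / √(N i) := by
      have : (k : ℝ) ≤ N i := by exact_mod_cast hk.le
      exact div_nonneg (by linarith) (Real.sqrt_nonneg _)
    have h1' := h1 k hk
    have h2' := h2 k hk
    set x := ((N i : ℝ) - k) / √(N i)
    have mono {a : ℝ} (ha0 : 0 ≤ a) (ha : a ≤ B) :
        32 * (a + 2) * Real.exp ((a + 1) ^ 2) * Real.exp ((2 + 2 * (a + 1)) * x - x ^ 2 / 2) ≤
        32 * (B + 2) * Real.exp ((B + 1) ^ 2) * Real.exp ((2 + 2 * (B + 1)) * x - x ^ 2 / 2) := by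
      gcongr
    have h1'' := h1'.trans (mono (norm_nonneg _) hB1)
    have h2'' := h2'.trans (mono (norm_nonneg _) hB2)
    set Y := 32 * (B + 2) * Real.exp ((B + 1) ^ 2) *
      Real.exp ((2 + 2 * (B + 1)) * x - x ^ 2 / 2) with hY
    have h3' := h3 (k + 1) hk
    have h4' := h4 (k + 1) hk
    have hY0 : 0 ≤ Y := by positivity
    calc _ ≤ (‖oddTerm (N i) k (z i)‖ * ‖∑ l ∈ range (k + 1), evenTerm (N i) l (w i)‖ +
          ‖oddTerm (N i) k (w i)‖ * ‖∑ l ∈ range (k + 1), evenTerm (N i) l (z i)‖) * √(N i) := by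
          refine mul_le_mul_of_nonneg_right ?_ (Real.sqrt_nonneg _)
          refine (norm_sub_le _ _).trans_eq ?_
          rw [norm_mul, norm_mul]
      _ = (‖oddTerm (N i) k (z i)‖ * √(N i)) * ‖∑ l ∈ range (k + 1), evenTerm (N i) l (w i)‖ +
          (‖oddTerm (N i) k (w i)‖ * √(N i)) * ‖∑ l ∈ range (k + 1), evenTerm (N i) l (z i)‖ := by
          ring
      _ ≤ Y * K₂ + Y * K₁ := by gcongr
      _ = _ := by rw [hY]; ring
  · intro t ht κ h1 h2
    have h3 := ((tendsto_oddTerm hN hz ht h1 h2).mul (tendsto_sum_evenTerm hN hw ht h1 h2)).sub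
      ((tendsto_oddTerm hN hw ht h1 h2).mul (tendsto_sum_evenTerm hN hz ht h1 h2))
    refine h3.congr fun i => ?_
    ring

end Limits

end PlanarSymplectic

end

/-! ### Rescaling at the edge and locally uniform convergence -/

noncomputable section

namespace PlanarSymplectic

open Finset MeasureTheory Filter Topology

/-- Continuity of `f` is not assumed: near `x` the values `F n y` are close to `f x` for all large
`n`, and letting `n` tend to infinity with `y` fixed makes `f y` close to `f x`. -/
theorem tendstoLocallyUniformlyOn_of_tendsto_prod {X : Type*} [TopologicalSpace X] {S : Set X}
    {F : ℕ → X → ℂ} {f : X → ℂ}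
    (h : ∀ x ∈ S, Tendsto (fun q : ℕ × X => F q.1 q.2) (atTop ×ˢ 𝓝[S] x) (𝓝 (f x))) :
    TendstoLocallyUniformlyOn F f atTop S := by
  rw [Metric.tendstoLocallyUniformlyOn_iff]
  intro ε hε x hx
  have h1 := Metric.tendsto_nhds.1 (h x hx) (ε / 4) (by positivity)
  obtain ⟨p, hp, q, hq, hpq⟩ := eventually_prod_iff.1 h1
  refine ⟨{y | q y} ∩ S, inter_mem hq self_mem_nhdsWithin, hp.mono fun n hn y hy => ?_⟩
  have h2 : Tendsto (fun m => F m y) atTop (𝓝 (f y)) :=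
    (h y hy.2).comp (tendsto_id.prodMk (tendsto_const_pure.mono_right (pure_le_nhdsWithin hy.2)))
  have h3 : dist (f y) (f x) ≤ ε / 4 := by
    refine le_of_tendsto (h2.dist tendsto_const_nhds) ?_
    filter_upwards [hp] with m hm using (hpq hm hy.1).le
  have h4 := hpq hn hy.1
  calc dist (f y) (F n y) ≤ dist (f y) (f x) + dist (F n y) (f x) := dist_triangle_right _ _ _
    _ < ε := by linarith

theorem softHardPotential_ne_top_iff (ζ : ℂ) :
    softHardPotential ζ ≠ ⊤ ↔ ζ ∈ Metric.closedBall (0 : ℂ) √2 := by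
  rw [mem_closedBall_zero_iff, softHardPotential]
  split_ifs with h
  · simp only [h, iff_true]
    exact EReal.coe_ne_top _
  · simp [h]

/-- A closed disc is convex with nonempty interior, so derivatives within it are unique even on the
wall and agree with those of `|ζ|²`. -/
theorem ddbar_softHardPotential {p : ℂ} (hp : ‖p‖ ≤ √2) : ddbar softHardPotential p = 1 := by
  have hs : {ζ | softHardPotential ζ ≠ ⊤} = Metric.closedBall (0 : ℂ) √2 := by
    ext ζ; exact softHardPotential_ne_top_iff ζ
  have hpos : (0 : ℝ) < √2 := Real.sqrt_pos.2 two_pos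
  have hu : UniqueDiffOn ℝ (Metric.closedBall (0 : ℂ) √2) := by
    refine uniqueDiffOn_convex (convex_closedBall _ _) ?_
    rw [interior_closedBall _ hpos.ne']
    exact ⟨0, by simp⟩
  have hmem : p ∈ Metric.closedBall (0 : ℂ) √2 := by simpa using hp
  have hcongr : Set.EqOn (fun ζ => (softHardPotential ζ).toReal) (fun ζ : ℂ => ‖ζ‖ ^ 2)
      (Metric.closedBall (0 : ℂ) √2) := by
    intro ζ hζ
    rw [mem_closedBall_zero_iff] at hζ
    simp only [softHardPotential, if_pos hζ]
    exact EReal.toReal_coe _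
  have hval (v : ℂ) : iteratedFDerivWithin ℝ 2 (fun ζ => (softHardPotential ζ).toReal)
      (Metric.closedBall (0 : ℂ) √2) p ![v, v] = 2 * ‖v‖ ^ 2 := by
    rw [iteratedFDerivWithin_congr hcongr hmem,
      iteratedFDerivWithin_eq_iteratedFDeriv hu (contDiff_norm_sq ℝ).contDiffAt hmem,
      iteratedFDeriv_two_apply]
    have h1 : fderiv ℝ (fun ζ : ℂ => ‖ζ‖ ^ 2) = fun x => (2 • innerSL ℝ : ℂ →L[ℝ] ℂ →L[ℝ] ℝ) x := by
      ext x y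
      rw [fderiv_norm_sq_apply]
      rfl
    rw [h1, ContinuousLinearMap.fderiv]
    change 2 • inner ℝ v v = 2 * ‖v‖ ^ 2
    rw [real_inner_self_eq_norm_sq, nsmul_eq_mul, Nat.cast_ofNat]
  rw [ddbar, hs, InnerProductSpace.laplacianWithin_eq_iteratedFDerivWithin_complexPlane _ hu hmem,
    hval, hval]
  simp
  norm_num

theorem microScale_softHardPotential (N : ℕ) {p : ℂ} (hp : ‖p‖ ≤ √2) :
    microScale N softHardPotential p = √2 / √N := by
  rw [microScale, ddbar_softHardPotential hp, mul_one_div, Real.sqrt_div (Nat.cast_nonneg N),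
    one_div_div]

/-- Every index occurs exactly once in each term of the Pfaffian, so all terms share the factor `∏
d`. -/
theorem pfaffian_mul_mul {k : ℕ} (c : ℂ) (d : Fin k × Fin 2 → ℂ)
    (K : Fin k × Fin 2 → Fin k × Fin 2 → ℂ) :
    pfaffian (Matrix.of fun x y => c * (d x * d y) * K x y) =
      c ^ k * (∏ x, d x) * pfaffian (Matrix.of K) := by
  simp_rw [mul_assoc c]
  rw [pfaffian_smul c fun x y => (d x * d y) * K x y, mul_assoc]
  congr 1
  simp only [pfaffian, Matrix.of_apply]
  rw [mul_left_comm, mul_sum univ _ (∏ x, d x)]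
  congr 1
  refine sum_congr rfl fun σ _ => ?_
  rw [prod_mul_distrib, ← Equiv.prod_comp σ d, Fintype.prod_prod_type]
  simp only [Fin.prod_univ_two]
  ring

theorem pfaffianMatrix_eq (κ : ℂ → ℂ → ℂ) {k : ℕ} (z : Fin k → ℂ) :
    pfaffianMatrix κ z = Matrix.of fun r c =>
      Complex.exp (-((‖z r.1‖ : ℂ) ^ 2) - (‖z c.1‖ : ℂ) ^ 2) *
        κ (doubledConfig z r) (doubledConfig z c) := by
  ext ⟨r, i⟩ ⟨c, j⟩
  fin_cases i <;> fin_cases j <;> simp [pfaffianMatrix, doubledConfig]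

/-- The polynomials have definite parity; this reduces the edge `-√2` to `√2`. -/
theorem finitePreKernel_sign_mul (N : ℕ) {ε : ℂ} (hε : ε ^ 2 = 1) (a b : ℂ) :
    finitePreKernel N (ε * a) (ε * b) = ε * finitePreKernel N a b := by
  have h1 (s : ℕ) (a : ℂ) : (skewPoly (diskMoment N) s 1).eval (ε * a) =
      ε * (skewPoly (diskMoment N) s 1).eval a := by
    rw [eval_skewPoly_one, eval_skewPoly_one, mul_pow, pow_succ, pow_mul, hε]
    simp
  have h0 (s : ℕ) (a : ℂ) : (skewPoly (diskMoment N) s 0).eval (ε * a) =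
      (skewPoly (diskMoment N) s 0).eval a := by
    rw [eval_skewPoly, eval_skewPoly]
    refine sum_congr rfl fun l _ => ?_
    rw [mul_pow, Fin.val_zero, add_zero, pow_mul ε, hε, one_pow, one_mul]
  simp only [finitePreKernel, h1, h0, mul_sum]
  exact sum_congr rfl fun s _ => by ring

theorem norm_sqrt_add_div_sq {N : ℕ} (hN : N ≠ 0) (z : ℂ) :
    N * ‖(√2 * (√N + z) / √N : ℂ)‖ ^ 2 = 2 * N + 4 * √N * z.re + 2 * ‖z‖ ^ 2 := by
  have hN' : (0 : ℝ) < N := by exact_mod_cast Nat.pos_of_ne_zero hN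
  have hr : √(N : ℝ) ^ 2 = N := Real.sq_sqrt hN'.le
  rw [norm_div, norm_mul, Complex.norm_real, Complex.norm_real,
    Real.norm_of_nonneg (Real.sqrt_nonneg _), Real.norm_of_nonneg (Real.sqrt_nonneg _), div_pow,
    mul_pow, Real.sq_sqrt two_pos.le, hr, ← Complex.normSq_eq_norm_sq, ← Complex.normSq_eq_norm_sq,
    Complex.normSq_add, Complex.normSq_ofReal, Complex.re_ofReal_mul, Complex.conj_re, ← pow_two, hr]
  field_simp
  ring

/-- The hypothesis on `z` says that the points lie in the disc. There the weight factors over `z_j`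
and `z̄_j`, and conjugating the kernel by `d` absorbs it. -/
theorem rescaledCorrFun_eq_pfaffianCorrFun {N k : ℕ} (hN : N ≠ 0) (hk : k ≤ N) {p θ : ℝ}
    (hp : p = √2 ∨ p = -√2) (hθ : Complex.exp (θ * Complex.I) = (p : ℂ) / (|p| : ℝ))
    {z : Fin k → ℂ} (hz : ∀ j, 2 * √N * (z j).re + ‖z j‖ ^ 2 ≤ 0) :
    (rescaledCorrFun N softHardPotential p θ k z : ℂ) =
      pfaffianCorrFun (rescaledPreKernel N) k z := by
  have h2pos : (0 : ℝ) < √2 := Real.sqrt_pos.2 two_pos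
  have h2ne : ((√2 : ℝ) : ℂ) ≠ 0 := Complex.ofReal_ne_zero.2 h2pos.ne'
  have hN' : (0 : ℝ) < N := by exact_mod_cast Nat.pos_of_ne_zero hN
  have hNne : ((√N : ℝ) : ℂ) ≠ 0 := Complex.ofReal_ne_zero.2 (Real.sqrt_pos.2 hN').ne'
  obtain ⟨ε, hε, hεp, hεθ⟩ : ∃ ε : ℝ, ε ^ 2 = 1 ∧ p = ε * √2 ∧
      Complex.exp (θ * Complex.I) = ε := by
    rcases hp with rfl | rfl
    · refine ⟨1, by norm_num, by ring, ?_⟩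
      rw [hθ, abs_of_pos h2pos, div_self h2ne, Complex.ofReal_one]
    · refine ⟨-1, by norm_num, by ring, ?_⟩
      rw [hθ, abs_neg, abs_of_pos h2pos, Complex.ofReal_neg, neg_div, div_self h2ne]
      simp
  have hεC : (ε : ℂ) ^ 2 = 1 := by rw [← Complex.ofReal_pow, hε, Complex.ofReal_one]
  have hpn : ‖(p : ℂ)‖ ≤ √2 := by
    rw [Complex.norm_real, Real.norm_eq_abs]
    rcases hp with rfl | rfl <;> simp [abs_of_pos h2pos]
  have hpt (a : ℂ) : (p : ℂ) + ε * ((√2 / √N : ℝ) : ℂ) * a = ε * (√2 * (√N + a) / √N) := by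
    rw [hεp]
    push_cast
    field_simp
  have hdc (x : Fin k × Fin 2) :
      doubledConfig (fun j => (ε : ℂ) * (√2 * (√N + z j) / √N)) x =
        ε * (√2 * (√N + doubledConfig z x) / √N) := by
    unfold doubledConfig
    split_ifs <;> simp
  rw [rescaledCorrFun, microScale_softHardPotential N hpn, hεθ]
  simp_rw [hpt]
  rw [Complex.ofReal_mul, corrFun_eq_pfaffian hN hk]
  simp_rw [hdc, finitePreKernel_sign_mul N hεC]
  rw [pfaffian_smul (ε : ℂ) fun x y => finitePreKernel N
    (√2 * (√N + doubledConfig z x) / √N) (√2 * (√N + doubledConfig z y) / √N),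
    pfaffianCorrFun, pfaffianMatrix_eq]
  set d : Fin k × Fin 2 → ℂ := fun x => Complex.exp (-((‖z x.1‖ : ℂ) ^ 2)) *
    Complex.exp (-N - 2 * √N * doubledConfig z x) with hd
  have hmat (x y : Fin k × Fin 2) : Complex.exp (-((‖z x.1‖ : ℂ) ^ 2) - (‖z y.1‖ : ℂ) ^ 2) *
        rescaledPreKernel N (doubledConfig z x) (doubledConfig z y) =
      (2 * √2 / √N ^ 3 : ℂ) * (d x * d y) * finitePreKernel N
        (√2 * (√N + doubledConfig z x) / √N) (√2 * (√N + doubledConfig z y) / √N) := by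
    rw [← rescaledPreKernel_eq hN, sub_eq_add_neg, Complex.exp_add]
    simp only [hd]
    ring
  simp_rw [hmat]
  rw [pfaffian_mul_mul (2 * √2 / √N ^ 3 : ℂ) d fun x y => finitePreKernel N
        (√2 * (√N + doubledConfig z x) / √N) (√2 * (√N + doubledConfig z y) / √N)]
  have hw (j : Fin k) : (diskWeight N ((ε : ℂ) * (√2 * (√N + z j) / √N)) : ℂ) =
      d (j, 0) * d (j, 1) := by
    have hεn : ‖(ε : ℂ)‖ = 1 := by
      rw [Complex.norm_real, ← abs_one, Real.norm_eq_abs]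
      exact (sq_eq_sq_iff_abs_eq_abs ε 1).1 (by rw [hε]; norm_num)
    have hsq := norm_sqrt_add_div_sq hN (z j)
    have hn : ‖(ε : ℂ) * (√2 * (√N + z j) / √N)‖ = ‖(√2 * (√N + z j) / √N : ℂ)‖ := by
      rw [norm_mul, hεn, one_mul]
    have hmem : (ε : ℂ) * (√2 * (√N + z j) / √N) ∈ Metric.closedBall (0 : ℂ) √2 := by
      rw [mem_closedBall_zero_iff, hn]
      apply Real.le_sqrt_of_sq_le
      have := hz j
      refine le_of_mul_le_mul_left ?_ hN'
      rw [hsq]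
      linarith
    rw [diskWeight, Set.indicator_of_mem hmem, hn, hsq]
    have hc : z j + conj (z j) = 2 * ((z j).re : ℂ) := by
      rw [Complex.add_conj]; push_cast; rfl
    simp only [hd, doubledConfig, if_true, one_ne_zero, if_false]
    push_cast
    rw [← Complex.exp_add, ← Complex.exp_add, ← Complex.exp_add]
    congr 1
    linear_combination (2 * (√N : ℂ)) * hc
  have hprod : ∏ j, (conj ((ε : ℂ) * (√2 * (√N + z j) / √N)) - ε * (√2 * (√N + z j) / √N)) *
      (diskWeight N ((ε : ℂ) * (√2 * (√N + z j) / √N)) : ℂ) =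
      ((ε : ℂ) * (√2 / √N)) ^ k * (∏ j, (conj (z j) - z j)) * ∏ x, d x := by
    have : ((ε : ℂ) * (√2 / √N)) ^ k = ∏ _j : Fin k, ((ε : ℂ) * (√2 / √N)) := by simp
    rw [this, ← prod_mul_distrib, Fintype.prod_prod_type, ← prod_mul_distrib]
    refine prod_congr rfl fun j _ => ?_
    rw [hw, Fin.prod_univ_two]
    simp only [map_mul, map_div₀, map_add, Complex.conj_ofReal]
    field_simp
    ring
  rw [hprod]
  -- Per particle, two powers of the microscopic scale come from the Jacobian and one from rescaling
  -- `ζ̄ - ζ`.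
  have hc1 : (2 * √2 / √N ^ 3 : ℂ) ^ k = ((√2 / √N : ℂ) ^ 2) ^ k * (√2 / √N) ^ k := by
    rw [← mul_pow]
    congr 1
    have : ((√2 : ℝ) : ℂ) ^ 2 = 2 := by
      rw [← Complex.ofReal_pow, Real.sq_sqrt two_pos.le]; simp
    rw [div_pow, this]
    field_simp
  have hc2 : (ε : ℂ) ^ k * (ε : ℂ) ^ k = 1 := by rw [← mul_pow, ← pow_two, hεC, one_pow]
  rw [hc1, mul_pow, ← pow_mul]
  push_cast
  generalize pfaffian _ = P
  linear_combination ((√2 / √N : ℂ) ^ (2 * k) * (√2 / √N : ℂ) ^ k *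
    (∏ j, (conj (z j) - z j)) * (∏ x, d x) * P) * hc2

theorem tendsto_pfaffianCorrFun {ι : Type*} {l : Filter ι} [l.IsCountablyGenerated] {N : ι → ℕ}
    (hN : Tendsto N l atTop) {k : ℕ} {z : ι → Fin k → ℂ} {z₀ : Fin k → ℂ}
    (hz : Tendsto z l (𝓝 z₀)) :
    Tendsto (fun i => pfaffianCorrFun (rescaledPreKernel (N i)) k (z i)) l
      (𝓝 (pfaffianCorrFun (wronskianPreKernel (Set.Iio 0) softHardEdgeFun) k z₀)) := by
  have hzj (j : Fin k) : Tendsto (fun i => z i j) l (𝓝 (z₀ j)) := (tendsto_pi_nhds.1 hz) j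
  have hcj (j : Fin k) : Tendsto (fun i => conj (z i j)) l (𝓝 (conj (z₀ j))) :=
    (Complex.continuous_conj.tendsto _).comp (hzj j)
  have hd (x : Fin k × Fin 2) :
      Tendsto (fun i => doubledConfig (z i) x) l (𝓝 (doubledConfig z₀ x)) := by
    unfold doubledConfig
    split_ifs
    · exact hzj _
    · exact hcj _
  have hnorm (j : Fin k) : Tendsto (fun i => ((‖z i j‖ : ℂ)) ^ 2) l (𝓝 ((‖z₀ j‖ : ℂ) ^ 2)) :=
    ((Complex.continuous_ofReal.tendsto _).comp (hzj j).norm).pow 2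
  simp only [pfaffianCorrFun, pfaffianMatrix_eq, pfaffian, Matrix.of_apply]
  refine (tendsto_finsetProd _ fun j _ => (hcj j).sub (hzj j)).mul (Tendsto.const_mul _ ?_)
  refine tendsto_finsetSum _ fun σ _ => Tendsto.const_mul _ ?_
  refine tendsto_finsetProd _ fun j _ => ?_
  refine Tendsto.mul ?_ (tendsto_rescaledPreKernel hN (hd _) (hd _))
  exact (Complex.continuous_exp.tendsto _).comp ((hnorm _).neg.sub (hnorm _))

end PlanarSymplectic

end

/-! ### The scaling limit -/

theorem mainTheorem3 (p : ℝ) (hp : p = √2 ∨ p = -√2) (θ : ℝ)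
    (hθ : Complex.exp (θ * Complex.I) = (p : ℂ) / (|p| : ℝ)) (k : ℕ) :
    TendstoLocallyUniformlyOn
      (fun (N : ℕ) (z : Fin k → ℂ) =>
        ((PlanarSymplectic.rescaledCorrFun N PlanarSymplectic.softHardPotential p θ k z : ℝ) : ℂ))
      (PlanarSymplectic.pfaffianCorrFun
        (PlanarSymplectic.wronskianPreKernel (Set.Iio 0) PlanarSymplectic.softHardEdgeFun) k)
      Filter.atTop
      {z : Fin k → ℂ | ∀ j, (z j).re < 0} := by
  refine PlanarSymplectic.tendstoLocallyUniformlyOn_of_tendsto_prod fun z₀ hz₀ => ?_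
  have hN : Filter.Tendsto (Prod.fst : ℕ × (Fin k → ℂ) → ℕ)
      (Filter.atTop ×ˢ nhdsWithin z₀ {z : Fin k → ℂ | ∀ j, (z j).re < 0}) Filter.atTop :=
    Filter.tendsto_fst
  have hz : Filter.Tendsto (Prod.snd : ℕ × (Fin k → ℂ) → Fin k → ℂ)
      (Filter.atTop ×ˢ nhdsWithin z₀ {z : Fin k → ℂ | ∀ j, (z j).re < 0}) (nhds z₀) :=
    Filter.tendsto_snd.mono_right nhdsWithin_le_nhds
  refine (PlanarSymplectic.tendsto_pfaffianCorrFun hN hz).congr' ?_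
  -- Here the half-plane condition enters: `2√N Re z_j` tends to `-∞` and beats the bounded
  -- `|z_j|²`, so the points are eventually inside the wall.
  have hdisk : ∀ᶠ q : ℕ × (Fin k → ℂ) in Filter.atTop ×ˢ nhdsWithin z₀ {z : Fin k → ℂ | ∀ j, (z j).re < 0},
      ∀ j, 2 * √(q.1 : ℝ) * (q.2 j).re + ‖q.2 j‖ ^ 2 ≤ 0 := by
    rw [Filter.eventually_all]
    intro j
    have hzj : Filter.Tendsto (fun q : ℕ × (Fin k → ℂ) => q.2 j)
        (Filter.atTop ×ˢ nhdsWithin z₀ {z : Fin k → ℂ | ∀ j, (z j).re < 0}) (nhds (z₀ j)) :=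
      (tendsto_pi_nhds.1 hz) j
    have h1 := ((PlanarSymplectic.tendsto_sqrt_natCast hN).const_mul_atTop two_pos).atTop_mul_neg
      (hz₀ j) ((Complex.continuous_re.tendsto _).comp hzj)
    exact (h1.atBot_add (hzj.norm.pow 2)).eventually_le_atBot 0
  filter_upwards [hdisk, hN.eventually_ge_atTop (k + 1)] with q hq hq1
  exact (PlanarSymplectic.rescaledCorrFun_eq_pfaffianCorrFun (by omega) (by omega) hp hθ hq).symm
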